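/- Let $0<m<n$ be integers. Let $\widetilde S_n$ be the affine symmetric group with simple generators $s_i$, $i\in\mathbb Z/n\mathbb Z$ (relations $s_i^2=1$; $s_is_{i+1}s_i=s_{i+1}s_is_{i+1}$ if $n\ge 3$; $s_is_j=s_js_i$ if $j\neq i\pm1$) and length function $\ell$. An element is *$0$-Grassmannian* if all its reduced words end with $s_0$ (the identity included); $\widetilde S_n^0$ is the set of these. An element is *$321$-avoiding* if none of its reduced words contains consecutive letters $s_is_{i+1}s_i$ for some $i\in\mathbb Z/n\mathbb Z$. For $J\subsetneq\mathbb Z/n\mathbb Z$ let $d_J$ (resp. $u_J$) be the product of the $s_j$, $j\in J$, each used once, in an order such that $s_{i+1}$ stands to the left (resp. right) of $s_i$ whenever $i,i+1\in J$. Let $\mathrm{maxr}(w)$ (resp. $\mathrm{maxc}(w)$) be the largest $|J|$ such that $w=vd_J$ with $\ell(w)=\ell(v)+\ell(d_J)$ (resp. $w=vu_J$ with $\ell(w)=\ell(v)+\ell(u_J)$) for some $v$. Put $$A_{(n-m,m)}=\{w\in\widetilde S_n: w\text{ is }321\text{-avoiding},\ \mathrm{maxc}(w)\le m,\ \mathrm{maxr}(w)\le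 n-m\},\qquad A^0_{(n-m,m)}=A_{(n-m,m)}\cap\widetilde S_n^0 .$$ For $w\in\widetilde S_n$ the affine Stanley symmetric function is $F_w=\sum x_1^{|J_1|}x_2^{|J_2|}\cdots$, summed over all sequences $J_1,J_2,\dots$ of proper subsets of $\mathbb Z/n\mathbb Z$, almost all empty, with $w=d_{J_1}d_{J_2}\cdots$ and $\ell(w)=\sum_i|J_i|$. The affine Schur functions are the $F_u$ with $u\in\widetilde S_n^0$. Let $\mathbb A$ be the affine nilCoxeter algebra over $\mathbb Z$, with generators $A_i$, $i\in\mathbb Z/n\mathbb Z$, satisfying $A_i^2=0$ and the same braid and commutation relations as the $s_i$; write $A_w=A_{i_1}\cdots A_{i_l}$ for a reduced word $s_{i_1}\cdots s_{i_l}$ of $w$, and $\mathbf h_i=\sum_{J\subsetneq\mathbb Z/n\mathbb Z,\,|J|=i}A_{d_J}$. Let $\mathbb A_{m,n}$ be the quotient of $\mathbb A$ by the relations $A_iA_{i+1}A_i=A_{i+1}A_iA_{i+1}=0$ for all $i$, $A_{d_J}=0$ for $|J|>n-m$, and $A_{u_J}=0$ for $|J|>m$, and let $\mathbb B_{m,n}\subseteq\mathbb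 A_{m,n}$ be the subalgebra generated by the images of $\mathbf h_1,\dots,\mathbf h_{n-m}$. For a partition $\lambda$ with $\lambda_1<n$ put $h_\lambda=h_{\lambda_1}h_{\lambda_2}\cdots\in\mathbb Z[h_1,\dots,h_{n-1}]$ and $\mathbf h_\lambda=\mathbf h_{\lambda_1}\mathbf h_{\lambda_2}\cdots$, and pair $\mathbb Z[h_1,\dots,h_{n-1}]$ with symmetric functions by $\langle h_\lambda,F\rangle=$ the coefficient of $x_1^{\lambda_1}x_2^{\lambda_2}\cdots$ in $F$ (the Hall pairing). **Theorem.** Every $F_w$, $w\in\widetilde S_n$, has a unique expansion $F_w=\sum_{u\in\widetilde S_n^0}c^w_uF_u$ as a finite integer combination of affine Schur functions, and there is a unique family $(s^{(k)}_u)_{u\in\widetilde S_n^0}$ in $\mathbb Z[h_1,\dots,h_{n-1}]$, $k=n-1$, with $\langle s^{(k)}_u,F_v\rangle=\delta_{uv}$ for all $u,v\in\widetilde S_n^0$. Let $\mathbf s^{(m,n)}_u$ be the image of $s^{(k)}_u$ under the $\mathbb Z$-linear map $h_\lambda\mapsto\mathbf h_\lambda$ followed by the projection $\mathbb A\to\mathbb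 A_{m,n}$. Then: 1. If $w$ is $321$-avoiding, then $c^w_u=0$ unless $u$ is $321$-avoiding (and $0$-Grassmannian). 2. If moreover $\mathrm{maxc}(w)\le m$ and $\mathrm{maxr}(w)\le n-m$, then $c^w_u=0$ unless $u\in A^0_{(n-m,m)}$. 3. The elements $\mathbf s^{(m,n)}_u$, $u\in A^0_{(n-m,m)}$, form a $\mathbb Z$-basis of $\mathbb B_{m,n}$. -/

import Mathlib

open Finset

noncomputable section

namespace AffineStanley

/-! ### The affine symmetric group -/

/-- The Coxeter matrix of affine type `A` with `n` nodes, indexed by `ℤ/nℤ`: cyclically adjacent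
nodes have order `3` (for `n = 2` order `∞`, encoded by `0`), other distinct nodes commute. -/
def affineMatrix (n : ℕ) : CoxeterMatrix (ZMod n) where
  M := Matrix.of fun i j =>
    if i = j then 1 else if j = i + 1 ∨ i = j + 1 then (if n = 2 then 0 else 3) else 2
  isSymm := by
    ext i j
    simp only [Matrix.transpose_apply, Matrix.of_apply]
    simp only [eq_comm (a := j) (b := i), or_comm (a := i = j + 1)]
  diagonal := by intro i; simp
  off_diagonal := by
    intro i j hij
    simp only [Matrix.of_apply, if_neg hij]
    split_ifs <;> omega

/-- The affine symmetric group on the simple generators `s_i`, `i ∈ ℤ/nℤ`. -/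
abbrev AffineSym (n : ℕ) : Type := (affineMatrix n).Group

/-- The affine symmetric group with its simple generators (length, reduced words, descents). -/
abbrev cox (n : ℕ) : CoxeterSystem (affineMatrix n) (AffineSym n) :=
  (affineMatrix n).toCoxeterSystem

/-- `0`-Grassmannian elements: every reduced word ends with `s_0` (the identity is allowed),
that is, `s_0` is the only possible right descent. -/
def IsZeroGrassmannian {n : ℕ} (w : AffineSym n) : Prop :=
  ∀ i : ZMod n, (cox n).IsRightDescent w i → i = 0

/-- `321`-avoiding elements: no reduced word has a consecutive subword `s_i s_{i+1} s_i`. -/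
def Is321Avoiding {n : ℕ} (w : AffineSym n) : Prop :=
  ∀ l : List (ZMod n), (cox n).IsReduced l → (cox n).wordProd l = w →
    ∀ i : ZMod n, ¬ [i, i + 1, i] <:+: l

/-! ### Cyclically decreasing and increasing elements -/

/-- Each letter occurs at most once and no `i + 1` stands to the right of an `i`. -/
def IsCycDecWord {n : ℕ} (l : List (ZMod n)) : Prop :=
  l.Nodup ∧ l.Pairwise fun a b => b ≠ a + 1

/-- Each letter occurs at most once and no `i + 1` stands to the left of an `i`. -/
def IsCycIncWord {n : ℕ} (l : List (ZMod n)) : Prop :=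
  l.Nodup ∧ l.Pairwise fun a b => a ≠ b + 1

theorem exists_cycDecWord {n : ℕ} [NeZero n] (J : Finset (ZMod n)) (hJ : J ≠ univ) :
    ∃ l : List (ZMod n), IsCycDecWord l ∧ l.toFinset = J := by
  obtain ⟨i, hi⟩ : ∃ i, i ∉ J := by
    by_contra! h
    exact hJ (eq_univ_iff_forall.2 h)
  have key : ∀ a b : ℕ, a < n → b < n → (a : ZMod n) = b → a = b := by
    intro a b ha hb h
    have := (ZMod.natCast_eq_natCast_iff' a b n).1 h
    rwa [Nat.mod_eq_of_lt ha, Nat.mod_eq_of_lt hb] at this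
  refine ⟨((List.range (n - 1)).map fun t : ℕ => i - 1 - (t : ZMod n)).filter (· ∈ J),
    ⟨?_, ?_⟩, ?_⟩
  · refine List.Nodup.filter _ ?_
    rw [List.nodup_map_iff_inj_on List.nodup_range]
    intro a ha b hb h
    rw [List.mem_range] at ha hb
    exact key a b (by omega) (by omega) (by simpa using h)
  · refine List.Pairwise.filter _ ?_
    rw [List.pairwise_map]
    refine List.Pairwise.imp_of_mem ?_ (List.pairwise_lt_range (n := n - 1))
    intro a b ha hb hab h
    rw [List.mem_range] at ha hb
    have h2 : ((b + 1 : ℕ) : ZMod n) = (a : ℕ) := by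
      push_cast
      linear_combination -h
    have := key (b + 1) a (by omega) (by omega) h2
    omega
  · ext j
    simp only [List.mem_toFinset, List.mem_filter, List.mem_map, List.mem_range,
      decide_eq_true_eq]
    refine ⟨fun h => h.2, fun h => ⟨⟨(i - 1 - j).val, ?_, by simp⟩, h⟩⟩
    have hlt := ZMod.val_lt (i - 1 - j)
    rcases Nat.lt_or_ge (i - 1 - j).val (n - 1) with h1 | h1
    · exact h1
    · exfalso
      have h3 : (i - 1 - j).val + 1 = n := by omega
      have h4 : (((i - 1 - j).val + 1 : ℕ) : ZMod n) = 0 := by rw [h3]; simp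
      have h5 : i = j := by
        push_cast at h4
        rw [ZMod.natCast_zmod_val] at h4
        linear_combination h4
      exact hi (h5 ▸ h)

theorem exists_cycIncWord {n : ℕ} [NeZero n] (J : Finset (ZMod n)) (hJ : J ≠ univ) :
    ∃ l : List (ZMod n), IsCycIncWord l ∧ l.toFinset = J := by
  obtain ⟨l, ⟨h1, h2⟩, h3⟩ := exists_cycDecWord J hJ
  exact ⟨l.reverse, ⟨List.nodup_reverse.2 h1, List.pairwise_reverse.2 h2⟩, by simpa using h3⟩

open Classical in
/-- The cyclically decreasing element `d_J` of a proper subset `J` (all cyclically decreasing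
words with letter set `J` have the same product; the value at `J = univ` is never used). -/
def cycDec {n : ℕ} [NeZero n] (J : Finset (ZMod n)) : AffineSym n :=
  if hJ : J ≠ univ then (cox n).wordProd (exists_cycDecWord J hJ).choose else 1

open Classical in
/-- The cyclically increasing element `u_J` of a proper subset `J`. -/
def cycInc {n : ℕ} [NeZero n] (J : Finset (ZMod n)) : AffineSym n :=
  if hJ : J ≠ univ then (cox n).wordProd (exists_cycIncWord J hJ).choose else 1

open Classical in
/-- `maxr w`: the size of the largest proper `J` with `w = v d_J` and `ℓ(w) = ℓ(v) + ℓ(d_J)`. -/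
def maxr {n : ℕ} [NeZero n] (w : AffineSym n) : ℕ :=
  ((univ : Finset (Finset (ZMod n))).filter fun J => J ≠ univ ∧ ∃ v : AffineSym n,
    w = v * cycDec J ∧ (cox n).length w = (cox n).length v + (cox n).length (cycDec J)).sup card

open Classical in
/-- `maxc w`: the size of the largest proper `J` with `w = v u_J` and `ℓ(w) = ℓ(v) + ℓ(u_J)`. -/
def maxc {n : ℕ} [NeZero n] (w : AffineSym n) : ℕ :=
  ((univ : Finset (Finset (ZMod n))).filter fun J => J ≠ univ ∧ ∃ v : AffineSym n,
    w = v * cycInc J ∧ (cox n).length w = (cox n).length v + (cox n).length (cycInc J)).sup card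

/-- The set `A_{(n-m,m)}`. -/
def setA (m n : ℕ) [NeZero n] : Set (AffineSym n) :=
  {w | Is321Avoiding w ∧ maxc w ≤ m ∧ maxr w ≤ n - m}

/-- The type of `0`-Grassmannian elements. -/
abbrev Grass (n : ℕ) : Type := {w : AffineSym n // IsZeroGrassmannian w}

/-- The type of elements of `A⁰_{(n-m,m)}`. -/
abbrev GrassA (m n : ℕ) [NeZero n] : Type := {u : Grass n // u.1 ∈ setA m n}

/-! ### Affine Stanley symmetric functions -/

open Classical in
/-- The affine Stanley symmetric function `F_w`, a formal power series in `x_0, x_1, …`. The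
coefficient of `x^a` is the number of cyclically decreasing decompositions
`w = d_{J_0} d_{J_1} ⋯`, `ℓ(w) = ∑ |J_i|`, with `|J_i| = a_i`; recall `ℓ(d_J) = |J|`, and only
the finitely many indices `i < N` can have `J_i ≠ ∅`. -/
def affineStanley {n : ℕ} [NeZero n] (w : AffineSym n) : MvPowerSeries ℕ ℤ := fun a =>
  let N := a.support.sup id + 1
  (((univ : Finset (Fin N → Finset (ZMod n))).filter fun J =>
    (∀ i : Fin N, J i ≠ univ ∧ (J i).card = a i) ∧
    (List.ofFn fun i : Fin N => cycDec (J i)).prod = w ∧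
    (cox n).length w = ∑ i : Fin N, (J i).card).card : ℤ)

/-- `c` is the family of coefficients of an expansion `F_w = ∑_u c_u F_u` into affine Schur
functions, `u` running over the `0`-Grassmannian elements. -/
def IsAffineSchurExpansion {n : ℕ} [NeZero n] (w : AffineSym n) (c : Grass n →₀ ℤ) : Prop :=
  affineStanley w = c.sum fun u z => z • affineStanley u.1

/-! ### `k`-Schur functions, `k = n - 1` -/

/-- The ring `ℤ[h_1, …, h_{n-1}]`; the variable `X i` stands for `h_{i+1}`. -/
abbrev HRing (n : ℕ) : Type := MvPolynomial (Fin (n - 1)) ℤ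

/-- The weakly decreasing list of parts of the partition `λ` with `h_λ = ∏ h_{i+1}^{α i}`. -/
def parts {n : ℕ} (α : Fin (n - 1) →₀ ℕ) : List ℕ :=
  (List.finRange (n - 1)).reverse.flatMap fun i => List.replicate (α i) (i.val + 1)

/-- The Hall pairing of an element of `ℤ[h_1, …, h_{n-1}]` with a symmetric function:
`⟨h_λ, m_μ⟩ = δ_{λμ}`, so `⟨h_λ, F⟩` is the coefficient of `x^λ` in `F`. -/
def hallPairing {n : ℕ} (f : HRing n) (F : MvPowerSeries ℕ ℤ) : ℤ :=
  ∑ α ∈ f.support, f.coeff α * MvPowerSeries.coeff (parts α).toFinsupp F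

open Classical in
/-- `s` is the family of `k`-Schur functions: the basis dual to the affine Schur functions. -/
def IsKSchurFamily {n : ℕ} [NeZero n] (s : Grass n → HRing n) : Prop :=
  ∀ u v : Grass n, hallPairing (s u) (affineStanley v.1) = if u = v then 1 else 0

/-! ### The affine nilCoxeter algebra -/

/-- The defining relations of the affine nilCoxeter algebra. -/
inductive NilRel (n : ℕ) : FreeAlgebra ℤ (ZMod n) → FreeAlgebra ℤ (ZMod n) → Prop
  | sq (i : ZMod n) : NilRel n (FreeAlgebra.ι ℤ i * FreeAlgebra.ι ℤ i) 0
  | braid (i : ZMod n) (hn : n ≠ 2) :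
      NilRel n (FreeAlgebra.ι ℤ i * FreeAlgebra.ι ℤ (i + 1) * FreeAlgebra.ι ℤ i)
        (FreeAlgebra.ι ℤ (i + 1) * FreeAlgebra.ι ℤ i * FreeAlgebra.ι ℤ (i + 1))
  | comm (i j : ZMod n) (hij : i ≠ j + 1) (hji : j ≠ i + 1) :
      NilRel n (FreeAlgebra.ι ℤ i * FreeAlgebra.ι ℤ j) (FreeAlgebra.ι ℤ j * FreeAlgebra.ι ℤ i)

/-- The affine nilCoxeter algebra `𝔸` over `ℤ`. -/
abbrev NilCoxeter (n : ℕ) : Type := RingQuot (NilRel n)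

/-- The generator `A_i`. -/
def nilGen {n : ℕ} (i : ZMod n) : NilCoxeter n :=
  RingQuot.mkAlgHom ℤ (NilRel n) (FreeAlgebra.ι ℤ i)

/-- `A_w = A_{i_1} ⋯ A_{i_l}` for a reduced word `s_{i_1} ⋯ s_{i_l}` of `w` (the product does not
depend on the reduced word). -/
def nilElt {n : ℕ} (w : AffineSym n) : NilCoxeter n :=
  (((cox n).exists_isReduced w).choose.map nilGen).prod

open Classical in
/-- `𝐡_i = ∑ A_{d_J}` over the proper subsets `J` of size `i`. -/
def nilH (n : ℕ) [NeZero n] (i : ℕ) : NilCoxeter n :=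
  ∑ J ∈ (univ : Finset (Finset (ZMod n))).filter (fun J => J ≠ univ ∧ J.card = i),
    nilElt (cycDec J)

/-- The map `ℤ[h_1, …, h_{n-1}] → 𝔸`, `h_λ ↦ 𝐡_{λ_1} 𝐡_{λ_2} ⋯`. -/
def noncomm {n : ℕ} [NeZero n] (f : HRing n) : NilCoxeter n :=
  ∑ α ∈ f.support, f.coeff α • ((parts α).map (nilH n)).prod

/-! ### The quotient `𝔸_{m,n}` and its subalgebra `𝔹_{m,n}` -/

/-- The additional relations defining `𝔸_{m,n}`. -/
inductive QuotRel (m n : ℕ) [NeZero n] : NilCoxeter n → NilCoxeter n → Prop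
  | braidLeft (i : ZMod n) : QuotRel m n (nilGen i * nilGen (i + 1) * nilGen i) 0
  | braidRight (i : ZMod n) : QuotRel m n (nilGen (i + 1) * nilGen i * nilGen (i + 1)) 0
  | dec (J : Finset (ZMod n)) (hJ : J ≠ univ) (h : n - m < J.card) :
      QuotRel m n (nilElt (cycDec J)) 0
  | inc (J : Finset (ZMod n)) (hJ : J ≠ univ) (h : m < J.card) :
      QuotRel m n (nilElt (cycInc J)) 0

/-- The algebra `𝔸_{m,n}`. -/
abbrev NilQuot (m n : ℕ) [NeZero n] : Type := RingQuot (QuotRel m n)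

/-- The projection `𝔸 → 𝔸_{m,n}`. -/
def proj (m n : ℕ) [NeZero n] : NilCoxeter n →ₐ[ℤ] NilQuot m n :=
  RingQuot.mkAlgHom ℤ (QuotRel m n)

/-- `𝔹_{m,n}`: the subalgebra of `𝔸_{m,n}` generated by the images of `𝐡_1, …, 𝐡_{n-m}`. -/
def algB (m n : ℕ) [NeZero n] : Subalgebra ℤ (NilQuot m n) :=
  Algebra.adjoin ℤ ((fun i => proj m n (nilH n i)) '' Set.Icc 1 (n - m))

end AffineStanley

end

open AffineStanley

set_option linter.unusedSectionVars false

noncomputable section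

/-! ### Adjacent exchanges of entries of integer sequences, and nil operators. -/

namespace AffineStanley

/-! ### Simultaneous exchange of adjacent positions -/

/-! The affine nilCoxeter algebra acts on formal combinations of sequences `ℤ → ℤ`: `A_i` exchanges
the entries at `k` and `k + 1`, for all `k ≡ i`, if these are ascents, and gives zero otherwise.
Three kinds of initial sequence carry the proof. The identity sees every `A_w`, so these form a
basis with coordinates `coef`. The staircase `ground` is killed by `A_w` unless `w` is
0-Grassmannian, and the Grassmannian `w` send it to distinct states (`coef_eq_nilRep_ground`). A 0-1
sequence of period `n` is a configuration of particles on a cycle, `A_i` letting a particle hop from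
`i` to an empty `i + 1`. For `n ≠ 2`, the elements of `A_{(n-m,m)}` are exactly those that act
without vanishing on some configuration of `m` particles (`exists_moves_of_mem_setA`,
`Moves.mem_setA`).

The coefficient of a monomial in `F_w` is the coefficient of `A_w` in a product of the `𝐡_i`, so
`⟨f, F_w⟩` is `coef w (noncomm f)`. The `𝐡_i` commute (`nilH_comm`): two rows of factors `1 + t A_k`
are exchanged by the Yang-Baxter equation on the line, and the cycle is recovered from the line by a
trace over the values at the cut. Removing maximal horizontal strips matches Grassmannian elements
with partitions having parts below `n`, and the products `𝐡_λ` are unitriangular for the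
lexicographic order (`coef_shape`, `le_shape_of_coef_ne_zero`). Hence the `k`-Schur functions exist
and are unique, and `c^w_u` is the coefficient of `A_w` in the noncommutative `s_u`
(`isAffineSchurExpansion_iff_coef`).

For the vanishing, let `w` lie in `A_{(n-m,m)}` with `n ≠ 2`. Starting the particles from a packed
configuration extends `w` to a reduced product `w y` that is Grassmannian and still in `A_{(n-m,m)}`
(`exists_mul_grassmannian`). At Grassmannian elements, right multiplication by `s_v` and by `A_v`
have the same coefficients. Therefore `c^w_u` is the coefficient of `A_{wy}` in `s_u A_y`, hence in
`s_u s_y = s_y s_u`, hence in `s_y A_u`; if it is nonzero, `u` is a right factor of `w y`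
(`exists_right_factor_of_coef_kSchur`), and the particle description passes to right factors. Every
321-avoiding element lies in some `A_{(n-m,m)}`, which gives the first claim from the second. For `n
= 2` everything follows from lengths.

For the basis, the coefficients at `A_{(n-m,m)}` do not see the relations of the quotient
(`coefCon_of_quotRel`), while `A_w` with `w` outside this set maps to zero. So `s_u` dies for `u`
outside, the remaining `s_u` stay independent by duality, and they span because `𝔹_{m,n}` is the
image of `ℤ[h_1, …, h_{n-1}]`. -/

open Classical in
/-- Exchange the positions `k` and `k + 1` for all `k ∈ U`. -/
def swapAt (U : Set ℤ) (k : ℤ) : ℤ := if k ∈ U then k + 1 else if k - 1 ∈ U then k - 1 else k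

/-- No two elements of `U` are consecutive. -/
def Sparse (U : Set ℤ) : Prop := ∀ k ∈ U, k + 1 ∉ U

/-- The values of `c` increase from `k` to `k + 1` for all `k ∈ U`. -/
def Asc (U : Set ℤ) (c : ℤ → ℤ) : Prop := ∀ k ∈ U, c k < c (k + 1)

theorem swapAt_of_mem {U : Set ℤ} {k : ℤ} (h : k ∈ U) : swapAt U k = k + 1 := by simp [swapAt, h]

theorem Sparse.swapAt_succ {U : Set ℤ} (hU : Sparse U) {k : ℤ} (h : k ∈ U) :
    swapAt U (k + 1) = k := by simp [swapAt, h, hU k h]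

theorem swapAt_of_notMem {U : Set ℤ} {k : ℤ} (h : k ∉ U) (h' : k - 1 ∉ U) : swapAt U k = k := by
  simp [swapAt, h, h']

theorem Sparse.swapAt_swapAt {U : Set ℤ} (hU : Sparse U) (k : ℤ) : swapAt U (swapAt U k) = k := by
  by_cases h : k ∈ U
  · rw [swapAt_of_mem h, hU.swapAt_succ h]
  · by_cases h' : k - 1 ∈ U
    · have h1 : swapAt U k = k - 1 := by simp [swapAt, h, h']
      rw [h1, swapAt_of_mem h']; ring
    · rw [swapAt_of_notMem h h', swapAt_of_notMem h h']

theorem Sparse.comp_swapAt_comp {U : Set ℤ} (hU : Sparse U) (c : ℤ → ℤ) :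
    (c ∘ swapAt U) ∘ swapAt U = c := by
  funext k; simp [hU.swapAt_swapAt]

/-- The sets `U` and `V` of exchanges do not interact. -/
def Far (U V : Set ℤ) : Prop := ∀ k ∈ U, k ∉ V ∧ k + 1 ∉ V ∧ k - 1 ∉ V

theorem Far.symm {U V : Set ℤ} (h : Far U V) : Far V U := by
  intro k hk
  refine ⟨fun h' => (h k h').1 hk, fun h' => (h _ h').2.2 (by simpa using hk),
    fun h' => (h _ h').2.1 (by simpa using hk)⟩

theorem Far.swapAt_eq {U V : Set ℤ} (h : Far U V) {k : ℤ} (hk : k ∈ V) :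
    swapAt U k = k ∧ swapAt U (k + 1) = k + 1 := by
  obtain ⟨h1, h2, h3⟩ := h.symm k hk
  exact ⟨swapAt_of_notMem h1 h3, swapAt_of_notMem h2 (by simpa using h1)⟩

theorem Far.asc_comp {U V : Set ℤ} (h : Far U V) (c : ℤ → ℤ) :
    Asc V (c ∘ swapAt U) ↔ Asc V c := by
  refine forall₂_congr fun k hk => ?_
  simp [h.swapAt_eq hk]

theorem Far.comm {U V : Set ℤ} (h : Far U V) (hU : Sparse U) (hV : Sparse V) (c : ℤ → ℤ) :
    (c ∘ swapAt U) ∘ swapAt V = (c ∘ swapAt V) ∘ swapAt U := by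
  have key : ∀ {U V : Set ℤ}, Far U V → Sparse V → ∀ k, (k ∈ V ∨ k - 1 ∈ V) →
      swapAt U (swapAt V k) = swapAt V (swapAt U k) := by
    intro U V h hV k hk
    rcases hk with hk | hk
    · rw [swapAt_of_mem hk, (h.swapAt_eq hk).1, (h.swapAt_eq hk).2, swapAt_of_mem hk]
    · obtain ⟨j, rfl⟩ : ∃ j, k = j + 1 := ⟨k - 1, by ring⟩
      rw [add_sub_cancel_right] at hk
      rw [hV.swapAt_succ hk, (h.swapAt_eq hk).1, (h.swapAt_eq hk).2, hV.swapAt_succ hk]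
  funext k
  simp only [Function.comp]
  congr 1
  by_cases h1 : k ∈ V ∨ k - 1 ∈ V
  · exact key h hV k h1
  by_cases h2 : k ∈ U ∨ k - 1 ∈ U
  · exact (key h.symm hU k h2).symm
  push Not at h1 h2
  rw [swapAt_of_notMem h1.1 h1.2, swapAt_of_notMem h2.1 h2.2, swapAt_of_notMem h1.1 h1.2]

/-- `V = U + 1`, and `U`, `U + 1`, `U + 2` are disjoint. -/
structure Linked (U V : Set ℤ) : Prop where
  succ_mem : ∀ k, k + 1 ∈ V ↔ k ∈ U
  one : ∀ k ∈ U, k + 1 ∉ U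
  two : ∀ k ∈ U, k + 2 ∉ U

namespace Linked

variable {U V : Set ℤ} (h : Linked U V) {k : ℤ}

include h

theorem sparse_left : Sparse U := h.one

theorem sparse_right : Sparse V := fun k hk hk' => by
  rw [h.succ_mem] at hk'
  obtain ⟨j, rfl⟩ : ∃ j, k = j + 1 := ⟨k - 1, by ring⟩
  exact h.one j ((h.succ_mem j).1 hk) hk'

theorem swap_left (hk : k ∈ U) :
    swapAt U k = k + 1 ∧ swapAt U (k + 1) = k ∧ swapAt U (k + 2) = k + 2 := by
  refine ⟨swapAt_of_mem hk, h.sparse_left.swapAt_succ hk, swapAt_of_notMem (h.two k hk) ?_⟩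
  rw [show k + 2 - 1 = k + 1 by ring]
  exact h.one k hk

theorem swap_right (hk : k ∈ U) :
    swapAt V k = k ∧ swapAt V (k + 1) = k + 2 ∧ swapAt V (k + 2) = k + 1 := by
  have h1 := (h.succ_mem k).2 hk
  refine ⟨swapAt_of_notMem (fun h2 => ?_) (fun h2 => ?_), ?_, ?_⟩
  · obtain ⟨j, rfl⟩ : ∃ j, k = j + 1 := ⟨k - 1, by ring⟩
    exact h.one _ ((h.succ_mem j).1 h2) hk
  · obtain ⟨j, rfl⟩ : ∃ j, k = j + 2 := ⟨k - 2, by ring⟩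
    rw [show j + 2 - 1 = j + 1 by ring, h.succ_mem] at h2
    exact h.two _ h2 hk
  · rw [swapAt_of_mem h1]; ring
  · rw [show k + 2 = k + 1 + 1 by ring, h.sparse_right.swapAt_succ h1]

theorem asc_right_iff (c : ℤ → ℤ) : Asc V c ↔ ∀ k ∈ U, c (k + 1) < c (k + 2) := by
  constructor
  · intro hc k hk
    have := hc _ ((h.succ_mem k).2 hk)
    rwa [add_assoc] at this
  · intro hc k hk
    obtain ⟨j, rfl⟩ : ∃ j, k = j + 1 := ⟨k - 1, by ring⟩
    have := hc j ((h.succ_mem j).1 hk)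
    rwa [add_assoc]

/-- Both sides reverse every triple `k, k + 1, k + 2` with `k ∈ U`; these triples are disjoint by
`one` and `two`. -/
theorem braid (c : ℤ → ℤ) :
    ((c ∘ swapAt U) ∘ swapAt V) ∘ swapAt U = ((c ∘ swapAt V) ∘ swapAt U) ∘ swapAt V := by
  funext j
  simp only [Function.comp]
  congr 1
  have e : ∀ k ∈ U, ∀ j, (j = k ∨ j = k + 1 ∨ j = k + 2) →
      swapAt U (swapAt V (swapAt U j)) = swapAt V (swapAt U (swapAt V j)) := by
    intro k hk j hj
    obtain ⟨a1, a2, a3⟩ := h.swap_left hk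
    obtain ⟨b1, b2, b3⟩ := h.swap_right hk
    rcases hj with rfl | rfl | rfl <;> simp only [a1, a2, a3, b1, b2, b3]
  by_cases h0 : j ∈ U
  · exact e j h0 j (Or.inl rfl)
  by_cases h1 : j - 1 ∈ U
  · exact e _ h1 j (Or.inr (Or.inl (by ring)))
  by_cases h2 : j - 2 ∈ U
  · exact e _ h2 j (Or.inr (Or.inr (by ring)))
  have hU : swapAt U j = j := swapAt_of_notMem h0 h1
  have hV : swapAt V j = j := by
    refine swapAt_of_notMem (fun h3 => h1 ?_) (fun h3 => h2 ?_)
    · rw [← h.succ_mem]; simpa using h3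
    · rw [← h.succ_mem]; convert h3 using 1; ring
  rw [hU, hV, hU, hV]

/-- Along either route the three conditions compare the three pairs of entries in each triple, so
both say that the triple is increasing. -/
theorem asc_iff (c : ℤ → ℤ) :
    (Asc U c ∧ Asc V (c ∘ swapAt U) ∧ Asc U ((c ∘ swapAt U) ∘ swapAt V)) ↔
    (Asc V c ∧ Asc U (c ∘ swapAt V) ∧ Asc V ((c ∘ swapAt V) ∘ swapAt U)) := by
  have e1 : Asc V (c ∘ swapAt U) ↔ ∀ k ∈ U, c k < c (k + 2) := by
    rw [h.asc_right_iff]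
    refine forall₂_congr fun k hk => ?_
    simp [h.swap_left hk]
  have e2 : Asc U ((c ∘ swapAt U) ∘ swapAt V) ↔ Asc V c := by
    rw [h.asc_right_iff]
    refine forall₂_congr fun k hk => ?_
    simp [h.swap_left hk, h.swap_right hk]
  have e3 : Asc U (c ∘ swapAt V) ↔ ∀ k ∈ U, c k < c (k + 2) := by
    refine forall₂_congr fun k hk => ?_
    simp [h.swap_right hk]
  have e4 : Asc V ((c ∘ swapAt V) ∘ swapAt U) ↔ Asc U c := by
    rw [h.asc_right_iff]
    refine forall₂_congr fun k hk => ?_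
    simp [h.swap_left hk, h.swap_right hk]
  rw [e1, e2, e3, e4]
  tauto

end Linked

/-! ### The nil operators -/

open Classical in
/-- The operator which exchanges positions along `U` if this creates descents, and is `0`
otherwise. -/
def nilOp (R : Type*) [CommRing R] (U : Set ℤ) : Module.End R ((ℤ → ℤ) →₀ R) :=
  Finsupp.linearCombination R fun c =>
    if Asc U c then Finsupp.single (c ∘ swapAt U) (1 : R) else 0

section nilOp

variable {R : Type*} [CommRing R]

open Classical in
theorem nilOp_single (U : Set ℤ) (c : ℤ → ℤ) (r : R) :
    nilOp R U (Finsupp.single c r) =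
      if Asc U c then Finsupp.single (c ∘ swapAt U) r else 0 := by
  rw [nilOp, Finsupp.linearCombination_single]
  split_ifs <;> simp

theorem end_ext {f g : Module.End R ((ℤ → ℤ) →₀ R)}
    (h : ∀ c, f (Finsupp.single c 1) = g (Finsupp.single c 1)) : f = g := by
  refine Finsupp.lhom_ext fun c r => ?_
  rw [← mul_one r, ← smul_eq_mul, ← Finsupp.smul_single, map_smul, map_smul, h]

theorem nilOp_mul_self {U : Set ℤ} (hU : Sparse U) (hne : U.Nonempty) :
    nilOp R U * nilOp R U = 0 := by
  classical
  refine end_ext fun c => ?_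
  rw [Module.End.mul_apply, nilOp_single]
  split_ifs with h
  · rw [nilOp_single, if_neg, LinearMap.zero_apply]
    intro h'
    obtain ⟨k, hk⟩ := hne
    have h1 := h k hk
    have h2 := h' k hk
    simp only [Function.comp, swapAt_of_mem hk, hU.swapAt_succ hk] at h2
    exact lt_asymm h1 h2
  · simp

theorem nilOp_comm {U V : Set ℤ} (h : Far U V) (hU : Sparse U) (hV : Sparse V) :
    nilOp R U * nilOp R V = nilOp R V * nilOp R U := by
  classical
  refine end_ext fun c => ?_
  simp only [Module.End.mul_apply, nilOp_single, apply_ite (nilOp R U), apply_ite (nilOp R V),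
    map_zero, h.asc_comp, h.symm.asc_comp, h.comm hU hV]
  split_ifs <;> rfl

theorem nilOp_braid {U V : Set ℤ} (h : Linked U V) :
    nilOp R U * nilOp R V * nilOp R U = nilOp R V * nilOp R U * nilOp R V := by
  classical
  refine end_ext fun c => ?_
  have key : ∀ U V : Set ℤ, (nilOp R U * nilOp R V * nilOp R U) (Finsupp.single c 1) =
      if Asc U c ∧ Asc V (c ∘ swapAt U) ∧ Asc U ((c ∘ swapAt U) ∘ swapAt V) then
        Finsupp.single (((c ∘ swapAt U) ∘ swapAt V) ∘ swapAt U) 1 else 0 := by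
    intro U V
    simp only [Module.End.mul_apply, nilOp_single, apply_ite (nilOp R U), apply_ite (nilOp R V),
      map_zero]
    split_ifs <;> first | rfl | tauto
  rw [key, key, h.braid]
  simp only [h.asc_iff]

end nilOp

/-! ### Runs of words and carriers -/

section Run

variable {ι : Type*} (U : ι → Set ℤ)

/-- The word `l` leads from `c` to `d`, creating descents at each step; the rightmost letter acts
first. -/
def Run : List ι → (ℤ → ℤ) → (ℤ → ℤ) → Prop
  | [], c, d => d = c
  | i :: l, c, d => ∃ e, Run l c e ∧ Asc (U i) e ∧ d = e ∘ swapAt (U i)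

variable {U}

theorem run_append {l l' : List ι} {c d : ℤ → ℤ} :
    Run U (l ++ l') c d ↔ ∃ e, Run U l' c e ∧ Run U l e d := by
  induction l generalizing d with
  | nil => simp [Run]
  | cons i l ih =>
    simp only [List.cons_append, Run, ih]
    constructor
    · rintro ⟨e, ⟨f, h1, h2⟩, h3⟩; exact ⟨f, h1, e, h2, h3⟩
    · rintro ⟨f, h1, e, h2, h3⟩; exact ⟨e, ⟨f, h1, h2⟩, h3⟩

theorem Run.right_unique {l : List ι} {c d d' : ℤ → ℤ} (h : Run U l c d) (h' : Run U l c d') :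
    d = d' := by
  induction l generalizing d d' with
  | nil => exact h.trans h'.symm
  | cons i l ih =>
    obtain ⟨e, h1, -, rfl⟩ := h
    obtain ⟨e', h1', -, rfl⟩ := h'
    rw [ih h1 h1']

theorem Run.left_unique (hU : ∀ i, Sparse (U i)) {l : List ι} {c c' d : ℤ → ℤ}
    (h : Run U l c d) (h' : Run U l c' d) : c = c' := by
  induction l generalizing d with
  | nil => exact h.symm.trans h'
  | cons i l ih =>
    obtain ⟨e, h1, -, rfl⟩ := h
    obtain ⟨e', h1', -, h2⟩ := h'
    have : e = e' := by
      rw [← (hU i).comp_swapAt_comp e, h2, (hU i).comp_swapAt_comp]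
    exact ih h1 (this ▸ h1')

theorem prod_nilOp_single {R : Type*} [CommRing R] {l : List ι} {c d : ℤ → ℤ}
    (h : Run U l c d) (r : R) :
    (l.map fun i => nilOp R (U i)).prod (Finsupp.single c r) = Finsupp.single d r := by
  induction l generalizing d with
  | nil => obtain rfl : d = c := h; simp
  | cons i l ih =>
    obtain ⟨e, h1, h2, rfl⟩ := h
    rw [List.map_cons, List.prod_cons, Module.End.mul_apply, ih h1, nilOp_single, if_pos h2]

theorem prod_nilOp_single_eq_zero {R : Type*} [CommRing R] {l : List ι} {c : ℤ → ℤ}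
    (h : ∀ d, ¬ Run U l c d) (r : R) :
    (l.map fun i => nilOp R (U i)).prod (Finsupp.single c r) = 0 := by
  classical
  induction l with
  | nil => exact absurd rfl (h c)
  | cons i l ih =>
    rw [List.map_cons, List.prod_cons, Module.End.mul_apply]
    by_cases h1 : ∃ e, Run U l c e
    · obtain ⟨e, h1⟩ := h1
      rw [prod_nilOp_single h1, nilOp_single, if_neg]
      exact fun h2 => h _ ⟨e, h1, h2, rfl⟩
    · rw [ih (not_exists.1 h1), map_zero]

open Classical in
theorem prod_nilOp_single_apply {R : Type*} [CommRing R] (l : List ι) (c d : ℤ → ℤ) :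
    (l.map fun i => nilOp R (U i)).prod (Finsupp.single c (1 : R)) d =
      if Run U l c d then 1 else 0 := by
  by_cases h : ∃ e, Run U l c e
  · obtain ⟨e, h⟩ := h
    rw [prod_nilOp_single h, Finsupp.single_apply]
    congr 1
    exact propext ⟨fun h1 => h1 ▸ h, fun h1 => h.right_unique h1⟩
  · rw [prod_nilOp_single_eq_zero (not_exists.1 h), if_neg fun h1 => h ⟨d, h1⟩]
    rfl

/-- Values are carried to the right along `S`: the value `m k` carried past the position `k ∈ S`
is smaller than the value at `k + 1`, which moves one step to the left. -/
def Carries (S : Set ℤ) (m c d : ℤ → ℤ) : Prop := ∀ k,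
  (k ∈ S → m k < c (k + 1) ∧ m (k + 1) = m k ∧ d k = c (k + 1)) ∧
  (k ∉ S → m (k + 1) = c (k + 1) ∧ d k = m k)

theorem carries_empty {c d : ℤ → ℤ} : (∃ m, Carries ∅ m c d) ↔ d = c := by
  constructor
  · rintro ⟨m, h⟩
    funext k
    have h1 := ((h (k - 1)).2 (Set.notMem_empty _)).1
    rw [sub_add_cancel] at h1
    rw [((h k).2 (Set.notMem_empty _)).2, h1]
  · rintro rfl
    exact ⟨d, fun k => ⟨fun h => absurd h (Set.notMem_empty _), fun _ => ⟨rfl, rfl⟩⟩⟩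

/-- The exchanges along `V` act after those along `S`. A value that has stopped at `k ∈ V` is taken
one step further and stops at `k + 1`, which is in neither set. -/
theorem carries_union {S V : Set ℤ} (hV : Sparse V) (h0 : ∀ k ∈ V, k ∉ S)
    (h1 : ∀ k ∈ V, k + 1 ∉ S) {c d : ℤ → ℤ} :
    (∃ m, Carries (V ∪ S) m c d) ↔
      ∃ e, (∃ m, Carries S m c e) ∧ Asc V e ∧ d = e ∘ swapAt V := by
  classical
  constructor
  · rintro ⟨m, h⟩
    have hm : ∀ k ∈ V, m k < c (k + 1) ∧ m (k + 1) = m k ∧ d k = c (k + 1) ∧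
        d (k + 1) = m k := by
      intro k hk
      have h2 := (h k).1 (Or.inl hk)
      have h3 := (h (k + 1)).2 (by simp [hV k hk, h1 k hk])
      exact ⟨h2.1, h2.2.1, h2.2.2, by rw [h3.2, h2.2.1]⟩
    -- Without `V`, no carrier arrives at `k` from `k - 1 ∈ V`, so a fresh one starts there with
    -- value `c k`.
    refine ⟨d ∘ swapAt V, ⟨fun k => if k - 1 ∈ V then c k else m k, fun k => ?_⟩, ?_,
      (hV.comp_swapAt_comp d).symm⟩
    · by_cases hk : k ∈ V
      · have hk' : k - 1 ∉ V := fun h' => hV _ h' (by simpa using hk)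
        refine ⟨fun h' => absurd h' (h0 k hk), fun _ => ?_⟩
        simp [hk, hk', swapAt_of_mem hk, (hm k hk).2.2.2]
      · by_cases hk' : k - 1 ∈ V
        · obtain ⟨j, rfl⟩ : ∃ j, k = j + 1 := ⟨k - 1, by ring⟩
          rw [add_sub_cancel_right] at hk'
          refine ⟨fun h' => absurd h' (h1 j hk'), fun _ => ?_⟩
          have h4 := (h (j + 1)).2 (by simp [hV j hk', h1 j hk'])
          simp [hk, hk', hV.swapAt_succ hk', h4.1, (hm j hk').2.2.1]
        · simp only [add_sub_cancel_right, if_neg hk, if_neg hk', Function.comp,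
            swapAt_of_notMem hk hk']
          refine ⟨fun h' => (h k).1 (Or.inr h'), fun h' => (h k).2 ?_⟩
          simp [hk, h']
    · intro k hk
      obtain ⟨h2, -, h3, h4⟩ := hm k hk
      simp only [Function.comp, swapAt_of_mem hk, hV.swapAt_succ hk, h3, h4]
      exact h2
  · rintro ⟨e, ⟨m, h⟩, hA, rfl⟩
    have hm : ∀ k ∈ V, m (k + 1) = c (k + 1) ∧ e k = m k ∧ e (k + 1) = c (k + 1) := by
      intro k hk
      have h2 := (h k).2 (h0 k hk)
      have h3 := (h (k + 1)).2 (h1 k hk)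
      exact ⟨h2.1, h2.2, by rw [h3.2, h2.1]⟩
    -- With `V`, the carrier at `k` is the one prolonged from `k - 1 ∈ V`.
    refine ⟨fun k => if k - 1 ∈ V then m (k - 1) else m k, fun k => ?_⟩
    by_cases hk : k ∈ V
    · have hk' : k - 1 ∉ V := fun h' => hV _ h' (by simpa using hk)
      obtain ⟨a1, a2, a3⟩ := hm k hk
      refine ⟨fun _ => ?_, fun h' => absurd (Or.inl hk) h'⟩
      have := hA k hk
      simp only [add_sub_cancel_right, if_pos hk, if_neg hk', Function.comp, swapAt_of_mem hk]
      refine ⟨by rw [← a2, ← a3]; exact this, ?_, a3⟩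
      simp
    · by_cases hk' : k - 1 ∈ V
      · obtain ⟨j, rfl⟩ : ∃ j, k = j + 1 := ⟨k - 1, by ring⟩
        rw [add_sub_cancel_right] at hk'
        refine ⟨fun h' => absurd h' (by simp [hV j hk', h1 j hk']), fun _ => ?_⟩
        have h4 := (h (j + 1)).2 (h1 j hk')
        simp [hk, hk', hV.swapAt_succ hk', h4.1, (hm j hk').2.1]
      · simp only [add_sub_cancel_right, if_neg hk, if_neg hk', Function.comp,
          swapAt_of_notMem hk hk']
        refine ⟨fun h' => (h k).1 (h'.resolve_left hk), fun h' => (h k).2 ?_⟩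
        simp only [Set.mem_union, not_or] at h'
        exact h'.2

/-- A word all of whose letters act to the left of the earlier ones carries values along the union
of its letters. -/
theorem run_iff_carries (hU : ∀ i, Sparse (U i)) {l : List ι}
    (hl : l.Pairwise fun i j => ∀ k ∈ U i, k ∉ U j ∧ k + 1 ∉ U j) {c d : ℤ → ℤ} :
    Run U l c d ↔ ∃ m, Carries {k | ∃ i ∈ l, k ∈ U i} m c d := by
  induction l generalizing d with
  | nil => simp only [Run, List.not_mem_nil, false_and, exists_false, Set.ofPred_false,
      carries_empty]
  | cons i l ih =>
    rw [List.pairwise_cons] at hl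
    have : {k | ∃ j ∈ i :: l, k ∈ U j} = U i ∪ {k | ∃ j ∈ l, k ∈ U j} := by
      ext k; simp
    rw [this, carries_union (hU i)]
    · simp only [Run, ih hl.2]
    · rintro k hk ⟨j, hj, hk'⟩; exact (hl.1 j hj k hk).1 hk'
    · rintro k hk ⟨j, hj, hk'⟩; exact (hl.1 j hj k hk).2 hk'

end Run

end AffineStanley

/-! ### Quasi-periodic sequences and the exchange property for runs. -/

namespace AffineStanley

variable {n : ℕ}

/-! ### Residue classes -/

/-- The integers in the residue class `i`. -/
def resid (i : ZMod n) : Set ℤ := {k | (k : ZMod n) = i}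

theorem mem_resid {i : ZMod n} {k : ℤ} : k ∈ resid i ↔ (k : ZMod n) = i := Iff.rfl

theorem succ_mem_resid {i : ZMod n} {k : ℤ} : k + 1 ∈ resid (i + 1) ↔ k ∈ resid i := by
  simp [mem_resid]

theorem resid_nonempty (i : ZMod n) : (resid i).Nonempty :=
  ⟨_, (ZMod.intCast_surjective i).choose_spec⟩

theorem two_ne_zero_zmod [Fact (1 < n)] (hn : n ≠ 2) : (2 : ZMod n) ≠ 0 := by
  intro h
  have h1 : ((2 : ℕ) : ZMod n) = 0 := by exact_mod_cast h
  rw [ZMod.natCast_eq_zero_iff] at h1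
  have := Nat.le_of_dvd (by norm_num) h1
  have := (Fact.out : 1 < n)
  omega

section

variable [Fact (1 < n)]

theorem sparse_resid (i : ZMod n) : Sparse (resid i) := by
  intro k hk hk'
  rw [mem_resid] at hk hk'
  push_cast at hk'
  rw [hk] at hk'
  simp at hk'

omit [Fact (1 < n)] in
theorem far_resid {i j : ZMod n} (h0 : i ≠ j) (h1 : i ≠ j + 1) (h2 : j ≠ i + 1) :
    Far (resid i) (resid j) := by
  intro k hk
  rw [mem_resid] at hk
  simp only [mem_resid]
  push_cast
  rw [hk]
  exact ⟨h0, h2.symm, fun h => h1 (by rw [← h]; ring)⟩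

theorem linked_resid (hn : n ≠ 2) (i : ZMod n) : Linked (resid i) (resid (i + 1)) where
  succ_mem _ := succ_mem_resid
  one := sparse_resid i
  two := by
    intro k hk hk'
    rw [mem_resid] at hk hk'
    push_cast at hk'
    rw [hk] at hk'
    exact two_ne_zero_zmod hn (by simpa using hk')

/-! ### Quasi-periodic functions -/

/-- `c (k + n) = c k + N`. -/
def Per (n : ℕ) (N : ℤ) (c : ℤ → ℤ) : Prop := ∀ k, c (k + n) = c k + N

omit [Fact (1 < n)] in
theorem Per.add_mul {N : ℤ} {c : ℤ → ℤ} (h : Per n N c) (k t : ℤ) :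
    c (k + n * t) = c k + N * t := by
  induction t with
  | zero => simp
  | succ t ih => rw [mul_add, ← add_assoc, mul_one, h, ih]; ring
  | pred t ih =>
    have := h (k + n * (-(t : ℤ) - 1))
    rw [show k + n * (-(t : ℤ) - 1) + n = k + n * (-(t : ℤ)) by ring, ih] at this
    linarith

omit [Fact (1 < n)] in
theorem exists_eq_add_mul_of_mem_resid {i : ZMod n} {k k' : ℤ} (h : k ∈ resid i)
    (h' : k' ∈ resid i) : ∃ t : ℤ, k' = k + n * t := by
  rw [mem_resid] at h h'
  rw [← h, ZMod.intCast_eq_intCast_iff_dvd_sub] at h'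
  obtain ⟨t, ht⟩ := h'
  exact ⟨-t, by linarith⟩

omit [Fact (1 < n)] in
theorem add_mem_resid {i : ZMod n} {k : ℤ} : k + n ∈ resid i ↔ k ∈ resid i := by
  simp [mem_resid]

omit [Fact (1 < n)] in
theorem swapAt_resid_add (i : ZMod n) (k : ℤ) :
    swapAt (resid i) (k + n) = swapAt (resid i) k + n := by
  have h1 : (k + n - 1 ∈ resid i) ↔ k - 1 ∈ resid i := by
    rw [← add_mem_resid (k := k - 1)]; ring_nf
  by_cases h : k ∈ resid i
  · rw [swapAt_of_mem h, swapAt_of_mem (add_mem_resid.2 h)]; ring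
  · have h' := mt add_mem_resid.1 h
    by_cases h2 : k - 1 ∈ resid i
    · simp only [swapAt, if_neg h, if_neg h', if_pos h2, if_pos (h1.2 h2)]; ring
    · rw [swapAt_of_notMem h h2, swapAt_of_notMem h' (mt h1.1 h2)]

omit [Fact (1 < n)] in
theorem Per.swapAt {N : ℤ} {c : ℤ → ℤ} (h : Per n N c) (i : ZMod n) :
    Per n N (c ∘ swapAt (resid i)) := by
  intro k
  simp only [Function.comp, swapAt_resid_add, h _]

omit [Fact (1 < n)] in
theorem Run.per {N : ℤ} {l : List (ZMod n)} {c d : ℤ → ℤ} (h : Run resid l c d)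
    (hc : Per n N c) : Per n N d := by
  induction l generalizing d with
  | nil => obtain rfl : d = c := h; exact hc
  | cons i l ih => obtain ⟨e, h1, -, rfl⟩ := h; exact (ih h1).swapAt i

omit [Fact (1 < n)] in
theorem Per.asc_iff {N : ℤ} {c : ℤ → ℤ} (h : Per n N c) {i : ZMod n} {k : ℤ} (hk : k ∈ resid i) :
    Asc (resid i) c ↔ c k < c (k + 1) := by
  refine ⟨fun h' => h' k hk, fun h' k' hk' => ?_⟩
  obtain ⟨t, rfl⟩ := exists_eq_add_mul_of_mem_resid hk hk'
  rw [h.add_mul, show k + n * t + 1 = k + 1 + n * t by ring, h.add_mul]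
  linarith

/-- The values of `c` decrease from `k` to `k + 1` for all `k ∈ U`. -/
def Desc (U : Set ℤ) (c : ℤ → ℤ) : Prop := ∀ k ∈ U, c (k + 1) < c k

omit [Fact (1 < n)] in
theorem Per.desc_iff {N : ℤ} {c : ℤ → ℤ} (h : Per n N c) {i : ZMod n} {k : ℤ}
    (hk : k ∈ resid i) : Desc (resid i) c ↔ c (k + 1) < c k := by
  refine ⟨fun h' => h' k hk, fun h' k' hk' => ?_⟩
  obtain ⟨t, rfl⟩ := exists_eq_add_mul_of_mem_resid hk hk'
  rw [h.add_mul, show k + n * t + 1 = k + 1 + n * t by ring, h.add_mul]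
  linarith

theorem Sparse.asc_comp_iff {U : Set ℤ} (hU : Sparse U) {c : ℤ → ℤ} :
    Asc U (c ∘ AffineStanley.swapAt U) ↔ Desc U c := by
  refine forall₂_congr fun k hk => ?_
  simp [swapAt_of_mem hk, hU.swapAt_succ hk]

theorem Sparse.desc_comp_iff {U : Set ℤ} (hU : Sparse U) {c : ℤ → ℤ} :
    Desc U (c ∘ AffineStanley.swapAt U) ↔ Asc U c := by
  refine forall₂_congr fun k hk => ?_
  simp [swapAt_of_mem hk, hU.swapAt_succ hk]

theorem Far.desc_comp {U V : Set ℤ} (h : Far U V) (c : ℤ → ℤ) :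
    Desc V (c ∘ AffineStanley.swapAt U) ↔ Desc V c := by
  refine forall₂_congr fun k hk => ?_
  simp [h.swapAt_eq hk]

theorem Linked.desc_right_iff {U V : Set ℤ} (h : Linked U V) (c : ℤ → ℤ) :
    Desc V c ↔ ∀ k ∈ U, c (k + 2) < c (k + 1) := by
  constructor
  · intro hc k hk
    have := hc _ ((h.succ_mem k).2 hk)
    rwa [add_assoc] at this
  · intro hc k hk
    obtain ⟨j, rfl⟩ : ∃ j, k = j + 1 := ⟨k - 1, by ring⟩
    have := hc j ((h.succ_mem j).1 hk)
    rwa [add_assoc]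

end

/-! ### Exchange -/

/-- A family of elements of a monoid satisfies the braid and commutation relations. -/
structure BraidRel {M : Type*} [Monoid M] (x : ZMod n → M) : Prop where
  braid : n ≠ 2 → ∀ i, x i * x (i + 1) * x i = x (i + 1) * x i * x (i + 1)
  comm : ∀ i j, i ≠ j + 1 → j ≠ i + 1 → x i * x j = x j * x i

section

variable [Fact (1 < n)] {M : Type*} [Monoid M] {x : ZMod n → M} {N : ℤ} {c₀ : ℤ → ℤ}

/-- The exchange condition, by induction on length as in Matsumoto's theorem. Since `x` is any
family satisfying the braid relations, it applies both to the group and to the nilCoxeter algebra;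
monotonicity of `c₀` ensures that the initial state has no descents. -/
theorem Run.exchange (hx : BraidRel x) (hN : 0 ≤ N) (hc₀ : Per n N c₀)
    (h₀ : ∀ k, c₀ k ≤ c₀ (k + 1)) {l : List (ZMod n)} {c : ℤ → ℤ} (h : Run resid l c₀ c)
    {i : ZMod n} (hi : Desc (resid i) c) :
    ∃ l', Run resid l' c₀ (c ∘ swapAt (resid i)) ∧
      (l.map x).prod = x i * (l'.map x).prod ∧ l.length = l'.length + 1 := by
  induction hl : l.length using Nat.strong_induction_on generalizing l c i with
  | _ t ih =>
    subst hl
    have hc := h.per hc₀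
    match l, h with
    | [], h =>
      obtain rfl : c = c₀ := h
      obtain ⟨k, hk⟩ := resid_nonempty i
      exact absurd (hi k hk) (not_lt.2 (h₀ k))
    | j :: l, h =>
      obtain ⟨e, hl, hA, rfl⟩ := h
      have hj : Desc (resid j) (e ∘ swapAt (resid j)) := (sparse_resid j).desc_comp_iff.2 hA
      by_cases hij : i = j
      · subst hij
        exact ⟨l, by rwa [(sparse_resid i).comp_swapAt_comp], by simp, rfl⟩
      by_cases h2 : n = 2
      -- For `n = 2` descents at both residues would give `c (k + 2) < c k`, against `c (k + 2) = c
      -- k + N` with `N ≥ 0`.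
      · exfalso
        subst h2
        have h3 : j = i + 1 := by
          exact (by decide : ∀ i j : ZMod 2, i ≠ j → j = i + 1) i j hij
        obtain ⟨k, hk⟩ := resid_nonempty i
        have a1 := hi k hk
        have a2 := hj (k + 1) (by rw [h3]; exact succ_mem_resid.2 hk)
        have a3 := hc k
        push_cast at a3
        rw [add_assoc, show (1 : ℤ) + 1 = 2 by norm_num] at a2
        linarith
      by_cases h3 : j = i + 1
      · subst h3
        -- Descents at both `i` and `i + 1` make each triple decreasing. The induction hypothesis
        -- therefore exposes `i`, then `i + 1`, and the braid relation turns the leading `(i + 1) i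
        -- (i + 1)` into `i (i + 1) i`.
        have hL := linked_resid h2 i
        have hi' : Desc (resid i) e := by
          have := hL.desc_right_iff _ |>.1 hj
          intro k hk
          have a1 := hi k hk
          have a2 := this k hk
          simp only [Function.comp, hL.swap_right hk] at a1 a2
          linarith
        obtain ⟨l₂, r₂, p₂, q₂⟩ := ih _ (by simp) hl hi' rfl
        have hf : Desc (resid (i + 1)) (e ∘ swapAt (resid i)) := by
          rw [hL.desc_right_iff]
          intro k hk
          have a1 := hi k hk
          simp only [Function.comp, hL.swap_right hk, hL.swap_left hk] at a1 ⊢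
          exact a1
        obtain ⟨l₃, r₃, p₃, q₃⟩ := ih _ (by simp; omega) r₂ hf rfl
        refine ⟨(i + 1) :: i :: l₃, ⟨_, ⟨_, r₃, ?_, rfl⟩, ?_, ?_⟩, ?_, ?_⟩
        · intro k hk
          have a1 := (hL.asc_right_iff _).1 hA k hk
          simp only [Function.comp, hL.swap_right hk, hL.swap_left hk]
          exact a1
        · rw [hL.asc_right_iff]
          intro k hk
          have a1 := (hL.asc_right_iff _).1 hA k hk
          have a2 := hi' k hk
          simp only [Function.comp, hL.swap_right hk, hL.swap_left hk]
          linarith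
        · rw [hL.braid, (sparse_resid _).comp_swapAt_comp]
        · simp only [List.map_cons, List.prod_cons, p₂, p₃, ← mul_assoc]
          rw [hx.braid h2]
        · simp only [List.length_cons]; omega
      by_cases h4 : i = j + 1
      · subst h4
        have hL := linked_resid h2 j
        have hi' : Desc (resid (j + 1)) e := by
          have := hL.desc_right_iff _ |>.1 hi
          rw [hL.desc_right_iff]
          intro k hk
          have a1 := hj k hk
          have a2 := this k hk
          simp only [Function.comp, hL.swap_left hk] at a1 a2
          linarith
        obtain ⟨l₂, r₂, p₂, q₂⟩ := ih _ (by simp) hl hi' rfl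
        have hf : Desc (resid j) (e ∘ swapAt (resid (j + 1))) := by
          intro k hk
          have a1 := (hL.desc_right_iff _).1 hi k hk
          simp only [Function.comp, hL.swap_right hk, hL.swap_left hk] at a1 ⊢
          exact a1
        obtain ⟨l₃, r₃, p₃, q₃⟩ := ih _ (by simp; omega) r₂ hf rfl
        refine ⟨j :: (j + 1) :: l₃, ⟨_, ⟨_, r₃, ?_, rfl⟩, ?_, ?_⟩, ?_, ?_⟩
        · rw [hL.asc_right_iff]
          intro k hk
          have a1 := hA k hk
          simp only [Function.comp, hL.swap_right hk, hL.swap_left hk]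
          exact a1
        · intro k hk
          have a1 := hA k hk
          have a2 := (hL.desc_right_iff _).1 hi' k hk
          simp only [Function.comp, hL.swap_right hk, hL.swap_left hk]
          linarith
        · rw [← hL.braid, (sparse_resid _).comp_swapAt_comp]
        · simp only [List.map_cons, List.prod_cons, p₂, p₃, ← mul_assoc]
          rw [hx.braid h2]
        · simp only [List.length_cons]; omega
      · have hF := far_resid (Ne.symm hij) h3 h4
        rw [hF.desc_comp] at hi
        obtain ⟨l₂, r₂, p₂, q₂⟩ := ih _ (by simp) hl hi rfl
        refine ⟨j :: l₂, ⟨_, r₂, (hF.symm.asc_comp e).2 hA, ?_⟩, ?_, ?_⟩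
        · rw [hF.comm (sparse_resid _) (sparse_resid _)]
        · simp only [List.map_cons, List.prod_cons, p₂, ← mul_assoc]
          rw [hx.comm i j h4 h3]
        · simp only [List.length_cons]; omega

omit [Fact (1 < n)] in
theorem Run.eq_nil (h₀ : ∀ k, c₀ k ≤ c₀ (k + 1)) {l : List (ZMod n)} [Fact (1 < n)]
    (h : Run resid l c₀ c₀) : l = [] := by
  match l, h with
  | [], _ => rfl
  | j :: l, h =>
    obtain ⟨e, -, hA, h2⟩ := h
    have hj : Desc (resid j) c₀ := by rw [h2]; exact (sparse_resid j).desc_comp_iff.2 hA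
    obtain ⟨k, hk⟩ := resid_nonempty j
    exact absurd (hj k hk) (not_lt.2 (h₀ k))

/-- Words leading to the same function have the same product. -/
theorem Run.prod_unique (hx : BraidRel x) (hN : 0 ≤ N) (hc₀ : Per n N c₀)
    (h₀ : ∀ k, c₀ k ≤ c₀ (k + 1)) {l l' : List (ZMod n)} {c : ℤ → ℤ} (h : Run resid l c₀ c)
    (h' : Run resid l' c₀ c) : (l.map x).prod = (l'.map x).prod ∧ l.length = l'.length := by
  induction l' generalizing l c with
  | nil =>
    obtain rfl : c = c₀ := h'
    rw [h.eq_nil h₀]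
    exact ⟨rfl, rfl⟩
  | cons i l' ih =>
    obtain ⟨e, h1, hA, rfl⟩ := h'
    obtain ⟨l₂, r₂, p₂, q₂⟩ := h.exchange hx hN hc₀ h₀ ((sparse_resid i).desc_comp_iff.2 hA)
    rw [(sparse_resid i).comp_swapAt_comp] at r₂
    obtain ⟨h3, h4⟩ := ih r₂ h1
    simp [p₂, q₂, h3, h4]

end

end AffineStanley

/-! ### The group as permutations of `ℤ`, and coordinates on the nilCoxeter algebra. -/

namespace AffineStanley

variable {n : ℕ}

/-! ### The generators and their relations -/

theorem nilGen_mul_self (i : ZMod n) : nilGen i * nilGen i = 0 := by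
  have := RingQuot.mkAlgHom_rel ℤ (NilRel.sq i)
  simpa [nilGen] using this

theorem braidRel_nilGen : BraidRel (nilGen : ZMod n → NilCoxeter n) where
  braid hn i := by
    have := RingQuot.mkAlgHom_rel ℤ (NilRel.braid i hn)
    simpa [nilGen] using this
  comm i j h h' := by
    have := RingQuot.mkAlgHom_rel ℤ (NilRel.comm i j h h')
    simpa [nilGen] using this

theorem affineMatrix_apply (i j : ZMod n) : affineMatrix n i j =
    if i = j then 1 else if j = i + 1 ∨ i = j + 1 then (if n = 2 then 0 else 3) else 2 := rfl

theorem simple_comm {i j : ZMod n} (h : i ≠ j + 1) (h' : j ≠ i + 1) :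
    (cox n).simple i * (cox n).simple j = (cox n).simple j * (cox n).simple i := by
  by_cases hij : i = j
  · rw [hij]
  have h1 := (cox n).simple_mul_simple_pow i j
  rw [affineMatrix_apply, if_neg hij, if_neg (by tauto), pow_two] at h1
  have h2 := eq_inv_of_mul_eq_one_left h1
  rw [mul_inv_rev, (cox n).inv_simple, (cox n).inv_simple] at h2
  exact h2

theorem simple_braid [Fact (1 < n)] (hn : n ≠ 2) (i : ZMod n) :
    (cox n).simple i * (cox n).simple (i + 1) * (cox n).simple i =
      (cox n).simple (i + 1) * (cox n).simple i * (cox n).simple (i + 1) := by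
  have h1 := (cox n).simple_mul_simple_pow i (i + 1)
  rw [affineMatrix_apply, if_neg (by simp), if_pos (Or.inl rfl), if_neg hn, pow_succ, pow_two] at h1
  have h2 : ((cox n).simple i * (cox n).simple (i + 1) * (cox n).simple i) *
      ((cox n).simple (i + 1) * (cox n).simple i * (cox n).simple (i + 1)) = 1 := by
    rw [← h1]; group
  have h3 := eq_inv_of_mul_eq_one_left h2
  rw [mul_inv_rev, mul_inv_rev, (cox n).inv_simple, (cox n).inv_simple, ← mul_assoc] at h3
  exact h3

theorem braidRel_simple [Fact (1 < n)] : BraidRel (cox n).simple where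
  braid hn i := simple_braid hn i
  comm _ _ h h' := simple_comm h h'

theorem wordProd_eq (l : List (ZMod n)) : (cox n).wordProd l = (l.map (cox n).simple).prod := rfl

section

variable [Fact (1 < n)]

/-! ### The action on functions -/

/-- The simple transposition `(i, i + 1)` of affine permutations. -/
def simplePerm (i : ZMod n) : Equiv.Perm ℤ where
  toFun := swapAt (resid i)
  invFun := swapAt (resid i)
  left_inv := (sparse_resid i).swapAt_swapAt
  right_inv := (sparse_resid i).swapAt_swapAt

theorem simplePerm_apply (i : ZMod n) (k : ℤ) : simplePerm i k = swapAt (resid i) k := rfl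

theorem simplePerm_mul_self (i : ZMod n) : simplePerm i * simplePerm i = 1 :=
  Equiv.ext (sparse_resid i).swapAt_swapAt

theorem isLiftable_simplePerm :
    (affineMatrix n).IsLiftable (simplePerm : ZMod n → Equiv.Perm ℤ) := by
  have hbr : n ≠ 2 → ∀ i : ZMod n, simplePerm i * simplePerm (i + 1) * simplePerm i =
      simplePerm (i + 1) * simplePerm i * simplePerm (i + 1) := fun hn i =>
    Equiv.ext fun k => congrFun ((linked_resid hn i).braid id) k
  have hinv : ∀ i : ZMod n, (simplePerm i)⁻¹ = simplePerm i := fun i =>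
    inv_eq_of_mul_eq_one_left (simplePerm_mul_self i)
  have h3 : ∀ a b : Equiv.Perm ℤ, a⁻¹ = a → b⁻¹ = b → a * b * a = b * a * b →
      (a * b) ^ 3 = 1 := by
    intro a b ha hb h
    have : (a * b) ^ 3 = (a * b * a) * (b * a * b) := by simp only [pow_succ, pow_zero]; group
    rw [this, h]
    have : (b * a * b) = (b * a * b)⁻¹ := by
      rw [mul_inv_rev, mul_inv_rev, ha, hb, mul_assoc]
    nth_rw 2 [this]
    exact mul_inv_cancel _
  intro i j
  rw [affineMatrix_apply]
  split_ifs with h1 h2 hn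
  · rw [h1, pow_one, simplePerm_mul_self]
  · rw [pow_zero]
  · rcases h2 with rfl | rfl
    · exact h3 _ _ (hinv _) (hinv _) (hbr hn i)
    · exact h3 _ _ (hinv _) (hinv _) (hbr hn j).symm
  · push Not at h2
    have hc : simplePerm i * simplePerm j = simplePerm j * simplePerm i := by
      have := (far_resid h1 h2.2 h2.1).comm (sparse_resid i) (sparse_resid j) id
      exact Equiv.ext fun k => congrFun this k
    rw [pow_two, mul_assoc, ← mul_assoc (simplePerm j), ← hc, mul_assoc, simplePerm_mul_self,
      mul_one, simplePerm_mul_self]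

/-- The affine symmetric group as a group of permutations of `ℤ`. -/
def permRep : AffineSym n →* Equiv.Perm ℤ := (cox n).lift ⟨simplePerm, isLiftable_simplePerm⟩

theorem permRep_simple (i : ZMod n) : permRep ((cox n).simple i) = simplePerm i :=
  (cox n).lift_apply_simple isLiftable_simplePerm i

/-- The translate `w • c` of a function on `ℤ`. -/
def translate (w : AffineSym n) (c : ℤ → ℤ) : ℤ → ℤ := fun k => c ((permRep w)⁻¹ k)

theorem translate_one (c : ℤ → ℤ) : translate (1 : AffineSym n) c = c := by
  funext k; simp [translate]

theorem translate_simple_mul (i : ZMod n) (w : AffineSym n) (c : ℤ → ℤ) :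
    translate ((cox n).simple i * w) c = translate w c ∘ swapAt (resid i) := by
  funext k
  rw [translate, map_mul, permRep_simple, mul_inv_rev, Equiv.Perm.mul_apply,
    inv_eq_of_mul_eq_one_left (simplePerm_mul_self i), simplePerm_apply]
  rfl

theorem Run.eq_translate {l : List (ZMod n)} {c d : ℤ → ℤ} (h : Run resid l c d) :
    d = translate ((cox n).wordProd l) c := by
  induction l generalizing d with
  | nil => rw [CoxeterSystem.wordProd_nil, translate_one]; exact h
  | cons i l ih =>
    obtain ⟨e, h1, -, rfl⟩ := h
    rw [CoxeterSystem.wordProd_cons, translate_simple_mul, ← ih h1]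

theorem per_translate {N : ℤ} {c : ℤ → ℤ} (hc : Per n N c) (w : AffineSym n) :
    Per n N (translate w c) := by
  induction w using (cox n).simple_induction_left with
  | one => rwa [translate_one]
  | mul_simple_left w i ih => rw [translate_simple_mul]; exact ih.swapAt i

omit [Fact (1 < n)] in
theorem per_id : Per n n (id : ℤ → ℤ) := fun _ => rfl

/-- The inverse affine permutation as a function. -/
abbrev oneLine (w : AffineSym n) : ℤ → ℤ := translate w id

theorem oneLine_injective (w : AffineSym n) : Function.Injective (oneLine w) :=
  fun _ _ h => (permRep w)⁻¹.injective h

/-- A new letter either meets ascents and is prepended, or meets descents and cancels against a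
letter exposed by `Run.exchange`. The last clause records that if nothing was cancelled, the given
word is itself a run; this is what reduced words need. -/
theorem exists_run_oneLine (l : List (ZMod n)) : ∃ l', (cox n).wordProd l' = (cox n).wordProd l ∧
    Run resid l' id (oneLine ((cox n).wordProd l)) ∧ l'.length ≤ l.length ∧
    (l'.length = l.length → Run resid l id (oneLine ((cox n).wordProd l))) := by
  induction l with
  | nil => exact ⟨[], rfl, by simp [Run, translate_one], le_rfl, fun _ => by
      simp [Run, translate_one]⟩
  | cons i l ih =>
    obtain ⟨l', h1, h2, h3, h4⟩ := ih
    rw [CoxeterSystem.wordProd_cons, oneLine, translate_simple_mul]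
    obtain ⟨k, hk⟩ := resid_nonempty i
    have hP := h2.per per_id
    rcases lt_trichotomy (oneLine ((cox n).wordProd l) k) (oneLine ((cox n).wordProd l) (k + 1))
      with h5 | h5 | h5
    · rw [← hP.asc_iff hk] at h5
      refine ⟨i :: l', by rw [CoxeterSystem.wordProd_cons, h1], ⟨_, h2, h5, rfl⟩, by simpa using h3,
        fun h6 => ⟨_, h4 (by simpa using h6), h5, rfl⟩⟩
    · have := oneLine_injective _ h5
      omega
    · rw [← hP.desc_iff hk] at h5
      obtain ⟨l₂, r₂, p₂, q₂⟩ := h2.exchange braidRel_simple (by positivity) per_id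
        (fun k => by simp) h5
      rw [← wordProd_eq, ← wordProd_eq, h1] at p₂
      refine ⟨l₂, ?_, r₂, ?_, ?_⟩
      · rw [p₂, CoxeterSystem.simple_mul_simple_cancel_left]
      · simp; omega
      · intro h6; simp at h6; omega

theorem run_of_isReduced {l : List (ZMod n)} (h : (cox n).IsReduced l) :
    Run resid l id (oneLine ((cox n).wordProd l)) := by
  obtain ⟨l', h1, -, h3, h4⟩ := exists_run_oneLine l
  refine h4 (le_antisymm h3 ?_)
  rw [← h.eq, ← h1]
  exact (cox n).length_wordProd_le l'

theorem Run.wordProd_eq_of_eq {l l' : List (ZMod n)} {d : ℤ → ℤ} (h : Run resid l id d)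
    (h' : Run resid l' id d) :
    (cox n).wordProd l = (cox n).wordProd l' ∧ l.length = l'.length :=
  h.prod_unique braidRel_simple (by positivity) per_id (fun k => by simp) h'

theorem Run.isReduced {l : List (ZMod n)} {d : ℤ → ℤ} (h : Run resid l id d) :
    (cox n).IsReduced l := by
  obtain ⟨l', h1, h2⟩ := (cox n).exists_isReduced ((cox n).wordProd l)
  have h3 := run_of_isReduced h1
  rw [← h2, oneLine, ← h.eq_translate] at h3
  rw [CoxeterSystem.IsReduced, (h.wordProd_eq_of_eq h3).2, h2, h1.eq]

theorem oneLine_inj {w w' : AffineSym n} (h : oneLine w = oneLine w') : w = w' := by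
  obtain ⟨l, h1, rfl⟩ := (cox n).exists_isReduced w
  obtain ⟨l', h1', rfl⟩ := (cox n).exists_isReduced w'
  exact ((run_of_isReduced h1).wordProd_eq_of_eq (h ▸ run_of_isReduced h1')).1

/-- Descents are visible in the one-line notation of the inverse. -/
theorem not_isLeftDescent_iff_asc (w : AffineSym n) (i : ZMod n) :
    ¬ (cox n).IsLeftDescent w i ↔ Asc (resid i) (oneLine w) := by
  obtain ⟨l, h1, rfl⟩ := (cox n).exists_isReduced w
  have h2 := run_of_isReduced h1
  rw [CoxeterSystem.not_isLeftDescent_iff]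
  constructor
  · intro h
    have h3 : (cox n).IsReduced (i :: l) := by
      rw [CoxeterSystem.IsReduced, CoxeterSystem.wordProd_cons, h, h1.eq, List.length_cons]
    obtain ⟨e, h4, h5, -⟩ := run_of_isReduced h3
    rwa [h4.right_unique h2] at h5
  · intro h
    have h3 : Run resid (i :: l) id _ := ⟨_, h2, h, rfl⟩
    rw [← CoxeterSystem.wordProd_cons, h3.isReduced.eq, h1.eq, List.length_cons]

/-! ### The basis of the nilCoxeter algebra -/

theorem prod_nilGen_eq_of_run {l l' : List (ZMod n)} {d : ℤ → ℤ} (h : Run resid l id d)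
    (h' : Run resid l' id d) : (l.map nilGen).prod = (l'.map nilGen).prod :=
  (h.prod_unique braidRel_nilGen (by positivity) per_id (fun k => by simp) h').1

theorem nilElt_wordProd {l : List (ZMod n)} (h : (cox n).IsReduced l) :
    nilElt ((cox n).wordProd l) = (l.map nilGen).prod := by
  obtain ⟨h1, h2⟩ := ((cox n).exists_isReduced ((cox n).wordProd l)).choose_spec
  refine prod_nilGen_eq_of_run (run_of_isReduced h1) ?_
  rw [← h2]
  exact run_of_isReduced h

/-- At the first letter, read from the right, that fails to create descents, `Run.exchange` exposes
the same letter next to it, and its square is zero. -/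
theorem prod_nilGen_eq_zero {l : List (ZMod n)} (h : ¬ (cox n).IsReduced l) :
    (l.map nilGen).prod = 0 := by
  induction l with
  | nil => exact absurd (by simp [CoxeterSystem.IsReduced]) h
  | cons i l ih =>
    rw [List.map_cons, List.prod_cons]
    by_cases h1 : (cox n).IsReduced l
    · have h2 := run_of_isReduced h1
      have hP := h2.per per_id
      obtain ⟨k, hk⟩ := resid_nonempty i
      rcases lt_trichotomy (oneLine ((cox n).wordProd l) k) (oneLine ((cox n).wordProd l) (k + 1))
        with h5 | h5 | h5
      · rw [← hP.asc_iff hk] at h5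
        exact absurd (Run.isReduced (l := i :: l) ⟨_, h2, h5, rfl⟩) h
      · have := oneLine_injective _ h5
        omega
      · rw [← hP.desc_iff hk] at h5
        obtain ⟨l₂, r₂, p₂, q₂⟩ := h2.exchange braidRel_nilGen (by positivity) per_id
          (fun k => by simp) h5
        rw [p₂, ← mul_assoc, nilGen_mul_self, zero_mul]
    · rw [ih h1, mul_zero]

theorem nilElt_one : nilElt (1 : AffineSym n) = 1 := by
  have := nilElt_wordProd (n := n) (l := []) (by simp [CoxeterSystem.IsReduced])
  simpa using this

theorem nilElt_simple (i : ZMod n) : nilElt ((cox n).simple i) = nilGen i := by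
  have := nilElt_wordProd (n := n) (l := [i]) (by
    rw [CoxeterSystem.IsReduced, CoxeterSystem.wordProd_singleton, CoxeterSystem.length_simple]
    rfl)
  rwa [CoxeterSystem.wordProd_singleton, List.map_singleton, List.prod_singleton] at this

theorem nilElt_mul {v w : AffineSym n}
    (h : (cox n).length (v * w) = (cox n).length v + (cox n).length w) :
    nilElt v * nilElt w = nilElt (v * w) := by
  obtain ⟨l, h1, rfl⟩ := (cox n).exists_isReduced v
  obtain ⟨l', h1', rfl⟩ := (cox n).exists_isReduced w
  rw [nilElt_wordProd h1, nilElt_wordProd h1', ← List.prod_append, ← List.map_append,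
    ← CoxeterSystem.wordProd_append, nilElt_wordProd]
  rw [CoxeterSystem.IsReduced, CoxeterSystem.wordProd_append, h, h1.eq, h1'.eq, List.length_append]

theorem nilElt_mul_eq_zero {v w : AffineSym n}
    (h : (cox n).length (v * w) ≠ (cox n).length v + (cox n).length w) :
    nilElt v * nilElt w = 0 := by
  obtain ⟨l, h1, rfl⟩ := (cox n).exists_isReduced v
  obtain ⟨l', h1', rfl⟩ := (cox n).exists_isReduced w
  rw [nilElt_wordProd h1, nilElt_wordProd h1', ← List.prod_append, ← List.map_append,
    prod_nilGen_eq_zero]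
  intro h2
  rw [CoxeterSystem.IsReduced, CoxeterSystem.wordProd_append, List.length_append, ← h1.eq,
    ← h1'.eq] at h2
  exact h h2

theorem mem_span_nilElt (a : NilCoxeter n) :
    a ∈ Submodule.span ℤ (Set.range (nilElt : AffineSym n → NilCoxeter n)) := by
  obtain ⟨f, rfl⟩ := RingQuot.mkAlgHom_surjective ℤ (NilRel n) a
  induction f using FreeAlgebra.induction with
  | grade0 r =>
    rw [AlgHom.commutes, Algebra.algebraMap_eq_smul_one, ← nilElt_one]
    exact Submodule.smul_mem _ _ (Submodule.subset_span ⟨1, rfl⟩)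
  | grade1 i => exact Submodule.subset_span ⟨_, nilElt_simple i⟩
  | add f g hf hg => rw [map_add]; exact Submodule.add_mem _ hf hg
  | mul f g hf hg =>
    rw [map_mul]
    refine Submodule.span_induction₂ (p := fun a b _ _ => a * b ∈ Submodule.span ℤ
      (Set.range (nilElt : AffineSym n → NilCoxeter n))) ?_ ?_ ?_ ?_ ?_ ?_ ?_ hf hg
    · rintro _ _ ⟨v, rfl⟩ ⟨w, rfl⟩
      by_cases h : (cox n).length (v * w) = (cox n).length v + (cox n).length w
      · rw [nilElt_mul h]; exact Submodule.subset_span ⟨_, rfl⟩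
      · rw [nilElt_mul_eq_zero h]; exact Submodule.zero_mem _
    · intro y _; rw [zero_mul]; exact Submodule.zero_mem _
    · intro y _; rw [mul_zero]; exact Submodule.zero_mem _
    · intro x y z _ _ _ h1 h2; rw [add_mul]; exact Submodule.add_mem _ h1 h2
    · intro x y z _ _ _ h1 h2; rw [mul_add]; exact Submodule.add_mem _ h1 h2
    · intro r x y _ _ h; rw [smul_mul_assoc]; exact Submodule.smul_mem _ _ h
    · intro r x y _ _ h; rw [mul_smul_comm]; exact Submodule.smul_mem _ _ h

theorem nilRel_nilOp {a b : FreeAlgebra ℤ (ZMod n)} (h : NilRel n a b) :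
    FreeAlgebra.lift ℤ (fun i : ZMod n => nilOp ℤ (resid i)) a =
      FreeAlgebra.lift ℤ (fun i : ZMod n => nilOp ℤ (resid i)) b := by
  induction h with
  | sq i => simpa using nilOp_mul_self (sparse_resid i) (resid_nonempty i)
  | braid i hn => simpa using nilOp_braid (linked_resid hn i)
  | comm i j h h' =>
    by_cases hij : i = j
    · rw [hij]
    · simpa using nilOp_comm (far_resid hij h h') (sparse_resid i) (sparse_resid j)

/-- The action of the affine nilCoxeter algebra on functions on `ℤ`. -/
def nilRep : NilCoxeter n →ₐ[ℤ] Module.End ℤ ((ℤ → ℤ) →₀ ℤ) :=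
  RingQuot.liftAlgHom ℤ ⟨FreeAlgebra.lift ℤ fun i : ZMod n => nilOp ℤ (resid i),
    fun _ _ h => nilRel_nilOp h⟩

theorem nilRep_nilGen (i : ZMod n) : nilRep (nilGen i) = nilOp ℤ (resid i) := by
  rw [nilRep, nilGen, RingQuot.liftAlgHom_mkAlgHom_apply, FreeAlgebra.lift_ι_apply]

theorem nilRep_prod (l : List (ZMod n)) :
    nilRep (l.map nilGen).prod = (l.map fun i => nilOp ℤ (resid i)).prod := by
  rw [map_list_prod, List.map_map]
  congr 2
  funext i
  exact nilRep_nilGen i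

/-- The coefficient of `A_w`. -/
def coef (w : AffineSym n) : NilCoxeter n →ₗ[ℤ] ℤ :=
  (Finsupp.lapply (oneLine w)).comp
    ((LinearMap.applyₗ (Finsupp.single id 1)).comp nilRep.toLinearMap)

theorem coef_apply (w : AffineSym n) (a : NilCoxeter n) :
    coef w a = nilRep a (Finsupp.single id 1) (oneLine w) := rfl

theorem nilRep_nilElt_id (w : AffineSym n) :
    nilRep (nilElt w) (Finsupp.single id 1) = Finsupp.single (oneLine w) 1 := by
  obtain ⟨l, h1, rfl⟩ := (cox n).exists_isReduced w
  rw [nilElt_wordProd h1, nilRep_prod, prod_nilOp_single (run_of_isReduced h1)]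

open Classical in
theorem coef_nilElt (w v : AffineSym n) : coef w (nilElt v) = if v = w then 1 else 0 := by
  rw [coef_apply, nilRep_nilElt_id, Finsupp.single_apply]
  congr 1
  exact propext ⟨oneLine_inj, fun h => h ▸ rfl⟩

theorem eq_sum_coef (a : NilCoxeter n) :
    ∃ c : AffineSym n →₀ ℤ, (∀ w, coef w a = c w) ∧ a = c.sum fun w z => z • nilElt w := by
  classical
  obtain ⟨c, hc⟩ := Finsupp.mem_span_range_iff_exists_finsupp.1 (mem_span_nilElt a)
  refine ⟨c, fun w => ?_, hc.symm⟩
  rw [← hc, Finsupp.sum, map_sum]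
  simp only [map_smul, coef_nilElt, smul_eq_mul, mul_ite, mul_one, mul_zero]
  rw [Finset.sum_ite_eq']
  split_ifs with h
  · rfl
  · exact (Finsupp.notMem_support_iff.1 h).symm

theorem ext_coef {a b : NilCoxeter n} (h : ∀ w, coef w a = coef w b) : a = b := by
  obtain ⟨c, h1, h2⟩ := eq_sum_coef a
  obtain ⟨d, h3, h4⟩ := eq_sum_coef b
  have : c = d := Finsupp.ext fun w => by rw [← h1, ← h3, h]
  rw [h2, h4, this]

end

end AffineStanley

/-! ### Cyclically decreasing elements as carriers moving values to the right. -/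

namespace AffineStanley

variable {n : ℕ}

/-! ### Cyclically decreasing words -/

theorem IsCycDecWord.tail {i : ZMod n} {l : List (ZMod n)} (h : IsCycDecWord (i :: l)) :
    IsCycDecWord l := ⟨(List.nodup_cons.1 h.1).2, (List.pairwise_cons.1 h.2).2⟩

theorem IsCycDecWord.sublist {l l' : List (ZMod n)} (h : IsCycDecWord l) (h' : l'.Sublist l) :
    IsCycDecWord l' := ⟨h.1.sublist h', h.2.sublist h'⟩

theorem prod_mul_of_commute {M : Type*} [Monoid M] {x : ZMod n → M} (hx : BraidRel x)
    {i : ZMod n} {l : List (ZMod n)} (h : ∀ j ∈ l, i ≠ j + 1 ∧ j ≠ i + 1) :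
    (l.map x).prod * x i = x i * (l.map x).prod := by
  induction l with
  | nil => simp
  | cons j l ih =>
    rw [List.map_cons, List.prod_cons, mul_assoc, ih fun k hk => h k (List.mem_cons_of_mem _ hk),
      ← mul_assoc, ← mul_assoc, hx.comm i j (h j (by simp)).1 (h j (by simp)).2]

/-- The first letter `i` of `l` can be brought to the front of `l'`: a letter preceding it there is
not `i - 1` by the order in `l'`, and not `i + 1` because it follows `i` in `l`. Thus `d_J` does not
depend on the chosen word. -/
theorem IsCycDecWord.prod_eq {M : Type*} [Monoid M] {x : ZMod n → M} (hx : BraidRel x)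
    {l l' : List (ZMod n)} (h : IsCycDecWord l) (h' : IsCycDecWord l')
    (e : l.toFinset = l'.toFinset) : (l.map x).prod = (l'.map x).prod := by
  induction l generalizing l' with
  | nil =>
    have : l' = [] := by simpa using e.symm
    rw [this]
  | cons i l ih =>
    have hi : i ∈ l' := by rw [← List.mem_toFinset, ← e]; simp
    obtain ⟨p, q, rfl⟩ := List.append_of_mem hi
    have h1 := h'.1
    have h2 := h'.2
    rw [List.nodup_append, List.nodup_cons] at h1
    rw [List.pairwise_append, List.pairwise_cons] at h2
    have hl := List.nodup_cons.1 h.1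
    have e' : l.toFinset = (p ++ q).toFinset := by
      have e1 : ∀ y, y ∈ i :: l ↔ y ∈ p ++ i :: q := fun y => by
        rw [← List.mem_toFinset, e, List.mem_toFinset]
      ext y
      have := e1 y
      simp only [List.mem_toFinset, List.mem_cons, List.mem_append] at this ⊢
      have h4 : y = i → ¬ (y ∈ p ∨ y ∈ q) := by
        rintro rfl (h5 | h5)
        · exact h1.2.2 _ h5 _ (by simp) rfl
        · exact h1.2.1.1 h5
      have h5 : y = i → y ∉ l := by rintro rfl; exact hl.1
      tauto
    have hp : ∀ j ∈ p, i ≠ j + 1 ∧ j ≠ i + 1 := by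
      intro j hj
      refine ⟨h2.2.2 j hj i (by simp), (List.pairwise_cons.1 h.2).1 j ?_⟩
      rw [← List.mem_toFinset, e']
      simp [hj]
    rw [List.map_cons, List.prod_cons, ih h.tail (h'.sublist (by simp)) e']
    simp only [List.map_append, List.map_cons, List.prod_append, List.prod_cons]
    rw [← mul_assoc, ← mul_assoc, prod_mul_of_commute hx hp]

/-- The integers with residue in `J`. -/
def preim (J : Finset (ZMod n)) : Set ℤ := {k | (k : ZMod n) ∈ J}

theorem mem_preim {J : Finset (ZMod n)} {k : ℤ} : k ∈ preim J ↔ (k : ZMod n) ∈ J := Iff.rfl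

theorem add_mem_preim {J : Finset (ZMod n)} {k : ℤ} : k + n ∈ preim J ↔ k ∈ preim J := by
  simp [mem_preim]

theorem add_mul_mem_preim {J : Finset (ZMod n)} {k t : ℤ} :
    k + n * t ∈ preim J ↔ k ∈ preim J := by
  simp [mem_preim]

theorem exists_notMem_preim [NeZero n] {J : Finset (ZMod n)} (hJ : J ≠ univ) (k : ℤ) :
    (∃ j < k, j ∉ preim J) ∧ ∃ j > k, j ∉ preim J := by
  obtain ⟨i, hi⟩ : ∃ i, i ∉ J := by
    by_contra! h
    exact hJ (eq_univ_iff_forall.2 h)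
  obtain ⟨r, rfl⟩ := ZMod.intCast_surjective i
  have hn : (0 : ℤ) < n := by exact_mod_cast Nat.pos_of_ne_zero (NeZero.ne n)
  have key : ∀ t : ℤ, r + n * t ∉ preim J := fun t => by rwa [add_mul_mem_preim]
  refine ⟨⟨_, ?_, key (-(|r| + |k| + 1))⟩, ⟨_, ?_, key (|r| + |k| + 1)⟩⟩
  · have := abs_nonneg r; have := abs_nonneg k; have := le_abs_self r; have := neg_abs_le k
    nlinarith
  · have := abs_nonneg r; have := abs_nonneg k; have := le_abs_self k; have := neg_abs_le r
    nlinarith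

theorem IsCycDecWord.run_iff [Fact (1 < n)] {l : List (ZMod n)} (h : IsCycDecWord l)
    {c d : ℤ → ℤ} : Run resid l c d ↔ ∃ m, Carries (preim l.toFinset) m c d := by
  rw [run_iff_carries sparse_resid]
  · have : {k : ℤ | ∃ i ∈ l, k ∈ resid i} = preim l.toFinset := by
      ext k; simp [mem_preim, mem_resid]
    rw [this]
  · refine (h.1.and h.2).imp ?_
    rintro i j ⟨h1, h2⟩ k hk
    rw [mem_resid] at hk
    simp only [mem_resid]
    push_cast
    rw [hk]
    exact ⟨h1, h2.symm⟩

/-! ### Carriers -/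

section Carries

variable {S : Set ℤ} {m m' c d d' : ℤ → ℤ}

theorem Carries.const (h : Carries S m c d) {k q : ℤ} (hkq : k ≤ q)
    (hS : ∀ i, k ≤ i → i < q → i ∈ S) : m q = m k := by
  induction q, hkq using Int.leInduction with
  | base => rfl
  | succ q hq ih =>
    rw [((h q).1 (hS q hq (by omega))).2.1, ih fun i h1 h2 => hS i h1 (by omega)]

theorem Carries.start (h : Carries S m c d) {k : ℤ} (hk : k - 1 ∉ S) : m k = c k := by
  have := ((h (k - 1)).2 hk).1
  rwa [sub_add_cancel] at this

theorem exists_least_notMem {k : ℤ} (hS : ∃ j > k, j ∉ S) :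
    ∃ q, k ≤ q ∧ q ∉ S ∧ ∀ i, k ≤ i → i < q → i ∈ S := by
  classical
  obtain ⟨j, hj, hjS⟩ := hS
  obtain ⟨q, ⟨h1, h2⟩, h3⟩ := Int.exists_least_of_bdd (P := fun q => k ≤ q ∧ q ∉ S)
    ⟨k, fun z hz => hz.1⟩ ⟨j, hj.le, hjS⟩
  refine ⟨q, h1, h2, fun i hi hi' => ?_⟩
  by_contra h4
  exact absurd (h3 i ⟨hi, h4⟩) (not_le.2 hi')

theorem exists_greatest_notMem {k : ℤ} (hS : ∃ j < k, j ∉ S) :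
    ∃ q, q ≤ k ∧ q - 1 ∉ S ∧ ∀ i, q ≤ i → i < k → i ∈ S := by
  classical
  obtain ⟨j, hj, hjS⟩ := hS
  obtain ⟨q, ⟨h1, h2⟩, h3⟩ := Int.exists_greatest_of_bdd (P := fun q => q ≤ k ∧ q - 1 ∉ S)
    ⟨k, fun z hz => hz.1⟩ ⟨j + 1, by omega, by simpa using hjS⟩
  refine ⟨q, h1, h2, fun i hi hi' => ?_⟩
  by_contra h4
  have := h3 (i + 1) ⟨by omega, by simpa using h4⟩
  omega

/-- The starting point of the carrier arriving at `k`. -/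
theorem exists_lead (hS : ∀ k, ∃ j < k, j ∉ S) : ∃ f : ℤ → ℤ,
    (∀ k, f k ≤ k ∧ f k - 1 ∉ S ∧ ∀ i, f k ≤ i → i < k → i ∈ S) ∧
    (∀ k ∈ S, f (k + 1) = f k) ∧ (∀ k, k ∉ S → f (k + 1) = k + 1) := by
  choose f hf using fun k => exists_greatest_notMem (hS k)
  refine ⟨f, hf, fun k hk => ?_, fun k hk => ?_⟩
  · obtain ⟨a1, a2, a3⟩ := hf k
    obtain ⟨b1, b2, b3⟩ := hf (k + 1)
    by_contra hne
    rcases lt_or_gt_of_ne hne with h | h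
    · exact a2 (b3 _ (by omega) (by omega))
    · rcases eq_or_lt_of_le b1 with h1 | h1
      · rw [h1] at b2; simp at b2; exact b2 hk
      · exact b2 (a3 _ (by omega) (by omega))
  · obtain ⟨b1, b2, b3⟩ := hf (k + 1)
    by_contra hne
    exact hk (b3 k (by omega) (by omega))

theorem Carries.eq_lead (h : Carries S m c d) {f : ℤ → ℤ}
    (hf : ∀ k, f k ≤ k ∧ f k - 1 ∉ S ∧ ∀ i, f k ≤ i → i < k → i ∈ S) (k : ℤ) :
    m k = c (f k) := by
  obtain ⟨a1, a2, a3⟩ := hf k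
  rw [h.const a1 a3, h.start a2]

theorem Carries.unique (hS : ∀ k, ∃ j < k, j ∉ S) (h : Carries S m c d)
    (h' : Carries S m' c d') : m = m' ∧ d = d' := by
  obtain ⟨f, hf, -, -⟩ := exists_lead hS
  have hm : m = m' := funext fun k => by rw [h.eq_lead hf, h'.eq_lead hf]
  refine ⟨hm, funext fun k => ?_⟩
  by_cases hk : k ∈ S
  · rw [((h k).1 hk).2.2, ((h' k).1 hk).2.2]
  · rw [((h k).2 hk).2, ((h' k).2 hk).2, hm]

/-- On each block of `S` the carrier is the entry at the start of the block, so it only has to be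
smaller than every entry it passes. -/
theorem exists_carries (hS : ∀ k, ∃ j < k, j ∉ S)
    (hc : ∀ j k, j ≤ k → j - 1 ∉ S → (∀ i, j ≤ i → i ≤ k → i ∈ S) → c j < c (k + 1)) :
    ∃ m d, Carries S m c d := by
  classical
  obtain ⟨f, hf, h1, h2⟩ := exists_lead hS
  refine ⟨c ∘ f, fun k => if k ∈ S then c (k + 1) else c (f k), fun k => ⟨fun hk => ?_,
    fun hk => ?_⟩⟩
  · obtain ⟨a1, a2, a3⟩ := hf k
    refine ⟨hc _ _ a1 a2 fun i hi hi' => ?_, by simp [h1 k hk], by simp [hk]⟩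
    rcases eq_or_lt_of_le hi' with rfl | h4
    · exact hk
    · exact a3 i hi h4
  · simp [hk, h2 k hk]

end Carries

section

variable [NeZero n] [Fact (1 < n)]

theorem lt_notMem_preim {J : Finset (ZMod n)} (hJ : J ≠ univ) :
    ∀ k, ∃ j < k, j ∉ preim J := fun k => (exists_notMem_preim hJ k).1

theorem gt_notMem_preim {J : Finset (ZMod n)} (hJ : J ≠ univ) :
    ∀ k, ∃ j > k, j ∉ preim J := fun k => (exists_notMem_preim hJ k).2

theorem IsCycDecWord.isReduced {l : List (ZMod n)} (h : IsCycDecWord l)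
    (hl : l.toFinset ≠ univ) : (cox n).IsReduced l := by
  obtain ⟨m, d, hd⟩ := exists_carries (c := id) (lt_notMem_preim hl) (fun j k h _ _ => by
    simp only [id]; omega)
  exact (h.run_iff.2 ⟨m, hd⟩).isReduced

theorem cycDec_eq {l : List (ZMod n)} (h : IsCycDecWord l) (hl : l.toFinset ≠ univ) :
    cycDec l.toFinset = (cox n).wordProd l := by
  have h1 := (exists_cycDecWord l.toFinset hl).choose_spec
  rw [cycDec, dif_pos hl, wordProd_eq, wordProd_eq]
  exact h1.1.prod_eq braidRel_simple h h1.2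

theorem length_cycDec {J : Finset (ZMod n)} (hJ : J ≠ univ) :
    (cox n).length (cycDec J) = J.card := by
  obtain ⟨l, h, rfl⟩ := exists_cycDecWord J hJ
  rw [cycDec_eq h hJ, (h.isReduced hJ).eq, List.toFinset_card_of_nodup h.1]

theorem nilElt_cycDec {l : List (ZMod n)} (h : IsCycDecWord l) (hl : l.toFinset ≠ univ) :
    nilElt (cycDec l.toFinset) = (l.map nilGen).prod := by
  rw [cycDec_eq h hl, nilElt_wordProd (h.isReduced hl)]

theorem IsCycIncWord.reverse {l : List (ZMod n)} (h : IsCycIncWord l) :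
    IsCycDecWord l.reverse :=
  ⟨List.nodup_reverse.2 h.1, List.pairwise_reverse.2 h.2⟩

theorem cycInc_eq_inv {J : Finset (ZMod n)} (hJ : J ≠ univ) : cycInc J = (cycDec J)⁻¹ := by
  obtain ⟨h1, h2⟩ := (exists_cycIncWord J hJ).choose_spec
  rw [cycInc, dif_pos hJ]
  set l := (exists_cycIncWord J hJ).choose
  have h3 : l.reverse.toFinset = J := by rw [List.toFinset_reverse, h2]
  rw [← h3, cycDec_eq h1.reverse (by rwa [h3]), CoxeterSystem.wordProd_reverse, inv_inv]

theorem length_cycInc {J : Finset (ZMod n)} (hJ : J ≠ univ) :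
    (cox n).length (cycInc J) = J.card := by
  rw [cycInc_eq_inv hJ, CoxeterSystem.length_inv, length_cycDec hJ]

omit [NeZero n] in
theorem ne_univ_of_notMem [NeZero n] {J : Finset (ZMod n)} {i : ZMod n} (h : i ∉ J) : J ≠ univ :=
  fun h' => h (h' ▸ mem_univ i)

theorem cycDec_insert_right {J : Finset (ZMod n)} {i : ZMod n} (hi : i ∉ J) (hi' : i - 1 ∉ J) :
    cycDec (insert i J) = cycDec J * (cox n).simple i := by
  obtain ⟨l, h, rfl⟩ := exists_cycDecWord J (ne_univ_of_notMem hi)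
  have h1 : (l ++ [i]).toFinset = insert i l.toFinset := by
    ext; simp
  have h2 : IsCycDecWord (l ++ [i]) := by
    refine ⟨?_, ?_⟩
    · rw [List.nodup_append]
      refine ⟨h.1, by simp, fun a ha b hb => ?_⟩
      rw [List.mem_singleton.1 hb]
      rintro rfl
      exact hi (List.mem_toFinset.2 ha)
    · rw [List.pairwise_append]
      refine ⟨h.2, by simp, fun a ha b hb => ?_⟩
      rw [List.mem_singleton.1 hb]
      rintro rfl
      exact hi' (by simpa using ha)
  have h3 : i - 1 ∉ insert i l.toFinset := by
    simp only [mem_insert, not_or]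
    exact ⟨by simp, hi'⟩
  rw [← h1, cycDec_eq h2 (by rw [h1]; exact ne_univ_of_notMem h3),
    cycDec_eq h (ne_univ_of_notMem hi), CoxeterSystem.wordProd_append,
    CoxeterSystem.wordProd_singleton]

theorem cycDec_insert_left {J : Finset (ZMod n)} {i : ZMod n} (hi : i ∉ J) (hi' : i + 1 ∉ J) :
    cycDec (insert i J) = (cox n).simple i * cycDec J := by
  obtain ⟨l, h, rfl⟩ := exists_cycDecWord J (ne_univ_of_notMem hi)
  have h1 : (i :: l).toFinset = insert i l.toFinset := by simp
  have h2 : IsCycDecWord (i :: l) := by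
    refine ⟨List.nodup_cons.2 ⟨fun h' => hi (List.mem_toFinset.2 h'), h.1⟩,
      List.pairwise_cons.2 ⟨?_, h.2⟩⟩
    rintro a ha rfl
    exact hi' (List.mem_toFinset.2 ha)
  have h3 : i + 1 ∉ insert i l.toFinset := by
    simp only [mem_insert, not_or]
    exact ⟨by simp, hi'⟩
  rw [← h1, cycDec_eq h2 (by rw [h1]; exact ne_univ_of_notMem h3),
    cycDec_eq h (ne_univ_of_notMem hi), CoxeterSystem.wordProd_cons]

theorem cycInc_insert_left {J : Finset (ZMod n)} {i : ZMod n} (hi : i ∉ J) (hi' : i - 1 ∉ J) :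
    cycInc (insert i J) = (cox n).simple i * cycInc J := by
  have h3 : i - 1 ∉ insert i J := by
    simp only [mem_insert, not_or]
    exact ⟨by simp, hi'⟩
  rw [cycInc_eq_inv (ne_univ_of_notMem h3), cycInc_eq_inv (ne_univ_of_notMem hi),
    cycDec_insert_right hi hi', mul_inv_rev, CoxeterSystem.inv_simple]

theorem cycDec_empty : cycDec (∅ : Finset (ZMod n)) = 1 := by
  have := cycDec_eq (n := n) (l := []) ⟨by simp, by simp⟩ (by
    rw [List.toFinset_nil]; exact (univ_nonempty.ne_empty).symm)
  simpa using this

end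

end AffineStanley

/-! ### Yang-Baxter on the line, and windows of periodic carriers. -/

namespace AffineStanley

variable {n : ℕ}

/-! ### Linear words and the Yang-Baxter equation -/

section YangBaxter

variable {R : Type*} [CommRing R]

theorem sparse_singleton (k : ℤ) : Sparse {k} := by intro j hj; simp_all

theorem far_singleton {j k : ℤ} (h : j + 1 < k ∨ k + 1 < j) : Far {j} {k} := by
  intro i hi
  simp only [Set.mem_singleton_iff] at hi ⊢
  omega

theorem linked_singleton (k : ℤ) : Linked {k} {k + 1} where
  succ_mem j := by simp
  one := by intro j hj; simp_all
  two := by intro j hj; simp_all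

/-- The factor `1 + t A_k`. -/
def factor (k : ℤ) (t : R) : Module.End R ((ℤ → ℤ) →₀ R) := 1 + t • nilOp R {k}

theorem factor_comm {j k : ℤ} (h : j + 1 < k ∨ k + 1 < j) (s t : R) :
    factor j s * factor k t = factor k t * factor j s := by
  have := nilOp_comm (R := R) (far_singleton h) (sparse_singleton j) (sparse_singleton k)
  simp only [factor, mul_add, add_mul, mul_one, one_mul, smul_mul_assoc, mul_smul_comm, this]
  module

/-- The Yang-Baxter equation with additive spectral parameters: squares vanish, and the coefficients
of the remaining words agree on both sides. -/
theorem factor_braid (k : ℤ) (x y : R) :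
    factor k x * factor (k + 1) y * factor k (y - x) =
      factor (k + 1) (y - x) * factor k y * factor (k + 1) x := by
  have h := nilOp_braid (R := R) (linked_singleton k)
  have h1 := nilOp_mul_self (R := R) (sparse_singleton k) (Set.singleton_nonempty k)
  have h2 := nilOp_mul_self (R := R) (sparse_singleton (k + 1)) (Set.singleton_nonempty _)
  simp only [factor, mul_add, add_mul, mul_one, one_mul, smul_mul_assoc, mul_smul_comm,
    h, h1, h2, smul_zero]
  module

theorem factor_mul_neg (k : ℤ) (x : R) : factor k x * factor k (-x) = 1 := by
  have h1 := nilOp_mul_self (R := R) (sparse_singleton k) (Set.singleton_nonempty k)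
  simp only [factor, mul_add, add_mul, mul_one, one_mul, smul_mul_assoc, mul_smul_comm,
    h1, smul_zero]
  module

/-- The product `(1 + t A_{s+n-1}) ⋯ (1 + t A_s)`. -/
def scan (s : ℤ) (t : R) : ℕ → Module.End R ((ℤ → ℤ) →₀ R)
  | 0 => 1
  | n + 1 => factor (s + n) t * scan s t n

theorem factor_scan_comm {s k : ℤ} {n : ℕ} (h : s + n < k) (t x : R) :
    scan s t n * factor k x = factor k x * scan s t n := by
  induction n with
  | zero => simp [scan]
  | succ n ih =>
    push_cast at h
    rw [scan, mul_assoc, ih (by omega), ← mul_assoc, ← mul_assoc, factor_comm (by omega)]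

/-- The auxiliary factor with parameter `y - x` enters at the right end, passes each site by
`factor_braid` while exchanging `x` and `y` there, and leaves at the left end `n` sites further
along. -/
theorem scan_mul_scan (s : ℤ) (x y : R) (n : ℕ) :
    scan s x n * scan (s + 1) y n * factor s (y - x) =
      factor (s + n) (y - x) * (scan s y n * scan (s + 1) x n) := by
  induction n with
  | zero => simp [scan]
  | succ n ih =>
    have e : s + 1 + (n : ℤ) = s + n + 1 := by ring
    have e' : s + ((n + 1 : ℕ) : ℤ) = s + n + 1 := by push_cast; ring
    have c1 : ∀ t u : R, scan s t n * factor (s + n + 1) u = factor (s + n + 1) u * scan s t n :=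
      fun t u => factor_scan_comm (by omega) t u
    simp only [scan, e, e']
    calc _ = factor (s + n) x * (scan s x n * factor (s + n + 1) y) *
          (scan (s + 1) y n * factor s (y - x)) := by simp only [mul_assoc]
      _ = factor (s + n) x * factor (s + n + 1) y *
          (scan s x n * scan (s + 1) y n * factor s (y - x)) := by rw [c1]; simp only [mul_assoc]
      _ = (factor (s + n) x * factor (s + n + 1) y * factor (s + n) (y - x)) *
          (scan s y n * scan (s + 1) x n) := by rw [ih]; simp only [mul_assoc]
      _ = factor (s + n + 1) (y - x) * factor (s + n) y *
          (factor (s + n + 1) x * scan s y n) * scan (s + 1) x n := by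
            rw [factor_braid]; simp only [mul_assoc]
      _ = _ := by rw [← c1]; simp only [mul_assoc]

theorem scan_mul_scan' (s : ℤ) (x y : R) (n : ℕ) :
    scan s x n * scan (s + 1) y n =
      factor (s + n) (y - x) * (scan s y n * scan (s + 1) x n) * factor s (-(y - x)) := by
  rw [← scan_mul_scan, mul_assoc, factor_mul_neg, mul_one]

open Classical in
theorem nilOp_apply {U : Set ℤ} (hU : Sparse U) (v : (ℤ → ℤ) →₀ R) (d : ℤ → ℤ) :
    nilOp R U v d = if Desc U d then v (d ∘ swapAt U) else 0 := by
  induction v using Finsupp.induction_linear with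
  | zero => simp
  | add f g hf hg => rw [map_add, Finsupp.add_apply, hf, hg]; split_ifs <;> simp
  | single c r =>
    rw [nilOp_single]
    have e : c ∘ swapAt U = d ↔ c = d ∘ swapAt U :=
      ⟨fun h => by rw [← h, hU.comp_swapAt_comp], fun h => by rw [h, hU.comp_swapAt_comp]⟩
    by_cases h : c = d ∘ swapAt U
    · rw [h, hU.asc_comp_iff, hU.comp_swapAt_comp]
      split_ifs <;> simp
    · have h' := mt e.1 h
      split_ifs <;> simp [h, h']

/-- The increasing factors of the letters `s + k`, `k ∈ S`, `k < n`, largest letter first. -/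
def linWord (s : ℤ) (S : Finset ℕ) : ℕ → List ℤ
  | 0 => []
  | n + 1 => if n ∈ S then (s + n) :: linWord s S n else linWord s S n

theorem linWord_congr (s : ℤ) {S S' : Finset ℕ} {n : ℕ} (h : ∀ k < n, k ∈ S ↔ k ∈ S') :
    linWord s S n = linWord s S' n := by
  induction n with
  | zero => rfl
  | succ n ih =>
    simp only [linWord, h n (by omega), ih fun k hk => h k (by omega)]

theorem mem_linWord {s : ℤ} {S : Finset ℕ} {n : ℕ} {z : ℤ} :
    z ∈ linWord s S n ↔ ∃ k < n, k ∈ S ∧ z = s + k := by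
  induction n with
  | zero => simp [linWord]
  | succ n ih =>
    rw [linWord]
    split_ifs with h
    · rw [List.mem_cons, ih]
      constructor
      · rintro (rfl | ⟨k, h1, h2, h3⟩)
        · exact ⟨n, by omega, h, rfl⟩
        · exact ⟨k, by omega, h2, h3⟩
      · rintro ⟨k, h1, h2, h3⟩
        rcases Nat.lt_succ_iff_lt_or_eq.1 h1 with h4 | rfl
        · exact Or.inr ⟨k, h4, h2, h3⟩
        · exact Or.inl h3
    · rw [ih]
      constructor
      · rintro ⟨k, h1, h2, h3⟩
        exact ⟨k, by omega, h2, h3⟩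
      · rintro ⟨k, h1, h2, h3⟩
        rcases Nat.lt_succ_iff_lt_or_eq.1 h1 with h4 | rfl
        · exact ⟨k, h4, h2, h3⟩
        · exact absurd h2 h

theorem linWord_pairwise (s : ℤ) (S : Finset ℕ) (n : ℕ) :
    (linWord s S n).Pairwise fun i j => j < i := by
  induction n with
  | zero => simp [linWord]
  | succ n ih =>
    rw [linWord]
    split_ifs with h
    · refine List.pairwise_cons.2 ⟨fun z hz => ?_, ih⟩
      obtain ⟨k, h1, -, rfl⟩ := mem_linWord.1 hz
      omega
    · exact ih

theorem scan_eq_sum (s : ℤ) (t : R) (n : ℕ) :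
    scan s t n = ∑ S ∈ (range n).powerset,
      t ^ S.card • ((linWord s S n).map fun k => nilOp R {k}).prod := by
  induction n with
  | zero => simp [scan, linWord]
  | succ n ih =>
    rw [range_add_one, sum_powerset_insert (by simp), scan, factor, add_mul, one_mul, ih,
      smul_mul_assoc, mul_sum, smul_sum]
    congr 1
    · refine sum_congr rfl fun S hS => ?_
      have : n ∉ S := fun h => by simpa using mem_powerset.1 hS h
      rw [linWord, if_neg this]
    · refine sum_congr rfl fun S hS => ?_
      have h1 : n ∉ S := fun h => by simpa using mem_powerset.1 hS h
      rw [linWord, if_pos (mem_insert_self _ _), card_insert_of_notMem h1,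
        linWord_congr s (S := insert n S) (S' := S) (fun k hk => by
          simp [mem_insert, show k ≠ n by omega])]
      simp only [List.map_cons, List.prod_cons, mul_smul_comm, smul_smul, pow_succ, mul_comm]

end YangBaxter

/-! ### Windows of periodic carriers -/

section Window

variable [NeZero n] [Fact (1 < n)]

theorem exists_window (s k : ℤ) : ∃ k₀ t : ℤ, s ≤ k₀ ∧ k₀ < s + n ∧ k = k₀ + n * t := by
  have hn : (0 : ℤ) < n := by exact_mod_cast Nat.pos_of_ne_zero (NeZero.ne n)
  refine ⟨s + (k - s) % n, (k - s) / n, ?_, ?_, ?_⟩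
  · have := Int.emod_nonneg (k - s) hn.ne'; omega
  · have := Int.emod_lt_of_pos (k - s) hn; omega
  · have := Int.emod_add_mul_ediv (k - s) n
    linarith

theorem exists_per (N s : ℤ) (g : ℤ → ℤ) :
    ∃ d, Per n N d ∧ ∀ k, s ≤ k → k < s + n → d k = g k := by
  have hn : (0 : ℤ) < n := by exact_mod_cast Nat.pos_of_ne_zero (NeZero.ne n)
  refine ⟨fun k => g (s + (k - s) % n) + N * ((k - s) / n), fun k => ?_, fun k h1 h2 => ?_⟩
  · have e : k + n - s = (k - s) + n := by ring
    simp only [e, Int.add_emod_right]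
    rw [Int.add_ediv_of_dvd_right (dvd_refl _), Int.ediv_self hn.ne']
    ring
  · have h3 : (k - s) % n = k - s := Int.emod_eq_of_lt (by omega) (by omega)
    have h4 : (k - s) / n = 0 := Int.ediv_eq_zero_of_lt (by omega) (by omega)
    simp only [h3, h4]
    ring_nf

variable {N : ℤ} {J : Finset (ZMod n)} {c d m : ℤ → ℤ}

theorem Carries.per (hJ : J ≠ univ) (hc : Per n N c) (h : Carries (preim J) m c d) :
    Per n N m ∧ Per n N d := by
  have h' : Carries (preim J) (fun k => m (k + n) - N) c (fun k => d (k + n) - N) := by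
    intro k
    have h1 := h (k + n)
    rw [add_mem_preim, show k + n + 1 = k + 1 + n by ring, hc] at h1
    refine ⟨fun hk => ?_, fun hk => ?_⟩
    · obtain ⟨a, b, e⟩ := h1.1 hk
      exact ⟨by linarith, by linarith, by linarith⟩
    · obtain ⟨a, b⟩ := h1.2 hk
      exact ⟨by linarith, by linarith⟩
  obtain ⟨h1, h2⟩ := h.unique (lt_notMem_preim hJ) h'
  refine ⟨fun k => ?_, fun k => ?_⟩
  · have := congrFun h1 k
    linarith
  · have := congrFun h2 k
    linarith

/-- The part of `preim J` in the window `[s, s + n)`. -/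
def window (s : ℤ) (J : Finset (ZMod n)) : Set ℤ := {k | s ≤ k ∧ k < s + n ∧ k ∈ preim J}

/-- A carrier on the line over one window closes up to a periodic one when the value leaving at `s +
n` is the value entering at `s` shifted by `N`. Accordingly `f s` stands for the incoming carrier
and not for an entry of `c`. -/
theorem carries_of_window {s : ℤ} {μ f g : ℤ → ℤ} (hN : N ≠ 0) (hc : Per n N c) (hd : Per n N d)
    (h : Carries (window s J) μ f g) (hf : ∀ k, s < k → k ≤ s + n → f k = c k)
    (hg : g (s + n) = f s + N) (hgd : ∀ k, s ≤ k → k < s + n → g k = d k) :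
    J ≠ univ ∧ ∃ m, Carries (preim J) m c d ∧ m s = f s := by
  have hn : (0 : ℤ) < n := by exact_mod_cast Nat.pos_of_ne_zero (NeZero.ne n)
  have h0 : μ s = f s := h.start fun h => by have := h.1; omega
  have h1 : μ (s + n) = μ s + N := by
    have := ((h (s + n)).2 fun h => by have := h.2.1; omega).2
    rw [← this, hg, h0]
  refine ⟨?_, ?_⟩
  -- If all residues were used, a single carrier would cross the window with unchanged value,
  -- contradicting the shift by `N ≠ 0`.
  · rintro rfl
    have := h.const (k := s) (q := s + n) (by omega) fun i hi hi' => ⟨hi, hi', mem_univ _⟩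
    omega
  · obtain ⟨m, hm, hmμ⟩ := exists_per (n := n) N s μ
    have hmμ' : ∀ k, s ≤ k → k ≤ s + n → m k = μ k := by
      intro k hk hk'
      rcases eq_or_lt_of_le hk' with rfl | h2
      · rw [hm, hmμ s le_rfl (by omega), h1]
      · exact hmμ k hk h2
    refine ⟨m, fun k => ?_, by rw [hmμ' s le_rfl (by omega), h0]⟩
    obtain ⟨k₀, t, a1, a2, rfl⟩ := exists_window (n := n) s k
    rw [show k₀ + n * t + 1 = k₀ + 1 + n * t by ring]
    simp only [add_mul_mem_preim, hm.add_mul, hc.add_mul, hd.add_mul]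
    rw [hmμ' k₀ a1 a2.le, hmμ' (k₀ + 1) (by omega) (by omega), ← hf (k₀ + 1) (by omega) (by omega),
      ← hgd k₀ a1 a2]
    refine ⟨fun hk => ?_, fun hk => ?_⟩
    · obtain ⟨b1, b2, b3⟩ := (h k₀).1 ⟨a1, a2, hk⟩
      exact ⟨by linarith, by linarith, by linarith⟩
    · obtain ⟨b1, b2⟩ := (h k₀).2 fun h' => hk h'.2.2
      exact ⟨by linarith, by linarith⟩

/-- The function `f` with the values in the window `[s, s + n]` replaced by those of `d` and, at
the end, `z`. -/
def patch (n : ℕ) (s : ℤ) (d : ℤ → ℤ) (z : ℤ) (f : ℤ → ℤ) (k : ℤ) : ℤ :=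
  if s ≤ k ∧ k < s + n then d k else if k = s + n then z else f k

theorem window_of_carries {s : ℤ} {f : ℤ → ℤ} (hJ : J ≠ univ) (hc : Per n N c)
    (h : Carries (preim J) m c d) (hfs : f s = m s) (hf : ∀ k, s < k → k ≤ s + n → f k = c k) :
    ∃ μ, Carries (window s J) μ f (patch n s d (m s + N) f) := by
  have hm := (h.per hJ hc).1
  have hn : (0 : ℤ) < n := by exact_mod_cast Nat.pos_of_ne_zero (NeZero.ne n)
  refine ⟨fun k => if s ≤ k ∧ k ≤ s + n then m k else f k, fun k => ?_⟩
  simp only [patch]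
  by_cases h1 : s ≤ k ∧ k < s + n
  · rw [if_pos (by omega), if_pos (by omega), if_pos h1, hf (k + 1) (by omega) (by omega)]
    have : k ∈ window s J ↔ k ∈ preim J := ⟨fun h => h.2.2, fun h => ⟨h1.1, h1.2, h⟩⟩
    rw [this]
    exact h k
  · refine ⟨fun hk => absurd ⟨hk.1, hk.2.1⟩ h1, fun _ => ?_⟩
    rw [if_neg h1]
    by_cases h2 : k = s + n
    · subst h2
      rw [if_neg (by omega), if_pos rfl, if_pos (by omega), hm]
      exact ⟨rfl, rfl⟩
    · have h3 : ¬(s ≤ k ∧ k ≤ s + n) := by omega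
      rw [if_neg h2, if_neg h3]
      refine ⟨?_, rfl⟩
      split_ifs with h4
      · have : k + 1 = s := by omega
        rw [this, hfs]
      · rfl

end Window

end AffineStanley

namespace AffineStanley

variable {n : ℕ}

/-! ### Commutation of the noncommutative complete homogeneous functions -/

section Commutation

variable [NeZero n] [Fact (1 < n)]

open Classical in
theorem scan_eq_sum_finset {R : Type*} [CommRing R] (s : ℤ) (t : R) :
    scan s t n = ∑ J : Finset (ZMod n), t ^ J.card •
      ((linWord s ((range n).filter fun k : ℕ => ((s + k : ℤ) : ZMod n) ∈ J) n).map
        fun k => nilOp R {k}).prod := by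
  have hn : 0 < n := Nat.pos_of_ne_zero (NeZero.ne n)
  have inj : ∀ a < n, ∀ b < n, ((s + (a : ℕ) : ℤ) : ZMod n) = ((s + (b : ℕ) : ℤ) : ZMod n) →
      a = b := by
    intro a ha b hb h
    push_cast at h
    have h' := (ZMod.natCast_eq_natCast_iff' a b n).1 (add_left_cancel h)
    rwa [Nat.mod_eq_of_lt ha, Nat.mod_eq_of_lt hb] at h'
  have pull : ∀ S ∈ (range n).powerset, (range n).filter (fun k : ℕ => ((s + k : ℤ) : ZMod n) ∈
      S.image fun k : ℕ => ((s + k : ℤ) : ZMod n)) = S := by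
    intro S hS
    ext k
    rw [mem_filter, mem_range, mem_image]
    constructor
    · rintro ⟨h1, j, h2, h3⟩
      rwa [← inj j (mem_range.1 (mem_powerset.1 hS h2)) k h1 h3]
    · exact fun h => ⟨mem_range.1 (mem_powerset.1 hS h), k, h, rfl⟩
  rw [scan_eq_sum]
  refine sum_bij' (fun S _ => S.image fun k : ℕ => ((s + k : ℤ) : ZMod n))
    (fun J _ => (range n).filter fun k : ℕ => ((s + k : ℤ) : ZMod n) ∈ J)
    (fun _ _ => mem_univ _) (fun J _ => mem_powerset.2 (filter_subset _ _)) pull ?_ ?_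
  · intro J _
    ext i
    rw [mem_image]
    constructor
    · rintro ⟨k, h1, rfl⟩
      exact (mem_filter.1 h1).2
    · intro hi
      have h1 : ((s + ((i - (s : ZMod n)).val : ℕ) : ℤ) : ZMod n) = i := by
        push_cast
        rw [ZMod.natCast_zmod_val]
        ring
      exact ⟨(i - (s : ZMod n)).val, mem_filter.2 ⟨mem_range.2 (ZMod.val_lt _), by rwa [h1]⟩, h1⟩
  · intro S hS
    rw [pull S hS, card_image_of_injOn]
    intro a ha b hb h
    exact inj a (mem_range.1 (mem_powerset.1 hS ha)) b (mem_range.1 (mem_powerset.1 hS hb)) h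

open Classical in
theorem run_linWord_iff {s : ℤ} {J : Finset (ZMod n)} {c d : ℤ → ℤ} :
    Run (fun k : ℤ => ({k} : Set ℤ))
      (linWord s ((range n).filter fun k : ℕ => ((s + k : ℤ) : ZMod n) ∈ J) n) c d ↔
      ∃ m, Carries (window s J) m c d := by
  rw [run_iff_carries fun k => sparse_singleton k]
  · have : {k : ℤ | ∃ i ∈ linWord s ((range n).filter fun k : ℕ => ((s + k : ℤ) : ZMod n) ∈ J) n,
        k ∈ ({i} : Set ℤ)} = window s J := by
      ext k
      simp only [Set.mem_ofPred_eq, mem_linWord, mem_filter, mem_range, Set.mem_singleton_iff,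
        window, mem_preim]
      constructor
      · rintro ⟨i, ⟨j, h1, ⟨-, h2⟩, rfl⟩, rfl⟩
        exact ⟨by omega, by omega, h2⟩
      · rintro ⟨h1, h2, h3⟩
        have h4 : s + ((k - s).toNat : ℤ) = k := by omega
        exact ⟨k, ⟨(k - s).toNat, by omega, ⟨by omega, by rwa [h4]⟩, h4.symm⟩, rfl⟩
    rw [this]
  · refine (linWord_pairwise _ _ _).imp fun h k hk => ?_
    simp only [Set.mem_singleton_iff] at hk ⊢
    omega

/-- The state `c` with the values at `-1` and `0` replaced. -/
def opened (c : ℤ → ℤ) (z z' : ℤ) (k : ℤ) : ℤ := if k = -1 then z else if k = 0 then z' else c k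

/-- The state which agrees with `d` on `[-1, n - 1)`, with `z, z'` at `n - 1, n` and with `c`
elsewhere. -/
def closed (n : ℕ) (c d : ℤ → ℤ) (z z' : ℤ) (k : ℤ) : ℤ :=
  if -1 ≤ k ∧ k < n - 1 then d k else if k = n - 1 then z else if k = n then z' else c k

/-- The cycle is cut open. The row `J`, acting first, uses the window starting at `0`, and the row
`I` the window starting at `-1`, so that their incoming carriers `z'` and `z` sit in adjacent cells;
the same carriers leave, shifted by `N`, at `n` and `n - 1`. -/
theorem window_pair_iff {N : ℤ} (hN : N ≠ 0) {c d : ℤ → ℤ} (hc : Per n N c) (hd : Per n N d)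
    (I J : Finset (ZMod n)) (z z' : ℤ) :
    (∃ f, (∃ μ, Carries (window 0 J) μ (opened c z z') f) ∧
      ∃ μ, Carries (window (-1) I) μ f (closed n c d (z + N) (z' + N))) ↔
    I ≠ univ ∧ J ≠ univ ∧ ∃ e mJ mI, Carries (preim J) mJ c e ∧ Carries (preim I) mI e d ∧
      mJ 0 = z' ∧ mI (-1) = z := by
  have hn : (1 : ℤ) < n := by exact_mod_cast (Fact.out : 1 < n)
  constructor
  · rintro ⟨f, ⟨μ, h⟩, μ', h'⟩
    obtain ⟨e, he, hef⟩ := exists_per (n := n) N 0 f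
    have f1 : f n = z' + N := by
      have h1 := ((h' n).2 fun h => by have := h.2.1; omega).2
      have h2 := ((h' (n - 1)).2 fun h => by have := h.2.1; omega).1
      rw [sub_add_cancel] at h2
      rw [← h2, ← h1, closed, if_neg (by omega), if_neg (by omega), if_pos rfl]
    have f2 : f (-1) = z := by
      have h1 := ((h (-1)).2 fun h => by have := h.1; omega).2
      have h2 := h.start (k := -1) fun h => by have := h.1; omega
      rw [h1, h2, opened, if_pos rfl]
    obtain ⟨hJ, mJ, a1, a2⟩ := carries_of_window hN hc he h
      (fun k h1 h2 => by rw [opened, if_neg (by omega), if_neg (by omega)])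
      (by rw [zero_add, f1]; simp [opened])
      (fun k h1 h2 => (hef k h1 h2).symm)
    obtain ⟨hI, mI, b1, b2⟩ := carries_of_window hN he hd h'
      (fun k h1 h2 => (hef k (by omega) (by omega)).symm)
      (by
        rw [f2, closed, if_neg (by omega), if_pos (by ring)])
      (fun k h1 h2 => by rw [closed, if_pos ⟨h1, by omega⟩])
    refine ⟨hI, hJ, e, mJ, mI, a1, b1, by simp [a2, opened], by rw [b2, f2]⟩
  · rintro ⟨hI, hJ, e, mJ, mI, h, h', rfl, rfl⟩
    have he := (h.per hJ hc).2
    obtain ⟨μ, hμ⟩ := window_of_carries (s := 0) (f := opened c (mI (-1)) (mJ 0)) hJ hc h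
      (by simp [opened]) (fun k h1 h2 => by rw [opened, if_neg (by omega), if_neg (by omega)])
    obtain ⟨μ', hμ'⟩ := window_of_carries (s := -1)
      (f := patch n 0 e (mJ 0 + N) (opened c (mI (-1)) (mJ 0))) hI he h'
      (by
        rw [patch, if_neg (by omega), if_neg (by omega), opened, if_pos rfl])
      (fun k h1 h2 => by rw [patch, if_pos ⟨by omega, by omega⟩])
    refine ⟨_, ⟨μ, hμ⟩, μ', ?_⟩
    convert hμ' using 1
    funext k
    simp only [closed, patch, opened]
    split_ifs <;> first | rfl | omega

/-- The coefficients of `d` in `A_{d_I} A_{d_J} c`. -/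
def Good (c d : ℤ → ℤ) (I J : Finset (ZMod n)) : Prop :=
  I ≠ univ ∧ J ≠ univ ∧ ∃ e mJ mI, Carries (preim J) mJ c e ∧ Carries (preim I) mI e d

/-- The carriers are determined by `c`, `I` and `J`, and there are finitely many pairs of subsets;
so the trace over the cut is a finite sum. -/
theorem exists_bound (c d : ℤ → ℤ) : ∃ F : Finset ℤ, ∀ I J : Finset (ZMod n), ∀ e mJ mI,
    I ≠ univ → J ≠ univ → Carries (preim J) mJ c e → Carries (preim I) mI e d →
    mJ 0 ∈ F ∧ mI (-1) ∈ F := by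
  classical
  have key : ∀ p : Finset (ZMod n) × Finset (ZMod n), ∃ F : Finset ℤ, ∀ e mJ mI,
      p.1 ≠ univ → p.2 ≠ univ → Carries (preim p.2) mJ c e → Carries (preim p.1) mI e d →
      mJ 0 ∈ F ∧ mI (-1) ∈ F := by
    intro p
    by_cases h : ∃ e mJ mI, p.1 ≠ univ ∧ p.2 ≠ univ ∧ Carries (preim p.2) mJ c e ∧
        Carries (preim p.1) mI e d
    · obtain ⟨e, mJ, mI, h1, h2, h3, h4⟩ := h
      refine ⟨{mJ 0, mI (-1)}, fun e' mJ' mI' _ _ h3' h4' => ?_⟩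
      obtain ⟨rfl, rfl⟩ := h3.unique (lt_notMem_preim h2) h3'
      obtain ⟨rfl, -⟩ := h4.unique (lt_notMem_preim h1) h4'
      simp
    · exact ⟨∅, fun e mJ mI h1 h2 h3 h4 => absurd ⟨e, mJ, mI, h1, h2, h3, h4⟩ h⟩
  choose F hF using key
  refine ⟨univ.biUnion F, fun I J e mJ mI h1 h2 h3 h4 => ?_⟩
  obtain ⟨a, b⟩ := hF (I, J) e mJ mI h1 h2 h3 h4
  exact ⟨mem_biUnion.2 ⟨_, mem_univ _, a⟩, mem_biUnion.2 ⟨_, mem_univ _, b⟩⟩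

-- Each admissible pair of rows contributes for exactly one choice of values at the cut, namely
-- those of its own carriers. The trace of the line operators thus counts pairs of cyclic rows.
open Classical in
theorem trace_scan_eq {R : Type*} [CommRing R] {N : ℤ} (hN : N ≠ 0) {c d : ℤ → ℤ}
    (hc : Per n N c) (hd : Per n N d) {F : Finset ℤ}
    (hF : ∀ I J : Finset (ZMod n), ∀ e mJ mI, I ≠ univ → J ≠ univ → Carries (preim J) mJ c e →
      Carries (preim I) mI e d → mJ 0 ∈ F ∧ mI (-1) ∈ F) (x y : R) :
    ∑ p ∈ F ×ˢ F, (scan (-1) x n * scan 0 y n)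
      (Finsupp.single (opened c p.1 p.2) 1) (closed n c d (p.1 + N) (p.2 + N)) =
    ∑ I : Finset (ZMod n), ∑ J : Finset (ZMod n),
      x ^ I.card * y ^ J.card * if Good c d I J then 1 else 0 := by
  have h1 : ∀ p : ℤ × ℤ, (scan (-1) x n * scan 0 y n)
      (Finsupp.single (opened c p.1 p.2) 1) (closed n c d (p.1 + N) (p.2 + N)) =
      ∑ I : Finset (ZMod n), ∑ J : Finset (ZMod n), x ^ I.card * y ^ J.card *
        if I ≠ univ ∧ J ≠ univ ∧ ∃ e mJ mI, Carries (preim J) mJ c e ∧ Carries (preim I) mI e d ∧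
          mJ 0 = p.2 ∧ mI (-1) = p.1 then 1 else 0 := by
    intro p
    rw [scan_eq_sum_finset, scan_eq_sum_finset, sum_mul_sum]
    simp only [LinearMap.sum_apply, Finsupp.finsetSum_apply]
    refine sum_congr rfl fun I _ => sum_congr rfl fun J _ => ?_
    rw [smul_mul_smul_comm, ← List.prod_append, ← List.map_append, LinearMap.smul_apply,
      Finsupp.smul_apply, smul_eq_mul, prod_nilOp_single_apply, run_append]
    simp only [run_linWord_iff, window_pair_iff hN hc hd]
  simp only [h1]
  rw [sum_comm]
  refine sum_congr rfl fun I _ => ?_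
  rw [sum_comm]
  refine sum_congr rfl fun J _ => ?_
  rw [← mul_sum]
  congr 1
  by_cases h : Good c d I J
  · rw [if_pos h]
    obtain ⟨hI, hJ, e, mJ, mI, a, b⟩ := h
    obtain ⟨f1, f2⟩ := hF I J e mJ mI hI hJ a b
    rw [sum_eq_single_of_mem (mI (-1), mJ 0) (mem_product.2 ⟨f2, f1⟩)]
    · rw [if_pos ⟨hI, hJ, e, mJ, mI, a, b, rfl, rfl⟩]
    · rintro ⟨z, z'⟩ _ hne
      rw [if_neg]
      rintro ⟨-, -, e', mJ', mI', a', b', rfl, rfl⟩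
      obtain ⟨rfl, rfl⟩ := a.unique (lt_notMem_preim hJ) a'
      obtain ⟨rfl, -⟩ := b.unique (lt_notMem_preim hI) b'
      exact hne rfl
  · rw [if_neg h]
    refine sum_eq_zero fun p _ => if_neg ?_
    rintro ⟨hI, hJ, e, mJ, mI, a, b, -, -⟩
    exact h ⟨hI, hJ, e, mJ, mI, a, b⟩

/-- By `scan_mul_scan'` the two products differ by a factor at each end of the line. These act on
the two cells at the cut only, and under the trace their effects cancel, as for a conjugation. -/
theorem trace_scan_comm {R : Type*} [CommRing R] (N : ℤ) (c d : ℤ → ℤ) (F : Finset ℤ) (x y : R) :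
    ∑ p ∈ F ×ˢ F, (scan (-1) x n * scan 0 y n)
      (Finsupp.single (opened c p.1 p.2) 1) (closed n c d (p.1 + N) (p.2 + N)) =
    ∑ p ∈ F ×ˢ F, (scan (-1) y n * scan 0 x n)
      (Finsupp.single (opened c p.1 p.2) 1) (closed n c d (p.1 + N) (p.2 + N)) := by
  classical
  have hn : (1 : ℤ) < n := by exact_mod_cast (Fact.out : 1 < n)
  set M : Module.End R ((ℤ → ℤ) →₀ R) := scan (-1) y n * scan 0 x n with hM
  have e1 : scan (-1) x n * scan 0 y n =
      factor (-1 + n) (y - x) * M * factor (-1) (-(y - x)) := by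
    have := scan_mul_scan' (-1) x y n
    rwa [neg_add_cancel] at this
  have o1 : ∀ z z', nilOp R {-1} (Finsupp.single (opened c z z') 1) =
      if z < z' then Finsupp.single (opened c z' z) 1 else 0 := by
    intro z z'
    rw [nilOp_single]
    have : Asc {-1} (opened c z z') ↔ z < z' := by simp [Asc, opened]
    simp only [this]
    congr 2
    funext k
    by_cases h1 : k = -1
    · subst h1
      simp [swapAt, opened]
    · by_cases h2 : k = 0
      · subst h2
        simp [swapAt, opened]
      · have h3 : k - 1 ≠ -1 := by omega
        simp [swapAt, opened, h1, h2, h3]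
  have o2 : ∀ (v : (ℤ → ℤ) →₀ R) z z', nilOp R {-1 + (n : ℤ)} v (closed n c d z z') =
      if z' < z then v (closed n c d z' z) else 0 := by
    intro v z z'
    rw [nilOp_apply (sparse_singleton _)]
    have b1 : closed n c d z z' (-1 + n) = z := by
      rw [closed, if_neg (by omega), if_pos (by ring)]
    have b2 : closed n c d z z' (-1 + n + 1) = z' := by
      rw [closed, if_neg (by omega), if_neg (by omega), if_pos (by ring)]
    have : Desc {-1 + (n : ℤ)} (closed n c d z z') ↔ z' < z := by
      simp only [Desc, Set.mem_singleton_iff, forall_eq, b1, b2]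
    simp only [this]
    congr 2
    funext k
    by_cases h1 : k = -1 + n
    · rw [Function.comp_apply, swapAt_of_mem (by simpa using h1), h1, b2, closed,
        if_neg (by omega), if_pos (by ring)]
    · by_cases h2 : k = n
      · have h3 : k = (-1 + (n : ℤ)) + 1 := by omega
        rw [Function.comp_apply, h3, (sparse_singleton _).swapAt_succ (Set.mem_singleton _), b1,
          closed, if_neg (by omega), if_neg (by omega), if_pos (by omega)]
      · rw [Function.comp_apply, swapAt_of_notMem (by simpa using h1)
          (by simp only [Set.mem_singleton_iff]; omega)]
        simp only [closed]
        have h3 : k ≠ n - 1 := by omega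
        simp only [h2, h3, if_false]
  have key : ∀ z z', (factor (-1 + n) (y - x) * M * factor (-1) (-(y - x)))
      (Finsupp.single (opened c z z') 1) (closed n c d (z + N) (z' + N)) =
      M (Finsupp.single (opened c z z') 1) (closed n c d (z + N) (z' + N)) +
      (y - x) * (if z' < z then
        M (Finsupp.single (opened c z z') 1) (closed n c d (z' + N) (z + N)) else 0) -
      (y - x) * (if z < z' then
        M (Finsupp.single (opened c z' z) 1) (closed n c d (z + N) (z' + N)) else 0) := by
    intro z z'
    rw [Module.End.mul_apply, Module.End.mul_apply]
    simp only [factor, LinearMap.add_apply, Module.End.one_apply, LinearMap.smul_apply, o1,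
      Finsupp.add_apply, Finsupp.smul_apply, smul_eq_mul, o2, map_add, map_smul,
      add_lt_add_iff_right]
    -- The term using both end factors would require `z < z'` and `z' < z`.
    by_cases h1 : z < z'
    · rw [if_pos h1, if_neg h1.not_gt, if_pos h1]
      rw [if_neg h1.not_gt]
      ring
    · rw [if_neg h1, if_neg h1]
      simp only [map_zero, Finsupp.zero_apply, mul_zero, ite_self, add_zero, sub_zero]
  rw [e1]
  simp only [key]
  rw [sum_sub_distrib, sum_add_distrib, sub_eq_iff_eq_add]
  congr 1
  rw [← mul_sum, ← mul_sum]
  congr 1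
  -- The two correction sums are interchanged by swapping the cut values `z` and `z'`.
  refine sum_bij' (fun p _ => p.swap) (fun p _ => p.swap) ?_ ?_ ?_ ?_ ?_
  · intro p hp; rw [mem_product] at hp ⊢; exact hp.symm
  · intro p hp; rw [mem_product] at hp ⊢; exact hp.symm
  · intro p _; simp
  · intro p _; simp
  · intro p _; rfl

-- With `x` and `y` independent indeterminates, comparing the coefficients of `x ^ a * y ^ b` in the
-- trace identity isolates the sizes of `I` and `J`.
open Classical in
theorem sum_good_comm {N : ℤ} (hN : N ≠ 0) {c d : ℤ → ℤ} (hc : Per n N c) (hd : Per n N d)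
    (a b : ℕ) :
    (∑ I : Finset (ZMod n), ∑ J : Finset (ZMod n),
      if I.card = a ∧ J.card = b ∧ Good c d I J then (1 : ℤ) else 0) =
    ∑ I : Finset (ZMod n), ∑ J : Finset (ZMod n),
      if I.card = b ∧ J.card = a ∧ Good c d I J then (1 : ℤ) else 0 := by
  obtain ⟨F, hF⟩ := exists_bound (n := n) c d
  have h := trace_scan_comm (R := Polynomial (Polynomial ℤ)) N c d F
    (Polynomial.C Polynomial.X) Polynomial.X (n := n)
  rw [trace_scan_eq hN hc hd hF, trace_scan_eq hN hc hd hF] at h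
  have h1 := congrArg (fun f => (f.coeff b).coeff a) h
  simp only [Polynomial.finsetSum_coeff] at h1
  have e1 : ∀ (p q : ℕ) (P : Prop), (((Polynomial.C Polynomial.X ^ p * Polynomial.X ^ q *
      if P then 1 else 0 : Polynomial (Polynomial ℤ))).coeff b).coeff a =
      if p = a ∧ q = b ∧ P then (1 : ℤ) else 0 := by
    intro p q P
    by_cases hP : P
    · rw [if_pos hP, mul_one, ← Polynomial.C_pow, Polynomial.coeff_C_mul, Polynomial.coeff_X_pow]
      by_cases hb : b = q
      · rw [if_pos hb, mul_one, Polynomial.coeff_X_pow]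
        simp [hb, hP, eq_comm]
      · rw [if_neg hb, if_neg fun h => hb h.2.1.symm]; simp
    · simp [hP]
  have e2 : ∀ (p q : ℕ) (P : Prop), (((Polynomial.X ^ p * Polynomial.C Polynomial.X ^ q *
      if P then 1 else 0 : Polynomial (Polynomial ℤ))).coeff b).coeff a =
      if p = b ∧ q = a ∧ P then (1 : ℤ) else 0 := by
    intro p q P
    rw [mul_comm (Polynomial.X ^ p), e1]
    congr 1
    exact propext ⟨fun h => ⟨h.2.1, h.1, h.2.2⟩, fun h => ⟨h.2.1, h.1, h.2.2⟩⟩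
  simpa only [e1, e2] using h1

open Classical in
theorem nilRep_cycDec_mul_apply {I J : Finset (ZMod n)} (hI : I ≠ univ) (hJ : J ≠ univ)
    (c d : ℤ → ℤ) :
    nilRep (nilElt (cycDec I) * nilElt (cycDec J)) (Finsupp.single c 1) d =
      if Good c d I J then 1 else 0 := by
  obtain ⟨l, h, rfl⟩ := exists_cycDecWord J hJ
  obtain ⟨l', h', rfl⟩ := exists_cycDecWord I hI
  rw [nilElt_cycDec h hJ, nilElt_cycDec h' hI, ← List.prod_append, ← List.map_append, nilRep_prod,
    prod_nilOp_single_apply, run_append]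
  simp only [h.run_iff, h'.run_iff]
  congr 1
  refine propext ⟨?_, ?_⟩
  · rintro ⟨e, ⟨m, h1⟩, m', h2⟩
    exact ⟨hI, hJ, e, m, m', h1, h2⟩
  · rintro ⟨-, -, e, m, m', h1, h2⟩
    exact ⟨e, ⟨m, h1⟩, m', h2⟩

open Classical in
theorem coef_nilH_mul_nilH (w : AffineSym n) (a b : ℕ) :
    coef w (nilH n a * nilH n b) = ∑ I : Finset (ZMod n), ∑ J : Finset (ZMod n),
      if I.card = a ∧ J.card = b ∧ Good id (oneLine w) I J then (1 : ℤ) else 0 := by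
  rw [nilH, nilH, sum_mul_sum, map_sum, sum_filter]
  refine sum_congr rfl fun I _ => ?_
  rw [map_sum, sum_filter]
  split_ifs with hI
  · refine sum_congr rfl fun J _ => ?_
    by_cases hJ : J ≠ univ ∧ J.card = b
    · rw [if_pos hJ, coef_apply, nilRep_cycDec_mul_apply hI.1 hJ.1]
      simp [hI.2, hJ.2]
    · rw [if_neg hJ, if_neg fun h => hJ ⟨h.2.2.2.1, h.2.1⟩]
  · refine (sum_eq_zero fun J _ => ?_).symm
    rw [if_neg fun h => hI ⟨h.2.2.1, h.1⟩]

theorem nilH_comm (a b : ℕ) : nilH n a * nilH n b = nilH n b * nilH n a := by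
  refine ext_coef fun w => ?_
  rw [coef_nilH_mul_nilH, coef_nilH_mul_nilH,
    sum_good_comm (by exact_mod_cast NeZero.ne n) per_id (per_translate per_id w)]

end Commutation

end AffineStanley

namespace AffineStanley

variable {n : ℕ}

/-! ### Grassmannian elements -/

section Grassmannian

variable [NeZero n] [Fact (1 < n)]

/-- The state with the value `t` on the window `[n t + 1, n t + n]`. -/
def ground (n : ℕ) (k : ℤ) : ℤ := (k - 1) / n

omit [Fact (1 < n)] in
theorem per_ground : Per n 1 (ground n) := by
  have hn : (n : ℤ) ≠ 0 := by exact_mod_cast NeZero.ne n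
  intro k
  rw [ground, ground, show k + n - 1 = (k - 1) + n by ring,
    Int.add_ediv_of_dvd_right (dvd_refl _), Int.ediv_self hn]

omit [Fact (1 < n)] in
theorem ground_mono : Monotone (ground n) := fun a b h =>
  Int.ediv_le_ediv (by exact_mod_cast Nat.pos_of_ne_zero (NeZero.ne n)) (by omega)

theorem ground_le_succ (k : ℤ) : ground n k ≤ ground n (k + 1) := ground_mono (by omega)

omit [Fact (1 < n)] in
theorem ground_succ_eq {k : ℤ} (h : (k : ZMod n) ≠ 0) : ground n (k + 1) = ground n k := by
  have hn : (0 : ℤ) < n := by exact_mod_cast Nat.pos_of_ne_zero (NeZero.ne n)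
  have h1 : k % n ≠ 0 := fun h' => h ((ZMod.intCast_zmod_eq_zero_iff_dvd k n).2
    (Int.dvd_of_emod_eq_zero h'))
  have h2 := Int.emod_nonneg k hn.ne'
  have h3 := Int.emod_lt_of_pos k hn
  have h4 := Int.emod_add_mul_ediv k n
  have h5 : k - 1 = (k % n - 1) + (k / n) * n := by linarith
  rw [ground, ground, add_sub_cancel_right, h5, Int.add_mul_ediv_right _ _ hn.ne',
    Int.ediv_eq_zero_of_lt (a := k % n - 1) (by omega) (by omega), zero_add]

omit [Fact (1 < n)] in
theorem ground_succ_lt (t : ℤ) : ground n (n * t) < ground n (n * t + 1) := by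
  have hn : (0 : ℤ) < n := by exact_mod_cast Nat.pos_of_ne_zero (NeZero.ne n)
  rw [ground, ground, add_sub_cancel_right, Int.mul_ediv_cancel_left _ hn.ne']
  have : (n * t - 1) / (n : ℤ) = t - 1 := by
    rw [show n * t - 1 = (n - 1 : ℤ) + (t - 1) * n by ring, Int.add_mul_ediv_right _ _ hn.ne',
      Int.ediv_eq_zero_of_lt (by omega) (by omega), zero_add]
  omega

theorem asc_ground_iff (i : ZMod n) : Asc (resid i) (ground n) ↔ i = 0 := by
  constructor
  · intro h
    by_contra hi
    obtain ⟨k, hk⟩ := resid_nonempty i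
    have := h k hk
    rw [ground_succ_eq (by rw [mem_resid] at hk; rwa [hk])] at this
    exact lt_irrefl _ this
  · rintro rfl
    have h1 : (0 : ℤ) ∈ resid (0 : ZMod n) := by simp [mem_resid]
    rw [per_ground.asc_iff h1]
    simpa using ground_succ_lt (n := n) 0

theorem nilRep_mul_nilGen_ground {i : ZMod n} (hi : i ≠ 0) (a : NilCoxeter n) :
    nilRep (a * nilGen i) (Finsupp.single (ground n) 1) = 0 := by
  rw [map_mul, Module.End.mul_apply, nilRep_nilGen, nilOp_single,
    if_neg (mt (asc_ground_iff i).1 hi), map_zero]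

theorem isRightDescent_iff (w : AffineSym n) (i : ZMod n) : (cox n).IsRightDescent w i ↔
    ∃ v, w = v * (cox n).simple i ∧ (cox n).length w = (cox n).length v + 1 := by
  rw [CoxeterSystem.isRightDescent_iff]
  constructor
  · intro h
    exact ⟨w * (cox n).simple i, ((cox n).simple_mul_simple_cancel_right i).symm, h.symm⟩
  · rintro ⟨v, rfl, h⟩
    rw [CoxeterSystem.simple_mul_simple_cancel_right, h]

theorem nilElt_eq_of_isRightDescent {w : AffineSym n} {i : ZMod n}
    (h : (cox n).IsRightDescent w i) : ∃ v, nilElt w = nilElt v * nilGen i := by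
  obtain ⟨v, rfl, h1⟩ := (isRightDescent_iff w i).1 h
  refine ⟨v, ?_⟩
  rw [← nilElt_simple, nilElt_mul (by rw [h1, CoxeterSystem.length_simple])]

theorem nilRep_nilElt_ground_of_not {w : AffineSym n} (h : ¬ IsZeroGrassmannian w)
    (a : NilCoxeter n) : nilRep (a * nilElt w) (Finsupp.single (ground n) 1) = 0 := by
  simp only [IsZeroGrassmannian] at h
  push Not at h
  obtain ⟨i, h1, h2⟩ := h
  obtain ⟨v, hv⟩ := nilElt_eq_of_isRightDescent h1
  rw [hv, ← mul_assoc, nilRep_mul_nilGen_ground h2]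

/-- Within a level set of `ground` every neighbouring pair has nonzero residue, where `u` has no
right descent; ascents accumulate. -/
theorem IsZeroGrassmannian.permRep_lt {u : AffineSym n} (hu : IsZeroGrassmannian u) {a b : ℤ}
    (hab : a < b) (h : ground n a = ground n b) : permRep u a < permRep u b := by
  induction b, (show a + 1 ≤ b from hab) using Int.leInduction with
  | base =>
    have h0 : (a : ZMod n) ≠ 0 := by
      intro h0
      obtain ⟨t, rfl⟩ := (ZMod.intCast_zmod_eq_zero_iff_dvd a n).1 h0
      exact (ground_succ_lt t).ne h
    have h1 : ¬ (cox n).IsLeftDescent u⁻¹ (a : ZMod n) := by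
      rw [CoxeterSystem.isLeftDescent_inv_iff]
      exact fun h' => h0 (hu _ h')
    have h2 := (not_isLeftDescent_iff_asc _ _).1 h1 a (by simp [mem_resid])
    simpa [oneLine, translate] using h2
  | succ b hb ih =>
    have e1 := ground_mono (n := n) (show a ≤ b by omega)
    have e2 := ground_le_succ (n := n) b
    have e3 : ground n a = ground n b := by omega
    refine (ih (by omega) e3).trans ?_
    have h0 : (b : ZMod n) ≠ 0 := by
      intro h0
      obtain ⟨t, rfl⟩ := (ZMod.intCast_zmod_eq_zero_iff_dvd b n).1 h0
      have := ground_succ_lt (n := n) t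
      omega
    have h1 : ¬ (cox n).IsLeftDescent u⁻¹ (b : ZMod n) := by
      rw [CoxeterSystem.isLeftDescent_inv_iff]
      exact fun h' => h0 (hu _ h')
    have h2 := (not_isLeftDescent_iff_asc _ _).1 h1 b (by simp [mem_resid])
    simpa [oneLine, translate] using h2

theorem IsZeroGrassmannian.of_mul {v w : AffineSym n} (h : IsZeroGrassmannian (v * w))
    (hl : (cox n).length (v * w) = (cox n).length v + (cox n).length w) :
    IsZeroGrassmannian w := by
  intro i hi
  refine h i ?_
  rw [CoxeterSystem.isRightDescent_iff] at hi ⊢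
  have h1 := (cox n).length_mul_le v (w * (cox n).simple i)
  have h2 := (cox n).length_mul_simple (v * w) i
  rw [← mul_assoc] at h1
  omega

/-- A reduced word creates strict inversions starting from the identity. For a Grassmannian product
these survive composition with `ground`, because no inversion involves two values of the same level.
-/
theorem IsZeroGrassmannian.run {l : List (ZMod n)} (hl : (cox n).IsReduced l)
    (h : IsZeroGrassmannian ((cox n).wordProd l)) :
    Run resid l (ground n) (translate ((cox n).wordProd l) (ground n)) := by
  induction l with
  | nil => simp [Run, translate_one]
  | cons i l ih =>
    have h1 : (cox n).IsReduced l := hl.drop 1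
    have h2 : (cox n).length ((cox n).wordProd (i :: l)) =
        (cox n).length ((cox n).simple i) + (cox n).length ((cox n).wordProd l) := by
      rw [hl.eq, h1.eq, CoxeterSystem.length_simple, List.length_cons, add_comm]
    rw [CoxeterSystem.wordProd_cons] at h h2
    have h3 := ih h1 (h.of_mul h2)
    rw [CoxeterSystem.wordProd_cons, translate_simple_mul]
    refine ⟨_, h3, ?_, rfl⟩
    obtain ⟨k, hk⟩ := resid_nonempty i
    rw [(per_translate per_ground _).asc_iff hk]
    obtain ⟨e, h5, h6, -⟩ := run_of_isReduced hl
    obtain rfl := h5.right_unique (run_of_isReduced h1)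
    have h7 := h6 k hk
    simp only [translate, id] at h7 ⊢
    refine lt_of_le_of_ne (ground_mono h7.le) fun h8 => ?_
    -- If the two exchanged values were on one level, the product, being Grassmannian, would keep
    -- their order, whereas the new letter `i` reverses it.
    have h9 := h.permRep_lt h7 h8
    rw [map_mul, permRep_simple] at h9
    have h10 : ∀ z, permRep ((cox n).wordProd l) ((permRep ((cox n).wordProd l))⁻¹ z) = z :=
      fun z => (permRep ((cox n).wordProd l)).apply_symm_apply z
    simp only [Equiv.Perm.mul_apply, h10, simplePerm_apply] at h9
    rw [swapAt_of_mem hk, (sparse_resid i).swapAt_succ hk] at h9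
    omega

/-- A run makes the product of generators act on `ground` without vanishing, which excludes
nonreduced words and non-Grassmannian products. -/
theorem Run.grassmannian {l : List (ZMod n)} {d : ℤ → ℤ} (h : Run resid l (ground n) d) :
    (cox n).IsReduced l ∧ IsZeroGrassmannian ((cox n).wordProd l) ∧
      d = translate ((cox n).wordProd l) (ground n) := by
  have h0 : nilRep (l.map nilGen).prod (Finsupp.single (ground n) 1) = Finsupp.single d 1 := by
    rw [nilRep_prod, prod_nilOp_single h]
  have h1 : (cox n).IsReduced l := by
    by_contra h1
    rw [prod_nilGen_eq_zero h1, map_zero, LinearMap.zero_apply] at h0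
    exact Finsupp.single_ne_zero.2 one_ne_zero h0.symm
  refine ⟨h1, ?_, h.eq_translate⟩
  by_contra h2
  rw [← nilElt_wordProd h1, ← one_mul (nilElt _), nilRep_nilElt_ground_of_not h2] at h0
  exact Finsupp.single_ne_zero.2 one_ne_zero h0.symm

theorem translate_ground_inj {u v : AffineSym n} (hu : IsZeroGrassmannian u)
    (hv : IsZeroGrassmannian v) (h : translate u (ground n) = translate v (ground n)) : u = v := by
  obtain ⟨l, h1, rfl⟩ := (cox n).exists_isReduced u
  obtain ⟨l', h1', rfl⟩ := (cox n).exists_isReduced v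
  exact ((hu.run h1).prod_unique braidRel_simple (by norm_num) per_ground ground_le_succ
    (h ▸ hv.run h1')).1

theorem coef_eq_nilRep_ground {u : AffineSym n} (hu : IsZeroGrassmannian u) (a : NilCoxeter n) :
    coef u a = nilRep a (Finsupp.single (ground n) 1) (translate u (ground n)) := by
  classical
  obtain ⟨c, -, rfl⟩ := eq_sum_coef a
  simp only [Finsupp.sum, map_sum, map_smul, LinearMap.sum_apply,
    Finsupp.finsetSum_apply]
  refine sum_congr rfl fun w _ => ?_
  rw [map_zsmul nilRep, LinearMap.smul_apply, Finsupp.smul_apply]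
  congr 1
  rw [coef_nilElt]
  by_cases hw : IsZeroGrassmannian w
  · obtain ⟨l, h1, rfl⟩ := (cox n).exists_isReduced w
    rw [nilElt_wordProd h1, nilRep_prod, prod_nilOp_single (hw.run h1), Finsupp.single_apply]
    congr 1
    exact propext ⟨fun h => h ▸ rfl, translate_ground_inj hw hu⟩
  · have := nilRep_nilElt_ground_of_not hw 1
    rw [one_mul] at this
    rw [this, if_neg fun h : w = u => hw (h.symm ▸ hu)]
    rfl

/-- Such an `A_w` already kills `ground`, hence so does any left multiple. This permits replacing
`s_v` by `A_v` as a right factor when only Grassmannian coefficients matter. -/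
theorem coef_mul_nilElt_of_not {u w : AffineSym n} (hu : IsZeroGrassmannian u)
    (hw : ¬ IsZeroGrassmannian w) (a : NilCoxeter n) : coef u (a * nilElt w) = 0 := by
  rw [coef_eq_nilRep_ground hu, nilRep_nilElt_ground_of_not hw]
  rfl

end Grassmannian

end AffineStanley

/-! ### Maximal horizontal strips of Grassmannian states. -/

namespace AffineStanley

variable {n : ℕ}

/-! ### Upper subsets of a given size -/

section Upper

variable {α : Type*} [DecidableEq α] {f : α → ℤ} {A : Finset α}

theorem exists_upper (A : Finset α) (f : α → ℤ) {t : ℕ} (ht : t ≤ A.card) :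
    ∃ T ⊆ A, T.card = t ∧ ∀ a ∈ T, ∀ b ∈ A, f a < f b → b ∈ T := by
  induction t with
  | zero => exact ⟨∅, by simp, by simp, by simp⟩
  | succ t ih =>
    obtain ⟨T, h1, h2, h3⟩ := ih (by omega)
    have h4 : (A \ T).Nonempty := by
      rw [← card_pos, card_sdiff_of_subset h1]
      omega
    obtain ⟨b, h5, h6⟩ := exists_max_image (A \ T) f h4
    rw [mem_sdiff] at h5
    refine ⟨insert b T, insert_subset h5.1 h1, by rw [card_insert_of_notMem h5.2, h2], ?_⟩
    intro a ha b' hb' hab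
    rw [mem_insert] at ha ⊢
    rcases ha with rfl | ha
    · by_contra hc
      push Not at hc
      exact absurd (h6 b' (mem_sdiff.2 ⟨hb', hc.2⟩)) (not_le.2 hab)
    · exact Or.inr (h3 a ha b' hb' hab)

theorem upper_unique (hf : Function.Injective f) {T T' : Finset α} (hT : T ⊆ A) (hT' : T' ⊆ A)
    (hc : T.card = T'.card) (h : ∀ a ∈ T, ∀ b ∈ A, f a < f b → b ∈ T)
    (h' : ∀ a ∈ T', ∀ b ∈ A, f a < f b → b ∈ T') : T = T' := by
  by_contra hne
  have h1 : ¬ T ⊆ T' := fun h1 => hne (eq_of_subset_of_card_le h1 hc.ge)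
  have h2 : ¬ T' ⊆ T := fun h2 => hne (eq_of_subset_of_card_le h2 hc.le).symm
  obtain ⟨a, ha, ha'⟩ := not_subset.1 h1
  obtain ⟨b, hb, hb'⟩ := not_subset.1 h2
  rcases lt_trichotomy (f a) (f b) with h3 | h3 | h3
  · exact hb' (h a ha b (hT' hb) h3)
  · exact ha' (hf h3 ▸ hb)
  · exact ha' (h' b hb a (hT ha) h3)

end Upper

/-! ### The positions followed by smaller values -/

/-- The positions which are followed by a smaller value. -/
def drops (d : ℤ → ℤ) : Set ℤ := {k | ∃ q > k, d q < d k}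

section Drops

variable [NeZero n] [Fact (1 < n)] {c d m : ℤ → ℤ} {J : Finset (ZMod n)}

theorem Per.mem_drops_iff (hd : Per n 1 d) (k t : ℤ) : k + n * t ∈ drops d ↔ k ∈ drops d := by
  have key : ∀ k t : ℤ, k ∈ drops d → k + n * t ∈ drops d := by
    rintro k t ⟨q, h1, h2⟩
    refine ⟨q + n * t, by omega, ?_⟩
    rw [hd.add_mul, hd.add_mul]
    omega
  refine ⟨fun h => ?_, key k t⟩
  have := key _ (-t) h
  rwa [show k + n * t + n * (-t) = k by ring] at this

open Classical in
/-- The residue classes of `drops d`. -/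
def dropFin (n : ℕ) [NeZero n] (d : ℤ → ℤ) : Finset (ZMod n) :=
  univ.filter fun r => ∃ k : ℤ, (k : ZMod n) = r ∧ k ∈ drops d

theorem Per.preim_dropFin (hd : Per n 1 d) : preim (dropFin n d) = drops d := by
  classical
  ext k
  rw [mem_preim, dropFin, mem_filter]
  refine ⟨fun ⟨_, j, h1, h2⟩ => ?_, fun h => ⟨mem_univ _, k, rfl, h⟩⟩
  obtain ⟨t, rfl⟩ := exists_eq_add_mul_of_mem_resid (mem_resid.2 h1) (mem_resid.2 rfl)
  exact (hd.mem_drops_iff j t).2 h2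

theorem Per.mem_dropFin (hd : Per n 1 d) {k : ℤ} : (k : ZMod n) ∈ dropFin n d ↔ k ∈ drops d := by
  rw [← hd.preim_dropFin, mem_preim]

theorem preim_injective : Function.Injective (preim : Finset (ZMod n) → Set ℤ) := by
  intro J J' h
  ext r
  obtain ⟨k, rfl⟩ := ZMod.intCast_surjective r
  exact Set.ext_iff.1 h k

theorem Per.dropFin_ne_univ (hd : Per n 1 d) : dropFin n d ≠ univ := by
  have hn : (0 : ℤ) < n := by exact_mod_cast Nat.pos_of_ne_zero (NeZero.ne n)
  obtain ⟨k, h1, h2⟩ := exists_min_image (Ico (0 : ℤ) n) d ⟨0, mem_Ico.2 ⟨le_rfl, hn⟩⟩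
  refine ne_univ_of_notMem (i := (k : ZMod n)) fun h => ?_
  obtain ⟨q, h3, h4⟩ := hd.mem_dropFin.1 h
  obtain ⟨q₀, t, h5, h6, rfl⟩ := exists_window (n := n) 0 q
  rw [hd.add_mul] at h4
  rw [mem_Ico] at h1
  have h7 := h2 q₀ (mem_Ico.2 ⟨h5, by omega⟩)
  have h8 : 0 ≤ t := by
    by_contra h8
    have : (n : ℤ) * t ≤ n * (-1) := mul_le_mul_of_nonneg_left (by omega) hn.le
    omega
  omega

/-- The carrier passing `k` is smaller than the entry it leaves there and stops further right. So
`drops d` bounds every strip ending in `d`. -/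
theorem Carries.mem_drops (hJ : J ≠ univ) (h : Carries (preim J) m c d) {k : ℤ}
    (hk : k ∈ preim J) : k ∈ drops d := by
  obtain ⟨q, h1, h2, h3⟩ := exists_least_notMem (gt_notMem_preim hJ k)
  have h4 : k < q := lt_of_le_of_ne h1 fun h' => h2 (h' ▸ hk)
  refine ⟨q, h4, ?_⟩
  rw [((h q).2 h2).2, h.const h1 h3, ((h k).1 hk).2.2]
  exact ((h k).1 hk).1

theorem Carries.subset_dropFin (hJ : J ≠ univ) (hd : Per n 1 d) (h : Carries (preim J) m c d) :
    J ⊆ dropFin n d := by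
  intro r hr
  obtain ⟨k, rfl⟩ := ZMod.intCast_surjective r
  exact hd.mem_dropFin.2 (h.mem_drops hJ hr)

/-- The bound is attained: the first non-drop at or after `k` carries a smallest entry of the
stretch from `k`, and moving this entry back to the start of its block of drops undoes the strip. -/
theorem Per.exists_carries_drops (hd : Per n 1 d) : ∃ m c, Carries (drops d) m c d := by
  classical
  have hgt : ∀ k, ∃ j > k, j ∉ drops d := by
    rw [← hd.preim_dropFin]
    exact gt_notMem_preim hd.dropFin_ne_univ
  choose g hg using fun k => exists_least_notMem (hgt k)
  have hle : ∀ k i, k ≤ i → i ≤ g k → d (g k) ≤ d i := by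
    intro k i h1 h2
    induction hs : (g k - i).toNat using Nat.strong_induction_on generalizing i with
    | _ s ih =>
      rcases eq_or_lt_of_le h2 with rfl | h3
      · exact le_rfl
      · obtain ⟨q, h4, h5⟩ := (hg k).2.2 i h1 h3
        by_cases h6 : q ≤ g k
        · exact (ih _ (by omega) q (by omega) h6 rfl).trans h5.le
        · have h7 : d (g k) ≤ d q := by
            by_contra h7
            exact (hg k).2.1 ⟨q, by omega, by omega⟩
          exact h7.trans h5.le
  refine ⟨fun k => d (g k), fun k => if k - 1 ∈ drops d then d (k - 1) else d (g k), fun k => ?_⟩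
  simp only [add_sub_cancel_right]
  refine ⟨fun hk => ?_, fun hk => ?_⟩
  · have h1 : k < g k := lt_of_le_of_ne (hg k).1 fun h => (hg k).2.1 (h ▸ hk)
    have h2 : g (k + 1) = g k := by
      obtain ⟨a1, a2, a3⟩ := hg k
      obtain ⟨b1, b2, b3⟩ := hg (k + 1)
      rcases lt_trichotomy (g (k + 1)) (g k) with h | h | h
      · exact absurd (a3 _ (by omega) h) b2
      · exact h
      · exact absurd (b3 _ (by omega) h) a2
    rw [if_pos hk, h2]
    refine ⟨?_, rfl, rfl⟩
    obtain ⟨q, h4, h5⟩ := hk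
    by_cases h6 : q ≤ g k
    · exact (hle k q h4.le h6).trans_lt h5
    · have h7 : d (g k) ≤ d q := by
        by_contra h7
        exact (hg k).2.1 ⟨q, by omega, by omega⟩
      exact h7.trans_lt h5
  · rw [if_neg hk]
    refine ⟨rfl, ?_⟩
    obtain ⟨a1, a2, a3⟩ := hg k
    have : g k = k := by
      by_contra h
      exact hk (a3 k le_rfl (by omega))
    rw [this]

/-- The entry `c (k + 1)` starts a carrier that stops at a non-drop `p` of `d`. A later smaller
entry of `c` is either passed by this carrier, which is impossible, or stays to the right of `p` in
`d`, making `p` a drop. This is why successive strips have weakly decreasing sizes. -/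
theorem Carries.succ_notMem_drops (hd : Per n 1 d) (h : Carries (drops d) m c d) {k : ℤ}
    (hk : k ∉ drops d) : k + 1 ∉ drops c := by
  have hgt : ∀ k, ∃ j > k, j ∉ drops d := by
    rw [← hd.preim_dropFin]
    exact gt_notMem_preim hd.dropFin_ne_univ
  have land : ∀ k, ∃ q, k ≤ q ∧ q ∉ drops d ∧ (∀ i, k ≤ i → i < q → i ∈ drops d) ∧
      d q = m k := by
    intro k
    obtain ⟨q, h1, h2, h3⟩ := exists_least_notMem (hgt k)
    exact ⟨q, h1, h2, h3, by rw [((h q).2 h2).2, h.const h1 h3]⟩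
  obtain ⟨p, p1, p2, p3, p4⟩ := land (k + 1)
  have e1 : m (k + 1) = c (k + 1) := ((h k).2 hk).1
  rintro ⟨q, h1, h2⟩
  obtain ⟨r, hr, h3⟩ : ∃ r ≥ q - 1, d r = c q := by
    by_cases hq : q - 1 ∈ drops d
    · refine ⟨q - 1, le_rfl, ?_⟩
      have := ((h (q - 1)).1 hq).2.2
      rwa [sub_add_cancel] at this
    · obtain ⟨r, r1, r2, r3, r4⟩ := land q
      refine ⟨r, by omega, ?_⟩
      rw [r4]
      exact h.start hq
  by_cases h4 : q - 1 < p
  · have h5 := (h (q - 1)).1 (p3 _ (by omega) h4)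
    rw [sub_add_cancel] at h5
    have h6 : m (q - 1) = m (k + 1) := h.const (by omega) fun i hi hi' => p3 i hi (by omega)
    omega
  · have h5 : d r < d p := by rw [p4, h3, e1]; exact h2
    have h6 : p ≠ r := by rintro rfl; omega
    exact p2 ⟨r, by omega, h5⟩

theorem Carries.card_dropFin_le (hc : Per n 1 c) (hd : Per n 1 d) (h : Carries (drops d) m c d) :
    (dropFin n c).card ≤ (dropFin n d).card := by
  refine card_le_card_of_injOn (· - 1) ?_ (fun a _ b _ h => by simpa using h)
  intro r hr
  obtain ⟨k, rfl⟩ := ZMod.intCast_surjective r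
  by_contra h1
  have h2 : (((k - 1 : ℤ) : ZMod n)) ∉ dropFin n d := by simpa using h1
  have h3 := h.succ_notMem_drops hd (mt hd.mem_dropFin.2 h2)
  rw [sub_add_cancel] at h3
  exact h3 (hc.mem_dropFin.1 hr)

/-- The representative of the residue class `r` at which `c` vanishes. -/
def zeroAt (c : ℤ → ℤ) (r : ZMod n) : ℤ := r.val - n * c r.val

theorem cast_zeroAt (c : ℤ → ℤ) (r : ZMod n) : ((zeroAt c r : ℤ) : ZMod n) = r := by
  simp [zeroAt]

theorem zeroAt_injective (c : ℤ → ℤ) : Function.Injective (zeroAt c : ZMod n → ℤ) := by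
  intro r s h
  rw [← cast_zeroAt c r, h, cast_zeroAt]

theorem Per.apply_zeroAt (hc : Per n 1 c) (r : ZMod n) : c (zeroAt c r) = 0 := by
  have := hc.add_mul r.val (-c r.val)
  rw [zeroAt, show (r.val : ℤ) - n * c r.val = r.val + n * (-c r.val) by ring, this]
  ring

theorem Per.eq_zeroAt (hc : Per n 1 c) (k : ℤ) : k = zeroAt c (k : ZMod n) + n * c k := by
  obtain ⟨t, ht⟩ := exists_eq_add_mul_of_mem_resid
    (mem_resid.2 (cast_zeroAt c (k : ZMod n))) (mem_resid.2 (rfl : (k : ZMod n) = k))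
  have : c k = t := by rw [ht, hc.add_mul, hc.apply_zeroAt]; ring
  rw [this]
  exact ht

/-- To add a strip of size `k`, choose the `n - k` residues at which carriers start. They have to be
non-drops of `c`, and among those an upper set for `zeroAt`, so that a carrier never meets an equal
entry and the strip produced is maximal. -/
theorem Per.exists_carries_card (hc : Per n 1 c) {k : ℕ} (hk : (dropFin n c).card ≤ k)
    (hkn : k < n) : ∃ J m d, J ≠ univ ∧ J.card = k ∧ Carries (preim J) m c d ∧ dropFin n d = J := by
  classical
  have hA : ((dropFin n c)ᶜ).card = n - (dropFin n c).card := by rw [card_compl, ZMod.card]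
  obtain ⟨T, t1, t2, t3⟩ := exists_upper (dropFin n c)ᶜ (zeroAt c) (t := n - k) (by omega)
  have hT : ∀ {j : ℤ}, (j : ZMod n) ∈ T → ∀ q > j, c j ≤ c q := by
    intro j hj q hq
    by_contra h
    exact mem_compl.1 (t1 hj) (hc.mem_dropFin.2 ⟨q, hq, by omega⟩)
  let J : Finset (ZMod n) := (Tᶜ).map ⟨(· - 1), sub_left_injective⟩
  have hJ : ∀ j : ℤ, j ∈ preim J ↔ ((j + 1 : ℤ) : ZMod n) ∉ T := by
    intro j
    rw [mem_preim, mem_map]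
    push_cast
    constructor
    · rintro ⟨r, h1, h2⟩
      rw [← h2]
      simpa using h1
    · exact fun h => ⟨j + 1, mem_compl.2 h, by simp⟩
  have hJc : J.card = k := by
    rw [card_map, card_compl, ZMod.card, t2]
    omega
  have hJu : J ≠ univ := by
    intro h
    rw [h, card_univ, ZMod.card] at hJc
    omega
  have hS := lt_notMem_preim hJu
  obtain ⟨m, d, h⟩ := exists_carries (c := c) hS (by
    intro j q h1 h2 h3
    have hj : (j : ZMod n) ∈ T := by
      have := mt (hJ (j - 1)).2 h2
      rw [sub_add_cancel] at this
      exact not_not.1 this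
    have hq : ((q + 1 : ℤ) : ZMod n) ∉ T := (hJ q).1 (h3 q h1 le_rfl)
    refine lt_of_le_of_ne (hT hj _ (by omega)) fun h4 => ?_
    by_cases h5 : q + 1 ∈ drops c
    · obtain ⟨p, h6, h7⟩ := h5
      have := hT hj p (by omega)
      omega
    -- If the entry at `q + 1` equals the carrier, `q + 1` is a later non-drop with the same value,
    -- so its `zeroAt` is larger and the upper set contains it.
    · refine hq (t3 _ hj _ (mem_compl.2 (mt hc.mem_dropFin.1 h5)) ?_)
      have e1 := hc.eq_zeroAt j
      have e2 := hc.eq_zeroAt (q + 1)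
      rw [← h4] at e2
      omega)
  have hd : Per n 1 d := (h.per hJu hc).2
  refine ⟨J, m, d, hJu, hJc, h, (Subset.antisymm (h.subset_dropFin hJu hd) ?_).symm⟩
  intro r hr
  obtain ⟨k, rfl⟩ := ZMod.intCast_surjective r
  by_contra hk'
  obtain ⟨f, hf, -, -⟩ := exists_lead hS
  obtain ⟨f1, f2, f3⟩ := hf k
  have hj : ((f k : ℤ) : ZMod n) ∈ T := by
    have := mt (hJ (f k - 1)).2 f2
    rw [sub_add_cancel] at this
    exact not_not.1 this
  obtain ⟨q, h1, h2⟩ := hd.mem_dropFin.1 hr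
  rw [((h k).2 hk').2, h.eq_lead hf] at h2
  by_cases hq : q ∈ preim J
  · rw [((h q).1 hq).2.2] at h2
    have := hT hj (q + 1) (by omega)
    omega
  · rw [((h q).2 hq).2, h.eq_lead hf] at h2
    obtain ⟨g1, g2, g3⟩ := hf q
    have h3 : k < f q := by
      by_contra h3
      exact hk' (g3 k (by omega) h1)
    have := hT hj (f q) (by omega)
    omega

/-- In a maximal strip the starting points of carriers are forced to form an upper set for `zeroAt`;
the size then determines them, which gives `Carries.right_unique_of_card`. -/
theorem Carries.upper_of_drops (hc : Per n 1 c) (hd : Per n 1 d) (h : Carries (drops d) m c d)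
    {r s : ZMod n} (hr : r - 1 ∉ dropFin n d) (hrs : zeroAt c r < zeroAt c s) : s - 1 ∉ dropFin n d := by
  have hS : ∀ k, ∃ j < k, j ∉ drops d := by
    rw [← hd.preim_dropFin]
    exact lt_notMem_preim hd.dropFin_ne_univ
  obtain ⟨f, hf, -, -⟩ := exists_lead hS
  have conv : ∀ t : ZMod n, t - 1 ∈ dropFin n d ↔ zeroAt c t - 1 ∈ drops d := by
    intro t
    rw [← hd.mem_dropFin]
    push_cast
    rw [cast_zeroAt]
  rw [conv] at hr ⊢
  intro h1
  have h2 := ((h _).1 h1).1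
  rw [sub_add_cancel, hc.apply_zeroAt, h.eq_lead hf] at h2
  obtain ⟨f1, f2, f3⟩ := hf (zeroAt c s - 1)
  set j := f (zeroAt c s - 1)
  have h3 : zeroAt c r ≤ j := by
    by_contra h3
    exact hr (f3 _ (by omega) (by omega))
  have h4 : zeroAt c r ≠ j := by
    intro h4
    rw [← h4, hc.apply_zeroAt] at h2
    omega
  have h5 := h.succ_notMem_drops hd hr
  rw [sub_add_cancel] at h5
  exact h5 ⟨j, by omega, by rw [hc.apply_zeroAt]; exact h2⟩

theorem Carries.right_unique_of_card (hc : Per n 1 c) (hd : Per n 1 d)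
    (h : Carries (drops d) m c d) {d' m' : ℤ → ℤ} (hd' : Per n 1 d')
    (h' : Carries (drops d') m' c d') (e : (dropFin n d).card = (dropFin n d').card) : d = d' := by
  classical
  have key : ∀ {d m : ℤ → ℤ}, Per n 1 d → Carries (drops d) m c d →
      ((dropFin n d)ᶜ.map ⟨(· + 1), add_left_injective 1⟩) ⊆ (dropFin n c)ᶜ ∧
      ∀ a ∈ ((dropFin n d)ᶜ.map ⟨(· + 1), add_left_injective 1⟩), ∀ b ∈ (dropFin n c)ᶜ,
        zeroAt c a < zeroAt c b → b ∈ ((dropFin n d)ᶜ.map ⟨(· + 1), add_left_injective 1⟩) := by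
    intro d m hd h
    constructor
    · intro r hr
      obtain ⟨s, hs, rfl⟩ := mem_map.1 hr
      obtain ⟨k, rfl⟩ := ZMod.intCast_surjective s
      have := h.succ_notMem_drops hd (mt hd.mem_dropFin.2 (mem_compl.1 hs))
      rw [mem_compl]
      intro h2
      apply this
      rw [← hc.mem_dropFin]
      push_cast
      exact h2
    · intro a ha b _ hab
      obtain ⟨s, hs, rfl⟩ := mem_map.1 ha
      refine mem_map.2 ⟨b - 1, mem_compl.2 (h.upper_of_drops hc hd (r := s + 1) ?_ hab), by simp⟩
      rw [add_sub_cancel_right]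
      exact mem_compl.1 hs
  obtain ⟨a1, a2⟩ := key hd h
  obtain ⟨b1, b2⟩ := key hd' h'
  have h1 := upper_unique (zeroAt_injective c) a1 b1 (by
    rw [card_map, card_map, card_compl, card_compl, e]) a2 b2
  have h2 : dropFin n d = dropFin n d' := compl_injective (map_injective _ h1)
  have h3 : drops d = drops d' := by rw [← hd.preim_dropFin, h2, hd'.preim_dropFin]
  rw [← h3] at h'
  refine (h.unique ?_ h').2
  rw [← hd.preim_dropFin]
  exact lt_notMem_preim hd.dropFin_ne_univ

end Drops

end AffineStanley

/-! ### Partitions of Grassmannian elements and lexicographic triangularity. -/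

namespace AffineStanley

variable {n : ℕ} [NeZero n] [Fact (1 < n)]

/-! ### The partition of a Grassmannian state -/

section Shape

variable {c d m : ℤ → ℤ} {J : Finset (ZMod n)}

theorem nilRep_nilElt_cycDec (hJ : J ≠ univ) (h : Carries (preim J) m c d)
    (v : (ℤ → ℤ) →₀ ℤ) : nilRep (nilElt (cycDec J)) v d = v c := by
  classical
  obtain ⟨l, hl, rfl⟩ := exists_cycDecWord J hJ
  have hr : Run resid l c d := hl.run_iff.2 ⟨m, h⟩
  rw [nilElt_cycDec hl hJ, nilRep_prod]
  induction v using Finsupp.induction_linear with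
  | zero => simp
  | add f g hf hg => rw [map_add, Finsupp.add_apply, hf, hg, Finsupp.add_apply]
  | single e r =>
    rw [Finsupp.single_apply]
    split_ifs with he
    · rw [he, prod_nilOp_single hr, Finsupp.single_eq_same]
    · by_cases h1 : ∃ d', Run resid l e d'
      · obtain ⟨d', h1⟩ := h1
        rw [prod_nilOp_single h1, Finsupp.single_apply, if_neg]
        rintro rfl
        exact he (h1.left_unique sparse_resid hr)
      · rw [prod_nilOp_single_eq_zero (not_exists.1 h1)]
        rfl

theorem nilRep_nilElt_cycDec_eq_zero (hJ : J ≠ univ) (h : ∀ m c, ¬ Carries (preim J) m c d)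
    (v : (ℤ → ℤ) →₀ ℤ) : nilRep (nilElt (cycDec J)) v d = 0 := by
  obtain ⟨l, hl, rfl⟩ := exists_cycDecWord J hJ
  rw [nilElt_cycDec hl hJ, nilRep_prod]
  induction v using Finsupp.induction_linear with
  | zero => simp
  | add f g hf hg => rw [map_add, Finsupp.add_apply, hf, hg, add_zero]
  | single e r =>
    by_cases h1 : ∃ d', Run resid l e d'
    · obtain ⟨d', h1⟩ := h1
      rw [prod_nilOp_single h1, Finsupp.single_eq_of_ne]
      rintro rfl
      obtain ⟨m, hm⟩ := hl.run_iff.1 h1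
      exact h m e hm
    · rw [prod_nilOp_single_eq_zero (not_exists.1 h1)]
      rfl

theorem exists_carries_of_nilRep_nilH_ne_zero {k : ℕ} {v : (ℤ → ℤ) →₀ ℤ}
    (h : nilRep (nilH n k) v d ≠ 0) :
    ∃ J m c, J ≠ univ ∧ J.card = k ∧ Carries (preim (n := n) J) m c d ∧ v c ≠ 0 := by
  classical
  rw [nilH, map_sum, LinearMap.sum_apply, Finsupp.finsetSum_apply] at h
  obtain ⟨J, h1, h2⟩ := exists_ne_zero_of_sum_ne_zero h
  rw [mem_filter] at h1
  by_cases h3 : ∃ m c, Carries (preim J) m c d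
  · obtain ⟨m, c, h3⟩ := h3
    refine ⟨J, m, c, h1.2.1, h1.2.2, h3, ?_⟩
    rwa [nilRep_nilElt_cycDec h1.2.1 h3] at h2
  · push Not at h3
    exact absurd (nilRep_nilElt_cycDec_eq_zero h1.2.1 h3 v) h2

/-- Every strip ending in `d` lies in `dropFin n d`, so only one has the same size. -/
theorem nilRep_nilH_drops (hd : Per n 1 d) (h : Carries (drops d) m c d) (v : (ℤ → ℤ) →₀ ℤ) :
    nilRep (nilH n (dropFin n d).card) v d = v c := by
  classical
  rw [nilH, map_sum, LinearMap.sum_apply, Finsupp.finsetSum_apply,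
    sum_eq_single_of_mem (dropFin n d) (mem_filter.2 ⟨mem_univ _, hd.dropFin_ne_univ, rfl⟩)]
  · refine nilRep_nilElt_cycDec (m := m) hd.dropFin_ne_univ ?_ v
    rwa [hd.preim_dropFin]
  · intro J hJ hne
    rw [mem_filter] at hJ
    refine nilRep_nilElt_cycDec_eq_zero hJ.2.1 (fun m c h1 => hne ?_) v
    exact eq_of_subset_of_card_le (h1.subset_dropFin hJ.2.1 hd) hJ.2.2.ge

theorem Run.exists_run_of_run {l L : List (ZMod n)} (h : Run resid l c d)
    (hL : Run resid L (ground n) d) :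
    ∃ L' : List (ZMod n), Run resid L' (ground n) c ∧ L.length = L'.length + l.length := by
  induction l generalizing d L with
  | nil =>
    obtain rfl : d = c := h
    exact ⟨L, hL, rfl⟩
  | cons i l ih =>
    obtain ⟨e, h1, h2, rfl⟩ := h
    obtain ⟨L₁, r₁, -, q₁⟩ := hL.exchange braidRel_simple (by norm_num) per_ground ground_le_succ
      ((sparse_resid i).desc_comp_iff.2 h2)
    rw [(sparse_resid i).comp_swapAt_comp] at r₁
    obtain ⟨L₂, r₂, q₂⟩ := ih h1 r₁
    exact ⟨L₂, r₂, by rw [q₁, q₂, List.length_cons, add_assoc]⟩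

variable (n) in
/-- The sizes of the successive maximal horizontal strips of a Grassmannian state. -/
inductive IsShape : List ℕ → (ℤ → ℤ) → Prop
  | nil : IsShape [] (ground n)
  | cons {l : List ℕ} {c d m : ℤ → ℤ} (h : IsShape l c) (hc : Carries (drops d) m c d)
      (hd : Per n 1 d) (hn : (dropFin n d).Nonempty) : IsShape ((dropFin n d).card :: l) d

theorem drops_ground : drops (ground n) = ∅ := by
  ext k
  simp only [Set.mem_empty_iff_false, iff_false]
  rintro ⟨q, h1, h2⟩
  exact absurd (ground_mono (n := n) (show k ≤ q by omega)) (not_le.2 h2)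

theorem dropFin_ground : dropFin n (ground n) = ∅ := by
  apply preim_injective
  rw [per_ground.preim_dropFin, drops_ground]
  ext k
  simp [mem_preim]

theorem IsShape.reach {l : List ℕ} (h : IsShape n l d) :
    ∃ L : List (ZMod n), Run resid L (ground n) d ∧ L.length = l.sum := by
  induction h with
  | nil => exact ⟨[], rfl, rfl⟩
  | @cons l c d m _ hc hd _ ih =>
    obtain ⟨L, h1, h2⟩ := ih
    obtain ⟨w, hw, hw'⟩ := exists_cycDecWord (dropFin n d) hd.dropFin_ne_univ
    refine ⟨w ++ L, run_append.2 ⟨c, h1, hw.run_iff.2 ⟨m, ?_⟩⟩, ?_⟩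
    · rwa [hw', hd.preim_dropFin]
    · rw [List.length_append, List.sum_cons, h2, ← hw', List.toFinset_card_of_nodup hw.1]

theorem IsShape.per {l : List ℕ} (h : IsShape n l d) : Per n 1 d := by
  obtain ⟨L, h1, -⟩ := h.reach
  exact h1.per per_ground

/-- Removing the maximal strip leaves a state still reachable from `ground` by a shorter word, by
`Run.exists_run_of_run`. -/
theorem exists_isShape {L : List (ZMod n)} (h : Run resid L (ground n) d) :
    ∃ l, IsShape n l d := by
  induction hs : L.length using Nat.strong_induction_on generalizing L d with
  | _ s ih =>
    subst hs
    have hd := h.per per_ground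
    rcases L with _ | ⟨i, L⟩
    · obtain rfl : d = ground n := h
      exact ⟨[], .nil⟩
    · have hne : (dropFin n d).Nonempty := by
        obtain ⟨e, -, h2, rfl⟩ := h
        obtain ⟨k, hk⟩ := resid_nonempty i
        exact ⟨k, hd.mem_dropFin.2 ⟨k + 1, by omega,
          (sparse_resid i).desc_comp_iff.2 h2 k hk⟩⟩
      obtain ⟨m, c, hc⟩ := hd.exists_carries_drops
      obtain ⟨w, hw, hw'⟩ := exists_cycDecWord (dropFin n d) hd.dropFin_ne_univ
      have hr : Run resid w c d := hw.run_iff.2 ⟨m, by rwa [hw', hd.preim_dropFin]⟩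
      obtain ⟨L', r, q⟩ := hr.exists_run_of_run h
      have hpos : 0 < w.length := by
        rw [← List.toFinset_card_of_nodup hw.1, hw']
        exact hne.card_pos
      obtain ⟨l, hl⟩ := ih _ (by omega) r rfl
      exact ⟨_, hl.cons hc hd hne⟩

theorem IsShape.parts_le {l : List ℕ} (h : IsShape n l d) :
    l.Pairwise (· ≥ ·) ∧ ∀ x ∈ l, x ≤ (dropFin n d).card := by
  induction h with
  | nil => simp
  | @cons l c d m h hc hd _ ih =>
    have h1 := hc.card_dropFin_le h.per hd
    have h2 : ∀ x ∈ l, x ≤ (dropFin n d).card := fun x hx => (ih.2 x hx).trans h1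
    refine ⟨List.pairwise_cons.2 ⟨h2, ih.1⟩, fun x hx => ?_⟩
    rcases List.mem_cons.1 hx with rfl | hx
    · exact le_rfl
    · exact h2 x hx

theorem IsShape.mem_pos_lt {l : List ℕ} (h : IsShape n l d) : ∀ x ∈ l, 0 < x ∧ x < n := by
  induction h with
  | nil => simp
  | @cons l c d m h hc hd hn ih =>
    intro x hx
    rcases List.mem_cons.1 hx with rfl | hx
    · refine ⟨hn.card_pos, ?_⟩
      have := card_lt_univ_of_notMem (s := dropFin n d)
        (by simpa using not_forall.1 (mt eq_univ_iff_forall.2 hd.dropFin_ne_univ) |>.choose_spec)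
      rwa [ZMod.card] at this
    · exact ih x hx

theorem IsShape.headD {l : List ℕ} (h : IsShape n l d) : l.headD 0 = (dropFin n d).card := by
  cases h with
  | nil => rw [dropFin_ground]; rfl
  | cons => rfl

theorem IsShape.right_unique {l : List ℕ} (h : IsShape n l d) {d' : ℤ → ℤ}
    (h' : IsShape n l d') : d = d' := by
  induction l generalizing d d' with
  | nil => cases h; cases h'; rfl
  | cons k l ih =>
    cases h with
    | @cons _ c _ m h1 h2 h3 h4 =>
      generalize hk : (dropFin n d).card = k at h'
      cases h' with
      | @cons _ c' _ m' h1' h2' h3' h4' =>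
        obtain rfl := ih h1 h1'
        exact h2.right_unique_of_card h1.per h3 h3' h2' hk

theorem IsShape.left_unique {l l' : List ℕ} (h : IsShape n l d) (h' : IsShape n l' d) :
    l = l' := by
  induction h generalizing l' with
  | nil =>
    generalize hg : ground n = g at h'
    cases h' with
    | nil => rfl
    | cons h hc hd hn => rw [← hg, dropFin_ground] at hn; simp at hn
  | @cons l c d m h hc hd hn ih =>
    cases h' with
    | nil => rw [dropFin_ground] at hn; simp at hn
    | @cons l' c' _ m' h' hc' hd' hn' =>
      have : c = c' := by
        obtain ⟨w, hw, hw'⟩ := exists_cycDecWord (dropFin n d) hd.dropFin_ne_univ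
        rw [← hd.preim_dropFin, ← hw'] at hc hc'
        exact (hw.run_iff.2 ⟨m, hc⟩).left_unique sparse_resid (hw.run_iff.2 ⟨m', hc'⟩)
      subst this
      rw [ih h']

theorem exists_isShape_of_list {l : List ℕ} (h : l.Pairwise (· ≥ ·))
    (h' : ∀ x ∈ l, 0 < x ∧ x < n) : ∃ d, IsShape n l d := by
  induction l with
  | nil => exact ⟨_, .nil⟩
  | cons k l ih =>
    rw [List.pairwise_cons] at h
    obtain ⟨c, hc⟩ := ih h.2 fun x hx => h' x (List.mem_cons_of_mem _ hx)
    have hk := h' k List.mem_cons_self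
    have h1 : (dropFin n c).card ≤ k := by
      rw [← hc.headD]
      rcases l with _ | ⟨x, l⟩
      · simp
      · exact h.1 x List.mem_cons_self
    obtain ⟨J, m, d, hJ, hJc, h2, h3⟩ := hc.per.exists_carries_card h1 hk.2
    have hd := (h2.per hJ hc.per).2
    refine ⟨d, ?_⟩
    have := IsShape.cons hc (d := d) (m := m) (by rwa [← hd.preim_dropFin, h3]) hd
      (card_pos.1 (by rw [h3, hJc]; exact hk.1))
    rwa [h3, hJc] at this

theorem IsShape.nilRep_self {l : List ℕ} (h : IsShape n l d) :
    nilRep ((l.map (nilH n)).prod) (Finsupp.single (ground n) 1) d = 1 := by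
  induction h with
  | nil => simp
  | @cons l c d m h hc hd hn ih =>
    rw [List.map_cons, List.prod_cons, map_mul, Module.End.mul_apply, nilRep_nilH_drops hd hc, ih]

/-- The head of `l'` is the size of the last strip, at most the size of the maximal one. In case of
equality the strip is the maximal one, the preceding state is the same, and the tails are compared.
-/
theorem IsShape.le_of_nilRep_ne_zero {l l' : List ℕ} (h : IsShape n l d)
    (hl' : ∀ x ∈ l', 0 < x)
    (h' : nilRep ((l'.map (nilH n)).prod) (Finsupp.single (ground n) 1) d ≠ 0) : l' ≤ l := by
  induction h generalizing l' with
  | nil =>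
    rcases l' with _ | ⟨k, l'⟩
    · exact le_rfl
    · rw [List.map_cons, List.prod_cons, map_mul, Module.End.mul_apply] at h'
      obtain ⟨J, m, c, h1, h2, h3, -⟩ := exists_carries_of_nilRep_nilH_ne_zero h'
      have h4 := h3.subset_dropFin h1 per_ground
      rw [dropFin_ground, subset_empty] at h4
      have := hl' k List.mem_cons_self
      rw [← h2, h4] at this
      simp at this
  | @cons l c d m h hc hd hn ih =>
    rcases l' with _ | ⟨k, l'⟩
    · exact not_lt.1 (List.not_lt_nil _)
    · rw [List.map_cons, List.prod_cons, map_mul, Module.End.mul_apply] at h'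
      obtain ⟨J, m', c', h1, h2, h3, h4⟩ := exists_carries_of_nilRep_nilH_ne_zero h'
      have h5 := h3.subset_dropFin h1 hd
      rw [le_iff_lt_or_eq, List.cons_lt_cons_iff]
      rcases (card_le_card h5).lt_or_eq with h6 | h6
      · exact Or.inl (Or.inl (h2 ▸ h6))
      · have h8 : k = (dropFin n d).card := h2 ▸ h6
        have h7 := eq_of_subset_of_card_le h5 h6.ge
        have : c = c' := by
          obtain ⟨w, hw, hw'⟩ := exists_cycDecWord (dropFin n d) hd.dropFin_ne_univ
          rw [h7, ← hw'] at h3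
          rw [← hd.preim_dropFin, ← hw'] at hc
          exact (hw.run_iff.2 ⟨m, hc⟩).left_unique sparse_resid (hw.run_iff.2 ⟨m', h3⟩)
        subst this
        rcases (ih (fun x hx => hl' x (List.mem_cons_of_mem _ hx)) h4).lt_or_eq with h9 | h9
        · exact Or.inl (Or.inr ⟨h8, h9⟩)
        · exact Or.inr (by rw [h8, h9])

end Shape

/-! ### The partition of a Grassmannian element -/

section GrassShape

theorem exists_isShape_grass (u : Grass n) : ∃ l, IsShape n l (translate u.1 (ground n)) := by
  obtain ⟨L, h1, h2⟩ := (cox n).exists_isReduced u.1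
  have h3 := u.2
  rw [h2] at h3 ⊢
  exact exists_isShape (h3.run h1)

/-- The partition of a Grassmannian element. -/
def shape (u : Grass n) : List ℕ := (exists_isShape_grass u).choose

theorem isShape_shape (u : Grass n) : IsShape n (shape u) (translate u.1 (ground n)) :=
  (exists_isShape_grass u).choose_spec

theorem shape_pairwise (u : Grass n) : (shape u).Pairwise (· ≥ ·) := (isShape_shape u).parts_le.1

theorem mem_shape (u : Grass n) : ∀ x ∈ shape u, 0 < x ∧ x < n := (isShape_shape u).mem_pos_lt

theorem shape_injective : Function.Injective (shape : Grass n → List ℕ) := by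
  intro u v h
  have h1 := isShape_shape u
  rw [h] at h1
  exact Subtype.ext (translate_ground_inj u.2 v.2 (h1.right_unique (isShape_shape v)))

theorem exists_shape_eq {l : List ℕ} (h : l.Pairwise (· ≥ ·)) (h' : ∀ x ∈ l, 0 < x ∧ x < n) :
    ∃ u : Grass n, shape u = l ∧ (cox n).length u.1 = l.sum := by
  obtain ⟨d, hd⟩ := exists_isShape_of_list h h'
  obtain ⟨L, h1, h2⟩ := hd.reach
  obtain ⟨h3, h4, h5⟩ := h1.grassmannian
  refine ⟨⟨_, h4⟩, ?_, by rw [← h2, h3.eq]⟩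
  have h6 := isShape_shape ⟨_, h4⟩
  rw [← h5] at h6
  exact h6.left_unique hd

theorem sum_shape (u : Grass n) : (shape u).sum = (cox n).length u.1 := by
  obtain ⟨v, h1, h2⟩ := exists_shape_eq (shape_pairwise u) (mem_shape u)
  rw [← h2, shape_injective h1]

theorem coef_shape (u : Grass n) : coef u.1 ((shape u).map (nilH n)).prod = 1 := by
  rw [coef_eq_nilRep_ground u.2]
  exact (isShape_shape u).nilRep_self

theorem le_shape_of_coef_ne_zero (u : Grass n) {l : List ℕ} (hl : ∀ x ∈ l, 0 < x)
    (h : coef u.1 (l.map (nilH n)).prod ≠ 0) : l ≤ shape u := by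
  rw [coef_eq_nilRep_ground u.2] at h
  exact (isShape_shape u).le_of_nilRep_ne_zero hl h

end GrassShape

end AffineStanley

/-! ### Symmetric functions as products of the `𝐡_i`. -/

namespace AffineStanley

variable {n : ℕ}

/-! ### The lists of parts -/

section Parts

theorem count_parts (α : Fin (n - 1) →₀ ℕ) (k : ℕ) :
    (parts α).count k = ∑ i : Fin (n - 1), if i.val + 1 = k then α i else 0 := by
  rw [parts, List.count_flatMap, Fin.sum_univ_def, List.map_reverse, List.sum_reverse]
  congr 2
  funext i
  simp [List.count_replicate]

theorem count_parts_succ (α : Fin (n - 1) →₀ ℕ) (i : Fin (n - 1)) :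
    (parts α).count (i.val + 1) = α i := by
  rw [count_parts, sum_eq_single_of_mem i (mem_univ _), if_pos rfl]
  intro j _ hj
  rw [if_neg]
  intro h
  exact hj (Fin.ext (by omega))

theorem parts_injective : Function.Injective (parts : (Fin (n - 1) →₀ ℕ) → List ℕ) := by
  intro α β h
  ext i
  rw [← count_parts_succ, h, count_parts_succ]

theorem mem_parts {α : Fin (n - 1) →₀ ℕ} {x : ℕ} (h : x ∈ parts α) : 0 < x ∧ x < n := by
  rw [parts, List.mem_flatMap] at h
  obtain ⟨i, -, hi⟩ := h
  have := (List.mem_replicate.1 hi).2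
  omega

theorem parts_pairwise (α : Fin (n - 1) →₀ ℕ) : (parts α).Pairwise (· ≥ ·) := by
  rw [parts, List.pairwise_flatMap]
  refine ⟨fun i _ => List.pairwise_replicate.2 (Or.inr le_rfl), ?_⟩
  rw [List.pairwise_reverse]
  refine (List.pairwise_lt_finRange (n - 1)).imp ?_
  intro i j hij x hx y hy
  rw [(List.mem_replicate.1 hx).2, (List.mem_replicate.1 hy).2]
  have : i.val < j.val := hij
  omega

theorem exists_perm_parts {l : List ℕ} (h : ∀ x ∈ l, 0 < x ∧ x < n) :
    ∃ α : Fin (n - 1) →₀ ℕ, (parts α).Perm l := by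
  refine ⟨Finsupp.equivFunOnFinite.symm fun i => l.count (i.val + 1), ?_⟩
  rw [List.perm_iff_count]
  intro k
  by_cases hk : 0 < k ∧ k < n
  · obtain ⟨i, rfl⟩ : ∃ i : Fin (n - 1), k = i.val + 1 := ⟨⟨k - 1, by omega⟩, by simp; omega⟩
    rw [count_parts_succ]
    rfl
  · rw [List.count_eq_zero_of_not_mem fun h' => hk (mem_parts h'),
      List.count_eq_zero_of_not_mem fun h' => hk (h k h')]

theorem exists_parts_eq {l : List ℕ} (hs : l.Pairwise (· ≥ ·)) (h : ∀ x ∈ l, 0 < x ∧ x < n) :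
    ∃ α : Fin (n - 1) →₀ ℕ, parts α = l := by
  obtain ⟨α, hα⟩ := exists_perm_parts h
  exact ⟨α, hα.eq_of_pairwise (fun a b _ _ h1 h2 => le_antisymm h2 h1) (parts_pairwise α) hs⟩

theorem parts_add_perm (α β : Fin (n - 1) →₀ ℕ) : (parts (α + β)).Perm (parts α ++ parts β) := by
  rw [List.perm_iff_count]
  intro k
  simp only [List.count_append, count_parts, Finsupp.add_apply, ← sum_add_distrib]
  refine sum_congr rfl fun i _ => ?_
  split_ifs <;> rfl

end Parts

section Algebra

variable [NeZero n] [Fact (1 < n)]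

theorem coef_mul_ne_zero {w : AffineSym n} {a b : NilCoxeter n} (h : coef w (a * b) ≠ 0) :
    ∃ u v, w = u * v ∧ (cox n).length w = (cox n).length u + (cox n).length v ∧
      coef u a ≠ 0 ∧ coef v b ≠ 0 := by
  classical
  obtain ⟨c, h1, h2⟩ := eq_sum_coef a
  obtain ⟨c', h1', h2'⟩ := eq_sum_coef b
  rw [h2, h2', Finsupp.sum, Finsupp.sum, sum_mul_sum, map_sum] at h
  obtain ⟨u, hu, h3⟩ := exists_ne_zero_of_sum_ne_zero h
  rw [map_sum] at h3
  obtain ⟨v, hv, h4⟩ := exists_ne_zero_of_sum_ne_zero h3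
  rw [smul_mul_smul_comm, map_smul] at h4
  have h5 : coef w (nilElt u * nilElt v) ≠ 0 := fun h5 => h4 (by rw [h5, smul_zero])
  by_cases h6 : (cox n).length (u * v) = (cox n).length u + (cox n).length v
  · rw [nilElt_mul h6, coef_nilElt] at h5
    have h7 : u * v = w := by
      by_contra h7
      exact h5 (if_neg h7)
    subst h7
    exact ⟨u, v, rfl, h6, by rw [h1]; exact Finsupp.mem_support_iff.1 hu,
      by rw [h1']; exact Finsupp.mem_support_iff.1 hv⟩
  · rw [nilElt_mul_eq_zero h6, map_zero] at h5
    exact absurd rfl h5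

theorem coef_one_ne_zero {w : AffineSym n} (h : coef w 1 ≠ 0) : w = 1 := by
  classical
  rw [← nilElt_one, coef_nilElt] at h
  by_contra h1
  exact h (if_neg fun h2 => h1 h2.symm)

theorem coef_nilH_ne_zero {w : AffineSym n} {k : ℕ} (h : coef w (nilH n k) ≠ 0) :
    ∃ J : Finset (ZMod n), J ≠ univ ∧ J.card = k ∧ w = cycDec J := by
  classical
  rw [nilH, map_sum] at h
  obtain ⟨J, h1, h2⟩ := exists_ne_zero_of_sum_ne_zero h
  rw [mem_filter] at h1
  rw [coef_nilElt] at h2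
  refine ⟨J, h1.2.1, h1.2.2, ?_⟩
  by_contra h3
  exact h2 (if_neg fun h4 => h3 h4.symm)

theorem length_of_coef_prod_nilH_ne_zero {l : List ℕ} {w : AffineSym n}
    (h : coef w (l.map (nilH n)).prod ≠ 0) : (cox n).length w = l.sum := by
  induction l generalizing w with
  | nil =>
    rw [List.map_nil, List.prod_nil] at h
    rw [coef_one_ne_zero h, CoxeterSystem.length_one, List.sum_nil]
  | cons k l ih =>
    rw [List.map_cons, List.prod_cons] at h
    obtain ⟨u, v, -, h1, h2, h3⟩ := coef_mul_ne_zero h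
    obtain ⟨J, h4, h5, rfl⟩ := coef_nilH_ne_zero h2
    rw [h1, ih h3, length_cycDec h4, h5, List.sum_cons]

theorem nilH_zero : nilH n 0 = 1 := by
  classical
  have : (univ : Finset (Finset (ZMod n))).filter (fun J => J ≠ univ ∧ J.card = 0) = {∅} := by
    ext J
    rw [mem_filter, card_eq_zero, mem_singleton]
    exact ⟨fun h => h.2.2, fun h => ⟨mem_univ _, h ▸ univ_nonempty.ne_empty.symm, h⟩⟩
  rw [nilH]
  convert sum_singleton (fun J => nilElt (cycDec (n := n) J)) ∅ using 2
  · rw [cycDec_empty, nilElt_one]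

theorem nilH_eq_zero {k : ℕ} (hk : n ≤ k) : nilH n k = 0 := by
  classical
  refine sum_eq_zero fun J hJ => ?_
  rw [mem_filter] at hJ
  refine absurd ?_ hJ.2.1
  rw [← card_eq_iff_eq_univ, ZMod.card]
  have := card_le_univ J
  rw [ZMod.card] at this
  omega

theorem commute_prod_nilH (l l' : List ℕ) :
    (l.map (nilH n)).prod * (l'.map (nilH n)).prod =
      (l'.map (nilH n)).prod * (l.map (nilH n)).prod := by
  refine Commute.list_prod_left _ _ fun x hx => Commute.list_prod_right _ _ fun y hy => ?_
  obtain ⟨i, -, rfl⟩ := List.mem_map.1 hx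
  obtain ⟨j, -, rfl⟩ := List.mem_map.1 hy
  exact nilH_comm i j

theorem prod_nilH_perm {l l' : List ℕ} (h : l.Perm l') :
    (l.map (nilH n)).prod = (l'.map (nilH n)).prod := by
  refine (h.map _).prod_eq' ?_
  rw [List.pairwise_map]
  exact List.pairwise_of_forall fun i j => nilH_comm i j

variable (n) in
/-- The product `𝐡_λ`. -/
def hProd (α : Fin (n - 1) →₀ ℕ) : NilCoxeter n := ((parts α).map (nilH n)).prod

theorem hProd_add (α β : Fin (n - 1) →₀ ℕ) : hProd n (α + β) = hProd n α * hProd n β := by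
  rw [hProd, prod_nilH_perm (parts_add_perm α β), List.map_append, List.prod_append]
  rfl

variable (n) in
/-- The map `noncomm` as a linear map. -/
def noncommLin : HRing n →ₗ[ℤ] NilCoxeter n :=
  (MvPolynomial.basisMonomials (Fin (n - 1)) ℤ).constr ℤ (hProd n)

theorem noncommLin_apply (f : HRing n) : noncommLin n f = noncomm f := by
  rw [noncommLin, Module.Basis.constr_apply]
  rfl

theorem noncommLin_monomial (α : Fin (n - 1) →₀ ℕ) :
    noncommLin n (MvPolynomial.monomial α 1) = hProd n α := by
  have := (MvPolynomial.basisMonomials (Fin (n - 1)) ℤ).constr_basis ℤ (hProd n) α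
  rwa [MvPolynomial.coe_basisMonomials] at this

theorem noncomm_eq_sum (f : HRing n) : noncomm f = ∑ α ∈ f.support, f.coeff α • hProd n α := rfl

theorem noncomm_comm (f g : HRing n) : noncomm f * noncomm g = noncomm g * noncomm f := by
  rw [noncomm_eq_sum, noncomm_eq_sum, sum_mul_sum, sum_mul_sum, sum_comm]
  refine sum_congr rfl fun β _ => sum_congr rfl fun α _ => ?_
  rw [smul_mul_smul_comm, smul_mul_smul_comm, mul_comm (f.coeff α)]
  congr 1
  exact commute_prod_nilH _ _

/-! ### Coefficients of affine Stanley functions -/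

theorem prod_ofFn_sum {A X : Type*} [Ring A] [Fintype X] {N : ℕ} (f : Fin N → X → A) :
    (List.ofFn fun i => ∑ x, f i x).prod =
      ∑ J : Fin N → X, (List.ofFn fun i => f i (J i)).prod := by
  induction N with
  | zero => simp
  | succ N ih =>
    rw [List.ofFn_succ, List.prod_cons, ih, sum_mul_sum, ← sum_product', univ_product_univ]
    refine Fintype.sum_equiv (Fin.consEquiv fun _ => X) _ _ fun p => ?_
    simp [List.ofFn_succ, Fin.consEquiv]

theorem prod_ofFn_ite {A : Type*} [Ring A] {N : ℕ} (P : Fin N → Prop) [DecidablePred P]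
    [Decidable (∀ i, P i)] (t : Fin N → A) :
    (List.ofFn fun i => if P i then t i else 0).prod =
      if ∀ i, P i then (List.ofFn t).prod else 0 := by
  split_ifs with h
  · simp [h]
  · push Not at h
    obtain ⟨i, hi⟩ := h
    refine List.prod_eq_zero ?_
    rw [List.mem_ofFn]
    exact ⟨i, if_neg hi⟩

open Classical in
theorem coef_prod_nilElt (w : AffineSym n) (l : List (AffineSym n)) :
    coef w (l.map nilElt).prod = if l.prod = w ∧ (cox n).length w = (l.map (cox n).length).sum
      then 1 else 0 := by
  have key : ∀ l : List (AffineSym n), (cox n).length l.prod ≤ (l.map (cox n).length).sum ∧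
      (l.map nilElt).prod = if (cox n).length l.prod = (l.map (cox n).length).sum
        then nilElt l.prod else 0 := by
    intro l
    induction l with
    | nil => simp [nilElt_one]
    | cons v l ih =>
      simp only [List.prod_cons, List.map_cons, List.sum_cons]
      have h1 := (cox n).length_mul_le v l.prod
      refine ⟨by omega, ?_⟩
      rw [ih.2]
      split_ifs with h2 h3 h3
      · rw [nilElt_mul (by omega)]
      · rw [nilElt_mul_eq_zero (by omega)]
      · omega
      · rw [mul_zero]
  rw [(key l).2]
  split_ifs with h1 h2 h2
  · rw [coef_nilElt, if_pos h2.1]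
  · rw [coef_nilElt, if_neg]
    rintro rfl
    exact h2 ⟨rfl, h1⟩
  · exact absurd (h2.1 ▸ h2.2) h1
  · rw [map_zero]

/-- Expanding the product of the sums `𝐡_{a_i}` lists all sequences of subsets, and by
`coef_prod_nilElt` a sequence contributes exactly when its product is `w` and the lengths add. -/
theorem coeff_affineStanley (w : AffineSym n) (a : ℕ →₀ ℕ) :
    MvPowerSeries.coeff a (affineStanley w) =
      coef w (((List.range (a.support.sup id + 1)).map a).map (nilH n)).prod := by
  classical
  have h0 : ∀ k, nilH n k = ∑ J : Finset (ZMod n),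
      if J ≠ univ ∧ J.card = k then nilElt (cycDec J) else 0 := fun k => by
    rw [nilH, sum_filter]
  have h1 : ((List.range (a.support.sup id + 1)).map a).map (nilH n) =
      List.ofFn fun i : Fin (a.support.sup id + 1) => ∑ J : Finset (ZMod n),
        if J ≠ univ ∧ J.card = a i then nilElt (cycDec J) else 0 := by
    rw [List.ofFn_eq_map, List.map_map, ← List.map_coe_finRange_eq_range, List.map_map]
    congr 1
    funext i
    exact h0 _
  rw [h1, prod_ofFn_sum, map_sum]
  change ((_ : ℕ) : ℤ) = _
  rw [card_filter]
  push_cast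
  refine sum_congr rfl fun J _ => ?_
  rw [prod_ofFn_ite]
  by_cases hJ : ∀ i : Fin (a.support.sup id + 1), J i ≠ univ ∧ (J i).card = a i
  · rw [if_pos hJ]
    have h2 := coef_prod_nilElt w (List.ofFn fun i => cycDec (J i))
    rw [List.map_ofFn, List.map_ofFn] at h2
    have h3 : (List.ofFn ((cox n).length ∘ fun i => cycDec (J i))).sum = ∑ i, (J i).card := by
      rw [List.sum_ofFn]
      exact sum_congr rfl fun i _ => length_cycDec (hJ i).1
    rw [h3] at h2
    refine Eq.trans ?_ h2.symm
    congr 1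
    exact propext ⟨fun h => h.2, fun h => ⟨hJ, h⟩⟩
  · rw [if_neg hJ, map_zero, if_neg fun h => hJ h.1]

theorem prod_nilH_filter (l : List ℕ) :
    ((l.filter (· ≠ 0)).map (nilH n)).prod = (l.map (nilH n)).prod := by
  induction l with
  | nil => rfl
  | cons k l ih =>
    rw [List.filter_cons]
    by_cases hk : k = 0
    · subst hk
      simp only [ne_eq, not_true, decide_false, Bool.false_eq_true, if_false]
      rw [ih, List.map_cons, List.prod_cons, nilH_zero, one_mul]
    · simp only [ne_eq, hk, not_false_eq_true, decide_true, if_true]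
      rw [List.map_cons, List.map_cons, List.prod_cons, List.prod_cons, ih]

/-- An exponent at least `n` gives a zero factor; otherwise commutativity lets the exponents be
sorted. Here the symmetry of `F_w` enters. -/
theorem coeff_affineStanley_eq (a : ℕ →₀ ℕ) :
    (∀ w : AffineSym n, MvPowerSeries.coeff a (affineStanley w) = 0) ∨
      ∃ α, ∀ w : AffineSym n, MvPowerSeries.coeff a (affineStanley w) = coef w (hProd n α) := by
  by_cases h : ∀ x ∈ ((List.range (a.support.sup id + 1)).map a).filter (· ≠ 0), x < n
  · obtain ⟨α, hα⟩ := exists_perm_parts (n := n)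
      (l := ((List.range (a.support.sup id + 1)).map a).filter (· ≠ 0))
      (fun x hx => ⟨Nat.pos_of_ne_zero (by simpa using (List.mem_filter.1 hx).2), h x hx⟩)
    right
    refine ⟨α, fun w => ?_⟩
    rw [coeff_affineStanley, ← prod_nilH_filter, ← prod_nilH_perm hα]
    rfl
  · left
    intro w
    push Not at h
    obtain ⟨x, hx, hxn⟩ := h
    rw [coeff_affineStanley, ← prod_nilH_filter, List.prod_eq_zero, map_zero]
    exact List.mem_map.2 ⟨x, hx, nilH_eq_zero hxn⟩

theorem coeff_parts (α : Fin (n - 1) →₀ ℕ) (w : AffineSym n) :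
    MvPowerSeries.coeff (parts α).toFinsupp (affineStanley w) = coef w (hProd n α) := by
  have key : ∀ l : List ℕ, (∀ x ∈ l, 0 < x) → ((List.range (l.toFinsupp.support.sup id + 1)).map
      l.toFinsupp).filter (· ≠ 0) = l := by
    intro l hl
    have h1 : l.toFinsupp.support = range l.length := by
      ext i
      rw [Finsupp.mem_support_iff, List.toFinsupp_apply, mem_range]
      constructor
      · intro h
        by_contra h'
        exact h (List.getD_eq_default _ _ (by omega))
      · intro h
        rw [List.getD_eq_getElem _ _ h]
        exact (hl _ (List.getElem_mem h)).ne'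
    rw [h1]
    rcases l with _ | ⟨x, l⟩
    · simp
    · have h2 : (range (x :: l).length).sup id + 1 = (x :: l).length := by
        rw [List.length_cons]
        congr 1
        exact le_antisymm (Finset.sup_le fun i hi => Nat.le_of_lt_succ (mem_range.1 hi))
          (Finset.le_sup (f := id) (self_mem_range_succ l.length))
      rw [h2, List.filter_eq_self.2]
      · refine List.ext_getElem (by simp) fun i h3 h4 => ?_
        simp only [List.getElem_map, List.getElem_range, List.toFinsupp_apply]
        rw [List.getD_eq_getElem _ _ h4]
      · intro y hy
        obtain ⟨i, hi, rfl⟩ := List.mem_map.1 hy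
        rw [List.mem_range] at hi
        rw [List.toFinsupp_apply, List.getD_eq_getElem _ _ hi]
        simpa using (hl _ (List.getElem_mem hi)).ne'
  rw [coeff_affineStanley, ← prod_nilH_filter, key _ fun x hx => (mem_parts hx).1]
  rfl

/-- This moves every question about `F_w` into the nilCoxeter algebra. -/
theorem hallPairing_affineStanley (f : HRing n) (w : AffineSym n) :
    hallPairing f (affineStanley w) = coef w (noncomm f) := by
  rw [hallPairing, noncomm_eq_sum, map_sum]
  refine sum_congr rfl fun α _ => ?_
  rw [coeff_parts, map_smul, smul_eq_mul]

theorem isAffineSchurExpansion_iff (w : AffineSym n) (c : Grass n →₀ ℤ) :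
    IsAffineSchurExpansion w c ↔
      ∀ f : HRing n, coef w (noncomm f) = c.sum fun u z => z * coef u.1 (noncomm f) := by
  have h1 : ∀ a, MvPowerSeries.coeff a (c.sum fun u z => z • affineStanley u.1) =
      c.sum fun u z => z * MvPowerSeries.coeff a (affineStanley u.1) := by
    intro a
    rw [Finsupp.sum, map_sum]
    refine sum_congr rfl fun u _ => ?_
    rw [map_zsmul, smul_eq_mul]
  constructor
  · intro h f
    simp only [← hallPairing_affineStanley]
    rw [show affineStanley w = _ from h]
    simp only [hallPairing, h1]
    simp only [Finsupp.sum, mul_sum]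
    rw [sum_comm]
    refine sum_congr rfl fun u _ => sum_congr rfl fun α _ => ?_
    ring
  · intro h
    refine MvPowerSeries.ext fun a => ?_
    rw [h1]
    rcases coeff_affineStanley_eq (n := n) a with h2 | ⟨α, h2⟩
    · simp [h2]
    · simp only [h2]
      have := h (MvPolynomial.monomial α 1)
      rwa [← noncommLin_apply, noncommLin_monomial] at this

end Algebra

end AffineStanley

namespace AffineStanley

variable {n : ℕ} [NeZero n] [Fact (1 < n)]

/-! ### The `k`-Schur basis -/

section Duality

theorem finite_length_eq (t : ℕ) : {w : AffineSym n | (cox n).length w = t}.Finite := by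
  refine ((List.finite_length_eq (ZMod n) t).image (cox n).wordProd).subset ?_
  intro w hw
  obtain ⟨l, h1, rfl⟩ := (cox n).exists_isReduced w
  exact ⟨l, by rw [Set.mem_ofPred_eq, ← h1.eq]; exact hw, rfl⟩

theorem finite_grass_length_eq (t : ℕ) : {u : Grass n | (cox n).length u.1 = t}.Finite :=
  (finite_length_eq t).preimage Subtype.val_injective.injOn

/-- The exponent of the monomial `h_λ`, `λ` the partition of `u`. -/
def expo (u : Grass n) : Fin (n - 1) →₀ ℕ :=
  (exists_parts_eq (shape_pairwise u) (mem_shape u)).choose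

theorem parts_expo (u : Grass n) : parts (expo u) = shape u :=
  (exists_parts_eq (shape_pairwise u) (mem_shape u)).choose_spec

theorem exists_expo_eq (α : Fin (n - 1) →₀ ℕ) : ∃ u : Grass n, expo u = α := by
  obtain ⟨u, h, -⟩ := exists_shape_eq (parts_pairwise α) fun x hx => mem_parts hx
  exact ⟨u, parts_injective (by rw [parts_expo, h])⟩

theorem coef_hProd_expo (u : Grass n) : coef u.1 (hProd n (expo u)) = 1 := by
  rw [hProd, parts_expo, coef_shape]

theorem le_shape_of_coef_hProd {u : Grass n} {α : Fin (n - 1) →₀ ℕ}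
    (h : coef u.1 (hProd n α) ≠ 0) : parts α ≤ shape u :=
  le_shape_of_coef_ne_zero u (fun _ hx => (mem_parts hx).1) h

theorem length_of_coef_hProd {w : AffineSym n} {u : Grass n}
    (h : coef w (hProd n (expo u)) ≠ 0) : (cox n).length w = (cox n).length u.1 := by
  rw [length_of_coef_prod_nilH_ne_zero h, parts_expo, sum_shape]

-- Inversion of the unitriangular matrix of Grassmannian coefficients of the `𝐡_λ`. The second
-- clause keeps track of homogeneity, including the coefficients at non-Grassmannian `w`.
open Classical in
theorem exists_dual (u : Grass n) : ∃ f : HRing n,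
    (∀ v : Grass n, coef v.1 (noncommLin n f) = if u = v then 1 else 0) ∧
    ∀ w, coef w (noncommLin n f) ≠ 0 → (cox n).length w = (cox n).length u.1 := by
  set G := (finite_grass_length_eq (n := n) ((cox n).length u.1)).toFinset with hG
  have hmem : ∀ v, v ∈ G ↔ (cox n).length v.1 = (cox n).length u.1 := fun v => by
    rw [hG, Set.Finite.mem_toFinset, Set.mem_ofPred_eq]
  -- Elimination from the largest shape downwards among the finitely many Grassmannian elements of
  -- the given length; `t` counts the shapes above that of `v`.
  suffices h : ∀ t : ℕ, ∀ v ∈ G, (G.filter fun v' => shape v < shape v').card = t →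
      ∃ f : HRing n, (∀ v' : Grass n, coef v'.1 (noncommLin n f) = if v = v' then 1 else 0) ∧
        ∀ w, coef w (noncommLin n f) ≠ 0 → (cox n).length w = (cox n).length u.1 from
    h _ u ((hmem u).2 rfl) rfl
  intro t
  induction t using Nat.strong_induction_on with
  | _ t ih =>
    intro v hv ht
    have h1 : ∀ v' : Grass n, ∃ f : HRing n, v' ∈ G.filter (fun v' => shape v < shape v') →
        (∀ v'' : Grass n, coef v''.1 (noncommLin n f) = if v' = v'' then 1 else 0) ∧
          ∀ w, coef w (noncommLin n f) ≠ 0 → (cox n).length w = (cox n).length u.1 := by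
      intro v'
      by_cases h2 : v' ∈ G.filter (fun v' => shape v < shape v')
      · have h3 := mem_filter.1 h2
        obtain ⟨f, hf⟩ := ih (G.filter fun v'' => shape v' < shape v'').card (by
          rw [← ht]
          refine card_lt_card ⟨fun x hx => ?_, fun hs => ?_⟩
          · rw [mem_filter] at hx ⊢
            exact ⟨hx.1, h3.2.trans hx.2⟩
          · exact lt_irrefl _ (mem_filter.1 (hs h2)).2) v' h3.1 rfl
        exact ⟨f, fun _ => hf⟩
      -- A default outside the index set, so that `f` can be chosen for all `v'`.
      · exact ⟨0, fun h => absurd h h2⟩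
    choose f hf using h1
    refine ⟨MvPolynomial.monomial (expo v) 1 - ∑ v' ∈ G.filter (fun v' => shape v < shape v'),
      coef v'.1 (hProd n (expo v)) • f v', fun v'' => ?_, fun w hw => ?_⟩
    · rw [map_sub, map_sum, noncommLin_monomial, map_sub, map_sum]
      simp only [map_smul, smul_eq_mul]
      rw [sum_congr rfl fun v' hv' => by rw [(hf v' hv').1 v'']]
      simp only [mul_ite, mul_one, mul_zero, sum_ite_eq']
      by_cases h2 : coef v''.1 (hProd n (expo v)) = 0
      · rw [if_neg fun h : v = v'' => by
          rw [← h, coef_hProd_expo] at h2; exact one_ne_zero h2]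
        simp [h2]
      · have h3 : v'' ∈ G := (hmem v'').2 ((length_of_coef_hProd h2).trans ((hmem v).1 hv))
        have h4 := le_shape_of_coef_hProd h2
        rw [parts_expo] at h4
        by_cases h5 : v = v''
        · subst h5
          have h6 : v ∉ G.filter fun v' => shape v < shape v' :=
            fun h => lt_irrefl _ (mem_filter.1 h).2
          rw [if_neg h6, if_pos rfl, coef_hProd_expo, sub_zero]
        · have h6 : v'' ∈ G.filter fun v' => shape v < shape v' :=
            mem_filter.2 ⟨h3, lt_of_le_of_ne h4 fun h => h5 (shape_injective h)⟩
          rw [if_neg h5, if_pos h6, sub_self]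
    · by_contra hl
      apply hw
      rw [map_sub, map_sum, noncommLin_monomial, map_sub, map_sum]
      have h2 : coef w (hProd n (expo v)) = 0 := by
        by_contra h2
        exact hl ((length_of_coef_hProd h2).trans ((hmem v).1 hv))
      rw [h2, zero_sub, neg_eq_zero]
      refine sum_eq_zero fun v' hv' => ?_
      rw [map_smul, map_smul]
      have h3 : coef w (noncommLin n (f v')) = 0 := by
        by_contra h3
        exact hl ((hf v' hv').2 w h3)
      rw [h3, smul_zero]

/-- At the element whose partition is the lexicographically least one in the support, triangularity
leaves only the corresponding term, with coefficient one. -/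
theorem eq_zero_of_coef {f : HRing n} (h : ∀ v : Grass n, coef v.1 (noncommLin n f) = 0) :
    f = 0 := by
  by_contra hf
  have hs : f.support.Nonempty := by
    rw [nonempty_iff_ne_empty]
    exact fun h => hf (MvPolynomial.support_eq_empty.1 h)
  obtain ⟨α, hα, hmin⟩ := exists_min_image f.support parts hs
  obtain ⟨v, rfl⟩ := exists_expo_eq α
  have h1 := h v
  rw [noncommLin_apply, noncomm_eq_sum, map_sum, sum_eq_single_of_mem (expo v) hα, map_smul,
    coef_hProd_expo, smul_eq_mul, mul_one] at h1
  · exact MvPolynomial.mem_support_iff.1 hα h1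
  · intro β hβ hne
    by_contra h2
    rw [map_smul] at h2
    have h3 := le_shape_of_coef_hProd (u := v) (α := β) fun h3 => h2 (by rw [h3, smul_zero])
    rw [← parts_expo] at h3
    exact hne (parts_injective (le_antisymm h3 (hmin β hβ)))

theorem ext_coef_grass {f g : HRing n}
    (h : ∀ v : Grass n, coef v.1 (noncommLin n f) = coef v.1 (noncommLin n g)) : f = g := by
  rw [← sub_eq_zero]
  refine eq_zero_of_coef fun v => ?_
  rw [map_sub, map_sub, h, sub_self]

/-- The `k`-Schur functions. -/
def kSchur (u : Grass n) : HRing n := (exists_dual u).choose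

open Classical in
theorem coef_kSchur (u v : Grass n) :
    coef v.1 (noncommLin n (kSchur u)) = if u = v then 1 else 0 :=
  (exists_dual u).choose_spec.1 v

theorem length_of_coef_kSchur {u : Grass n} {w : AffineSym n}
    (h : coef w (noncommLin n (kSchur u)) ≠ 0) : (cox n).length w = (cox n).length u.1 :=
  (exists_dual u).choose_spec.2 w h

theorem isKSchurFamily_iff (s : Grass n → HRing n) : IsKSchurFamily s ↔ s = kSchur := by
  classical
  simp only [IsKSchurFamily, hallPairing_affineStanley, ← noncommLin_apply]
  constructor
  · intro h
    funext u
    exact ext_coef_grass fun v => by rw [h, coef_kSchur]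
  · rintro rfl u v
    exact coef_kSchur u v

theorem exists_finsupp_grass (a : NilCoxeter n) :
    ∃ c : Grass n →₀ ℤ, ∀ u : Grass n, c u = coef u.1 a := by
  obtain ⟨c, h1, -⟩ := eq_sum_coef a
  refine ⟨c.comapDomain Subtype.val Subtype.val_injective.injOn, fun u => ?_⟩
  rw [Finsupp.comapDomain_apply, h1]

theorem exists_eq_sum_kSchur (f : HRing n) : ∃ c : Grass n →₀ ℤ,
    (∀ u : Grass n, c u = coef u.1 (noncommLin n f)) ∧ f = c.sum fun u z => z • kSchur u := by
  classical
  obtain ⟨c, hc⟩ := exists_finsupp_grass (noncommLin n f)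
  refine ⟨c, hc, ext_coef_grass fun v => ?_⟩
  rw [← hc, Finsupp.sum, map_sum, map_sum]
  simp only [map_smul, coef_kSchur, smul_eq_mul, mul_ite, mul_one, mul_zero]
  rw [sum_ite_eq']
  split_ifs with h
  · rfl
  · exact Finsupp.notMem_support_iff.1 h

/-- An expansion is an identity of linear functionals on `ℤ[h_1, …, h_{n-1}]`, and can be tested on
the `k`-Schur functions, which span and are dual to the affine Schur functions. -/
theorem isAffineSchurExpansion_iff_coef (w : AffineSym n) (c : Grass n →₀ ℤ) :
    IsAffineSchurExpansion w c ↔ ∀ u, c u = coef w (noncommLin n (kSchur u)) := by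
  classical
  rw [isAffineSchurExpansion_iff]
  simp only [← noncommLin_apply]
  constructor
  · intro h u
    rw [h]
    simp only [coef_kSchur, mul_ite, mul_one, mul_zero]
    rw [Finsupp.sum, sum_ite_eq]
    split_ifs with h
    · rfl
    · exact Finsupp.notMem_support_iff.1 h
  · intro h f
    obtain ⟨b, hb, hf⟩ := exists_eq_sum_kSchur f
    simp only [← hb]
    have h1 : coef w (noncommLin n f) = b.sum fun u z => z * c u := by
      conv_lhs => rw [hf]
      rw [Finsupp.sum, map_sum, map_sum]
      simp only [map_smul, smul_eq_mul, ← h]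
      rfl
    rw [h1, Finsupp.sum_of_support_subset b (subset_union_left (s₂ := c.support)) _ (by simp),
      Finsupp.sum_of_support_subset c (subset_union_right (s₁ := b.support)) _ (by simp)]
    exact sum_congr rfl fun u _ => mul_comm _ _

theorem existsUnique_isAffineSchurExpansion (w : AffineSym n) :
    ∃! c : Grass n →₀ ℤ, IsAffineSchurExpansion w c := by
  refine ⟨Finsupp.onFinset (finite_grass_length_eq ((cox n).length w)).toFinset
    (fun u => coef w (noncommLin n (kSchur u))) fun u hu => ?_, ?_, fun c hc => ?_⟩
  · rw [Set.Finite.mem_toFinset]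
    exact (length_of_coef_kSchur hu).symm
  · exact (isAffineSchurExpansion_iff_coef _ _).2 fun u => rfl
  · ext u
    rw [(isAffineSchurExpansion_iff_coef _ _).1 hc]
    rfl

theorem existsUnique_isKSchurFamily : ∃! s : Grass n → HRing n, IsKSchurFamily s :=
  ⟨kSchur, (isKSchurFamily_iff _).2 rfl, fun s hs => (isKSchurFamily_iff s).1 hs⟩

/-- If `w` extends to a Grassmannian element `w y`, then the coefficient of the affine Schur function
of `u` in the affine Stanley function of `w` vanishes unless `u` is a right factor of `w y`. -/
theorem exists_right_factor_of_coef_kSchur {w y : AffineSym n} {u : Grass n}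
    (hg : IsZeroGrassmannian (w * y))
    (hl : (cox n).length (w * y) = (cox n).length w + (cox n).length y)
    (h : coef w (noncommLin n (kSchur u)) ≠ 0) :
    ∃ x, w * y = x * u.1 ∧ (cox n).length (w * y) = (cox n).length x + (cox n).length u.1 := by
  classical
  have hy : IsZeroGrassmannian y := hg.of_mul hl
  -- Among its Grassmannian terms `s_v` has only `A_v`; the other terms are invisible at the
  -- Grassmannian element `w y`.
  have key : ∀ (v : Grass n) (a : NilCoxeter n),
      coef (w * y) (a * noncommLin n (kSchur v)) = coef (w * y) (a * nilElt v.1) := by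
    intro v a
    obtain ⟨c, h1, h2⟩ := eq_sum_coef (noncommLin n (kSchur v))
    conv_lhs => rw [h2]
    rw [Finsupp.sum, mul_sum, map_sum]
    have h3 : ∀ w' ∈ c.support, coef (w * y) (a * c w' • nilElt w') =
        if v.1 = w' then coef (w * y) (a * nilElt v.1) else 0 := by
      intro w' _
      rw [mul_smul_comm, map_smul, ← h1]
      by_cases hw' : IsZeroGrassmannian w'
      · rw [coef_kSchur v ⟨w', hw'⟩]
        by_cases h4 : v = ⟨w', hw'⟩
        · subst h4
          simp
        · rw [if_neg h4, if_neg fun h5 => h4 (Subtype.ext h5), zero_smul]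
      · rw [coef_mul_nilElt_of_not hg hw', smul_zero, if_neg]
        rintro rfl
        exact hw' v.2
    rw [sum_congr rfl h3, sum_ite_eq]
    by_cases h5 : v.1 ∈ c.support
    · rw [if_pos h5]
    · have h6 := coef_kSchur v v
      rw [h1, Finsupp.notMem_support_iff.1 h5, if_pos rfl] at h6
      exact absurd h6 zero_ne_one
  -- Only the term `A_w` can contribute, because `y` cancels on the right.
  have h1 : coef (w * y) (noncommLin n (kSchur u) * nilElt y) =
      coef w (noncommLin n (kSchur u)) := by
    obtain ⟨c, h1, h2⟩ := eq_sum_coef (noncommLin n (kSchur u))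
    conv_lhs => rw [h2]
    rw [h1, Finsupp.sum, sum_mul, map_sum]
    have h3 : ∀ w' ∈ c.support, coef (w * y) (c w' • nilElt w' * nilElt y) =
        if w = w' then c w else 0 := by
      intro w' _
      rw [smul_mul_assoc, map_smul, smul_eq_mul]
      by_cases h4 : w = w'
      · subst h4
        rw [if_pos rfl, nilElt_mul hl, coef_nilElt, if_pos rfl, mul_one]
      · rw [if_neg h4]
        by_cases h5 : (cox n).length (w' * y) = (cox n).length w' + (cox n).length y
        · rw [nilElt_mul h5, coef_nilElt, if_neg fun h6 => h4 (mul_right_cancel h6).symm, mul_zero]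
        · rw [nilElt_mul_eq_zero h5, map_zero, mul_zero]
    rw [sum_congr rfl h3, sum_ite_eq]
    split_ifs with h5
    · rfl
    · exact (Finsupp.notMem_support_iff.1 h5).symm
  -- At `w y`, the product `s_u A_y` is replaced by `s_u s_y`, then by `s_y s_u`, then by `s_y A_u`.
  rw [← h1, ← key ⟨y, hy⟩, noncommLin_apply, noncommLin_apply, noncomm_comm, ← noncommLin_apply,
    ← noncommLin_apply, key] at h
  obtain ⟨x, v, h2, h3, -, h4⟩ := coef_mul_ne_zero h
  rw [coef_nilElt] at h4
  have h5 : u.1 = v := by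
    by_contra h5
    exact h4 (if_neg h5)
  exact ⟨x, h5 ▸ h2, h5 ▸ h3⟩

end Duality

end AffineStanley

/-! ### Hopping particles and the combinatorics of `321`-avoiding words. -/

namespace AffineStanley

variable {n : ℕ} [NeZero n] [Fact (1 < n)]

/-! ### Particles on a cycle -/

section Particles

variable {S T : Finset (ZMod n)} {l l' : List (ZMod n)} {i j : ZMod n}

/-- The word `l` moves the particles from `S` to `T`; the letter `i` moves a particle from `i` to
the empty site `i + 1`, and the rightmost letter acts first. -/
def Moves : List (ZMod n) → Finset (ZMod n) → Finset (ZMod n) → Prop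
  | [], S, T => T = S
  | i :: l, S, T => ∃ R, Moves l S R ∧ i ∈ R ∧ i + 1 ∉ R ∧ T = insert (i + 1) (R.erase i)

theorem moves_append : Moves (l ++ l') S T ↔ ∃ R, Moves l' S R ∧ Moves l R T := by
  induction l generalizing T with
  | nil => simp [Moves]
  | cons i l ih =>
    simp only [List.cons_append, Moves, ih]
    constructor
    · rintro ⟨R, ⟨Q, h1, h2⟩, h3⟩
      exact ⟨Q, h1, R, h2, h3⟩
    · rintro ⟨Q, h1, R, h2, h3⟩
      exact ⟨R, ⟨Q, h1, h2⟩, h3⟩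

theorem Moves.card_eq (h : Moves l S T) : T.card = S.card := by
  induction l generalizing T with
  | nil => rw [show T = S from h]
  | cons i l ih =>
    obtain ⟨R, h1, h2, h3, rfl⟩ := h
    rw [card_insert_of_notMem fun h => h3 (mem_of_mem_erase h), card_erase_of_mem h2, ← ih h1]
    exact Nat.sub_add_cancel (card_pos.2 ⟨i, h2⟩)

theorem add_one_ne_self (i : ZMod n) : i + 1 ≠ i := by
  have := ZMod.nontrivial_iff (n := n) |>.2 (Fact.out : 1 < n).ne'
  simp

theorem sub_one_ne_self (i : ZMod n) : i - 1 ≠ i := by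
  intro h
  exact add_one_ne_self (i - 1) (by rw [sub_add_cancel, h])

theorem Moves.mem_iff (h : Moves l S T) (h1 : ∀ x ∈ l, x ≠ j ∧ x ≠ j - 1) : j ∈ T ↔ j ∈ S := by
  induction l generalizing T with
  | nil => rw [show T = S from h]
  | cons i l ih =>
    obtain ⟨R, h2, h3, h4, rfl⟩ := h
    obtain ⟨h5, h6⟩ := h1 i List.mem_cons_self
    rw [mem_insert, mem_erase, ← ih h2 fun x hx => h1 x (List.mem_cons_of_mem _ hx)]
    constructor
    · rintro (h | h)
      · exact absurd (eq_sub_of_add_eq h.symm) h6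
      · exact h.2
    · exact fun h => Or.inr ⟨h5.symm, h⟩

theorem Moves.notMem_of_append {y z : List (ZMod n)} (h : Moves (y ++ j :: z) S T)
    (hy : ∀ x ∈ y, x ≠ j ∧ x ≠ j - 1) : j ∉ T := by
  obtain ⟨R, ⟨Q, h1, h2, h3, rfl⟩, h4⟩ := moves_append.1 h
  rw [h4.mem_iff hy, mem_insert, mem_erase]
  rintro (h | h)
  · exact add_one_ne_self j h.symm
  · exact h.1 rfl

theorem Moves.mem_of_append {y z : List (ZMod n)} (h : Moves (y ++ (j - 1) :: z) S T)
    (hy : ∀ x ∈ y, x ≠ j ∧ x ≠ j - 1) : j ∈ T := by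
  obtain ⟨R, ⟨Q, h1, h2, h3, rfl⟩, h4⟩ := moves_append.1 h
  rw [h4.mem_iff hy, sub_add_cancel]
  exact mem_insert_self _ _

/-- The particle configuration `S` as a state. -/
def config (S : Finset (ZMod n)) (k : ℤ) : ℤ := if (k : ZMod n) ∈ S then 0 else 1

theorem per_config : Per n 0 (config S) := fun k => by simp [config]

theorem config_injective : Function.Injective (config : Finset (ZMod n) → ℤ → ℤ) := by
  intro S T h
  ext i
  obtain ⟨k, rfl⟩ := ZMod.intCast_surjective i
  have := congrFun h k
  simp only [config] at this
  split_ifs at this <;> simp_all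

theorem asc_config_iff : Asc (resid i) (config S) ↔ i ∈ S ∧ i + 1 ∉ S := by
  obtain ⟨k, rfl⟩ := ZMod.intCast_surjective i
  rw [per_config.asc_iff (k := k) (mem_resid.2 rfl)]
  simp only [config]
  push_cast
  split_ifs <;> simp_all

theorem config_comp_swapAt (h : i ∈ S) (h' : i + 1 ∉ S) :
    config S ∘ swapAt (resid i) = config (insert (i + 1) (S.erase i)) := by
  funext k
  rw [Function.comp_apply]
  by_cases h1 : k ∈ resid i
  · have h2 : (k : ZMod n) = i := h1
    rw [swapAt_of_mem h1]
    simp only [config]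
    push_cast
    rw [h2, if_neg h', if_neg]
    rw [mem_insert, mem_erase]
    rintro (h3 | h3)
    · exact add_one_ne_self i h3.symm
    · exact h3.1 rfl
  · by_cases h2 : k - 1 ∈ resid i
    · have h3 : (k : ZMod n) = i + 1 := by
        rw [mem_resid] at h2
        push_cast at h2
        exact eq_add_of_sub_eq h2
      have h4 : swapAt (resid i) k = k - 1 := by
        have := (sparse_resid i).swapAt_succ h2
        rwa [sub_add_cancel] at this
      rw [h4]
      simp only [config]
      push_cast
      rw [h3, add_sub_cancel_right, if_pos h, if_pos (mem_insert_self _ _)]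
    · have h3 : (k : ZMod n) ≠ i + 1 := by
        rw [mem_resid] at h2
        push_cast at h2
        exact fun h => h2 (by rw [h]; ring)
      have h4 : (k : ZMod n) ≠ i := h1
      rw [swapAt_of_notMem h1 h2]
      simp only [config, mem_insert, mem_erase, h3, h4, ne_eq, not_false_eq_true, true_and,
        false_or]

theorem run_config_iff {d : ℤ → ℤ} :
    Run resid l (config S) d ↔ ∃ T, Moves l S T ∧ d = config T := by
  induction l generalizing d with
  | nil => simp [Run, Moves]
  | cons i l ih =>
    simp only [Run, Moves, ih]
    constructor
    · rintro ⟨e, ⟨R, h1, rfl⟩, h2, rfl⟩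
      rw [asc_config_iff] at h2
      exact ⟨_, ⟨R, h1, h2.1, h2.2, rfl⟩, config_comp_swapAt h2.1 h2.2⟩
    · rintro ⟨T, ⟨R, h1, h2, h3, rfl⟩, rfl⟩
      exact ⟨_, ⟨R, h1, rfl⟩, asc_config_iff.2 ⟨h2, h3⟩, (config_comp_swapAt h2 h3).symm⟩

theorem Run.isReduced_of_run {c d : ℤ → ℤ} (h : Run resid l c d) : (cox n).IsReduced l := by
  by_contra h1
  have h0 : nilRep (l.map nilGen).prod (Finsupp.single c 1) = Finsupp.single d 1 := by
    rw [nilRep_prod, prod_nilOp_single h]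
  rw [prod_nilGen_eq_zero h1, map_zero, LinearMap.zero_apply] at h0
  exact Finsupp.single_ne_zero.2 one_ne_zero h0.symm

/-- Here `c` need not be monotone, so `Run.exchange` is not available; instead both words act
through the same `A_w`. This makes particle motion a property of the element. -/
theorem Run.of_wordProd_eq {c d : ℤ → ℤ} (h : Run resid l c d) (hl' : (cox n).IsReduced l')
    (e : (cox n).wordProd l = (cox n).wordProd l') : Run resid l' c d := by
  classical
  have h1 : nilRep (l.map nilGen).prod = nilRep (l'.map nilGen).prod := by
    rw [← nilElt_wordProd h.isReduced_of_run, ← nilElt_wordProd hl', e]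
  rw [nilRep_prod, nilRep_prod] at h1
  have h2 := prod_nilOp_single_apply (R := ℤ) (U := resid) l c d
  rw [h1, prod_nilOp_single_apply, if_pos h] at h2
  by_contra h3
  rw [if_neg h3] at h2
  exact zero_ne_one h2

theorem Moves.isReduced (h : Moves l S T) : (cox n).IsReduced l :=
  Run.isReduced_of_run (run_config_iff.2 ⟨T, h, rfl⟩)

theorem Moves.of_wordProd_eq (h : Moves l S T) (hl' : (cox n).IsReduced l')
    (e : (cox n).wordProd l = (cox n).wordProd l') : Moves l' S T := by
  obtain ⟨T', h1, h2⟩ := run_config_iff.1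
    (Run.of_wordProd_eq (run_config_iff.2 ⟨T, h, rfl⟩) hl' e)
  rwa [config_injective h2]

end Particles

/-! ### Alternation in words of `321`-avoiding elements -/

section Alternation

variable {l : List (ZMod n)} {i : ZMod n}

theorem Is321Avoiding.of_infix {p q : List (ZMod n)} (hl : (cox n).IsReduced (p ++ l ++ q))
    (h : Is321Avoiding ((cox n).wordProd (p ++ l ++ q))) : Is321Avoiding ((cox n).wordProd l) := by
  intro l' h1 h2 i hi
  have e : (cox n).wordProd (p ++ l' ++ q) = (cox n).wordProd (p ++ l ++ q) := by
    simp only [CoxeterSystem.wordProd_append, h2]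
  have hl2 : (cox n).IsReduced l := by
    have h3 := hl.take (p ++ l).length
    rw [List.take_left] at h3
    have h4 := h3.drop p.length
    rwa [List.drop_left] at h4
  have hlen : l'.length = l.length := by rw [← h1.eq, h2, hl2.eq]
  refine h (p ++ l' ++ q) ?_ e i ?_
  · rw [CoxeterSystem.IsReduced, e, hl.eq]
    simp [hlen]
  · exact hi.trans ⟨p, q, rfl⟩

theorem not_isReduced_infix_of_commute {p y z : List (ZMod n)}
    (hy : ∀ j ∈ y, i ≠ j + 1 ∧ j ≠ i + 1) :
    ¬ (cox n).IsReduced (p ++ i :: y ++ i :: z) := by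
  intro h
  have h1 := prod_mul_of_commute braidRel_simple hy
  rw [← wordProd_eq] at h1
  have h2 : (cox n).wordProd (p ++ i :: y ++ i :: z) = (cox n).wordProd (p ++ y ++ z) := by
    simp only [CoxeterSystem.wordProd_append, CoxeterSystem.wordProd_cons]
    rw [← h1]
    simp only [mul_assoc, CoxeterSystem.simple_mul_simple_cancel_left]
  have h3 := (cox n).length_wordProd_le (p ++ y ++ z)
  rw [← h2, h.eq] at h3
  simp only [List.length_append, List.length_cons] at h3
  omega

theorem not_is321Avoiding_of_split (hn : n ≠ 2) {δ : ZMod n} (hδ : δ = 1 ∨ δ = -1)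
    {p y₁ y₂ z : List (ZMod n)} (h₁ : ∀ j ∈ y₁, i ≠ j + 1 ∧ j ≠ i + 1)
    (h₂ : ∀ j ∈ y₂, i ≠ j + 1 ∧ j ≠ i + 1)
    (hl : (cox n).IsReduced (p ++ i :: (y₁ ++ (i + δ) :: y₂) ++ i :: z)) :
    ¬ Is321Avoiding ((cox n).wordProd (p ++ i :: (y₁ ++ (i + δ) :: y₂) ++ i :: z)) := by
  intro h
  have e1 := prod_mul_of_commute braidRel_simple h₁
  have e2 := prod_mul_of_commute braidRel_simple h₂
  rw [← wordProd_eq] at e1 e2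
  have e3 : (cox n).wordProd (p ++ i :: (y₁ ++ (i + δ) :: y₂) ++ i :: z) =
      (cox n).wordProd (p ++ y₁ ++ [i, i + δ, i] ++ (y₂ ++ z)) := by
    simp only [CoxeterSystem.wordProd_append, CoxeterSystem.wordProd_cons,
      CoxeterSystem.wordProd_nil, mul_one]
    simp only [mul_assoc]
    rw [← mul_assoc ((cox n).wordProd y₂) _ ((cox n).wordProd z), e2]
    simp only [← mul_assoc]
    rw [mul_assoc ((cox n).wordProd p) _ ((cox n).wordProd y₁), ← e1]
    simp only [← mul_assoc]
  have hlen : ∀ a b c : ZMod n, (p ++ y₁ ++ [a, b, c] ++ (y₂ ++ z)).length =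
      (p ++ i :: (y₁ ++ (i + δ) :: y₂) ++ i :: z).length := by
    intro a b c
    simp only [List.length_append, List.length_cons, List.length_nil]
    omega
  rcases hδ with rfl | rfl
  · exact h _ (by rw [CoxeterSystem.IsReduced, ← e3, hl.eq, hlen]) e3.symm i ⟨_, _, rfl⟩
  -- For `δ = -1` the letters read `i, i - 1, i`, and the braid relation produces the forbidden
  -- pattern starting at `i - 1`.
  · have e4 : (cox n).wordProd (p ++ y₁ ++ [i + -1, i, i + -1] ++ (y₂ ++ z)) =
        (cox n).wordProd (p ++ y₁ ++ [i, i + -1, i] ++ (y₂ ++ z)) := by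
      have := simple_braid hn (i + -1)
      rw [neg_add_cancel_right] at this
      have e5 : (cox n).wordProd [i + -1, i, i + -1] = (cox n).wordProd [i, i + -1, i] := by
        simpa only [CoxeterSystem.wordProd_cons, CoxeterSystem.wordProd_nil, mul_one,
          ← mul_assoc] using this
      simp only [CoxeterSystem.wordProd_append, e5]
    refine h (p ++ y₁ ++ [i + -1, i, i + -1] ++ (y₂ ++ z)) ?_ (e4.trans e3.symm) (i + -1)
      ⟨p ++ y₁, y₂ ++ z, by rw [neg_add_cancel_right]⟩
    rw [CoxeterSystem.IsReduced, e4, ← e3, hl.eq, hlen]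

/-- Two consecutive letters `i` of a reduced word of a `321`-avoiding element are separated by both
neighbours of `i`. -/
theorem Is321Avoiding.alternating (hn : n ≠ 2) {δ : ZMod n} (hδ : δ = 1 ∨ δ = -1)
    {p y z : List (ZMod n)} (hl : (cox n).IsReduced (p ++ i :: y ++ i :: z))
    (h : Is321Avoiding ((cox n).wordProd (p ++ i :: y ++ i :: z))) (hi : i ∉ y) :
    i - δ ∈ y := by
  induction hs : y.length using Nat.strong_induction_on generalizing p i y z with
  | _ s ih =>
    subst hs
    by_contra hiδ
    have hcomm : ∀ y' : List (ZMod n), y' ⊆ y → i + δ ∉ y' → ∀ j ∈ y', i ≠ j + 1 ∧ j ≠ i + 1 := by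
      intro y' h1 h2 j hj
      have h3 : j ≠ i - δ := fun h3 => hiδ (h3 ▸ h1 hj)
      have h4 : j ≠ i + δ := fun h4 => h2 (h4 ▸ hj)
      rcases hδ with rfl | rfl
      · exact ⟨fun h5 => h3 (by rw [h5]; ring), h4⟩
      · refine ⟨fun h5 => h4 (by rw [h5]; ring), fun h5 => h3 (by rw [h5]; ring)⟩
    -- With `i - δ` absent, count the letters `i + δ` between the two `i`: none makes the word
    -- nonreduced, one gives a braid, and two consecutive ones would need an `i` between them by
    -- induction.
    by_cases hj : i + δ ∈ y
    · obtain ⟨y₁, y₂, rfl, hj1⟩ := List.eq_append_cons_of_mem hj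
      by_cases hj2 : i + δ ∈ y₂
      · obtain ⟨y₃, y₄, rfl, hj3⟩ := List.eq_append_cons_of_mem hj2
        have e : p ++ i :: (y₁ ++ (i + δ) :: (y₃ ++ (i + δ) :: y₄)) ++ i :: z =
            (p ++ i :: y₁) ++ (i + δ) :: y₃ ++ (i + δ) :: (y₄ ++ i :: z) := by simp
        rw [e] at hl h
        have := ih y₃.length (by simp; omega) hl h hj3 rfl
        rw [add_sub_cancel_right] at this
        exact hi (by simp [this])
      · refine not_is321Avoiding_of_split hn hδ (hcomm y₁ ?_ hj1) (hcomm y₂ ?_ hj2) hl h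
        · exact fun x hx => List.mem_append_left _ hx
        · exact fun x hx => List.mem_append_right _ (List.mem_cons_of_mem _ hx)
    · exact not_isReduced_infix_of_commute (hcomm y (fun _ h => h) hj) hl

end Alternation

end AffineStanley

namespace AffineStanley

variable {n : ℕ} [NeZero n] [Fact (1 < n)]

/-! ### Letters which are last among neighbours -/

section Lead

variable {l : List (ZMod n)} {i j δ : ZMod n}

/-- The letters `j` such that the last letter of the word among `j - δ` and `j` is `j`. -/
def lead (δ : ZMod n) : List (ZMod n) → Finset (ZMod n)
  | [] => ∅
  | i :: l => if i ∉ l ∧ i - δ ∉ l then insert i (lead δ l) else lead δ l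

theorem mem_of_mem_lead (h : j ∈ lead δ l) : j ∈ l := by
  induction l with
  | nil => simp [lead] at h
  | cons i l ih =>
    rw [lead] at h
    split_ifs at h with h1
    · rcases mem_insert.1 h with rfl | h
      · exact List.mem_cons_self
      · exact List.mem_cons_of_mem _ (ih h)
    · exact List.mem_cons_of_mem _ (ih h)

theorem lead_subset_cons : lead δ l ⊆ lead δ (i :: l) := by
  rw [lead]
  split_ifs
  · exact subset_insert _ _
  · exact Subset.rfl

theorem add_mem_lead (h : i ∉ l) (h' : i + δ ∈ l) : i + δ ∈ lead δ l := by
  induction l with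
  | nil => simp at h'
  | cons k l ih =>
    by_cases h1 : i + δ ∈ l
    · exact lead_subset_cons (ih (fun h2 => h (List.mem_cons_of_mem _ h2)) h1)
    · rcases List.mem_cons.1 h' with rfl | h2
      · have h3 : i + δ - δ ∉ l := by
          rw [add_sub_cancel_right]
          exact fun h2 => h (List.mem_cons_of_mem _ h2)
        rw [lead, if_pos ⟨h1, h3⟩]
        exact mem_insert_self _ _
      · exact absurd h2 h1

theorem lead_nonempty (hl : l ≠ []) : (lead δ l).Nonempty := by
  induction l with
  | nil => exact absurd rfl hl
  | cons i l ih =>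
    rcases l with _ | ⟨k, l⟩
    · exact ⟨i, by simp [lead]⟩
    · exact (ih (by simp)).mono lead_subset_cons

theorem exists_notMem_lead (hδ : δ ≠ 0) (hl : l ≠ []) : ∃ j ∉ lead δ l, j - δ ∈ l := by
  induction l with
  | nil => exact absurd rfl hl
  | cons i l ih =>
    rcases l with _ | ⟨k, l⟩
    · refine ⟨i + δ, ?_, by simp⟩
      simpa [lead] using hδ
    · obtain ⟨j, h1, h2⟩ := ih (by simp)
      refine ⟨j, ?_, List.mem_cons_of_mem _ h2⟩
      rw [lead]
      split_ifs with h3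
      · rw [mem_insert]
        rintro (rfl | h4)
        · exact h3.2 h2
        · exact h1 h4
      · exact h1

theorem lead_ne_univ (hδ : δ ≠ 0) (l : List (ZMod n)) : lead δ l ≠ univ := by
  by_cases hl : l = []
  · rw [hl, lead]
    exact univ_nonempty.ne_empty.symm
  · obtain ⟨j, hj, -⟩ := exists_notMem_lead hδ hl
    exact ne_univ_of_notMem hj

/-- Both memberships concern the last of the letters `j - 1` and `j`, with opposite answers. For
particles: the site `j` cannot be required to be both occupied and empty at the start. -/
theorem sub_one_notMem_lead (h : j ∈ lead 1 l) : j - 1 ∉ lead (-1) l := by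
  induction l with
  | nil => simp [lead] at h
  | cons i l ih =>
    intro h'
    rw [lead] at h h'
    have key : ∀ {P Q : Prop} [Decidable P] {A : Finset (ZMod n)} {x : ZMod n},
        (x ∈ if P then insert i A else A) → x ∈ A ∨ (x = i ∧ P) := by
      intro P Q _ A x hx
      split_ifs at hx with hP
      · rcases mem_insert.1 hx with h1 | h1
        · exact Or.inr ⟨h1, hP⟩
        · exact Or.inl h1
      · exact Or.inl hx
    rcases key (Q := True) h with h1 | ⟨rfl, h1⟩ <;> rcases key (Q := True) h' with h2 | ⟨h2, h3⟩
    · exact ih h1 h2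
    · refine h3.2 ?_
      have : i - -1 = j := by rw [← h2]; ring
      rw [this]
      exact mem_of_mem_lead h1
    · exact h1.2 (mem_of_mem_lead h2)
    · exact sub_one_ne_self j h2

theorem exists_first (p : ZMod n → Prop) (h : ∃ x ∈ l, p x) :
    ∃ y x z, l = y ++ x :: z ∧ p x ∧ ∀ a ∈ y, ¬ p a := by
  induction l with
  | nil => simp at h
  | cons i l ih =>
    by_cases hi : p i
    · exact ⟨[], i, l, rfl, hi, by simp⟩
    · obtain ⟨x, hx, hp⟩ := h
      rcases List.mem_cons.1 hx with rfl | hx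
      · exact absurd hp hi
      · obtain ⟨y, x, z, rfl, h1, h2⟩ := ih ⟨x, hx, hp⟩
        refine ⟨i :: y, x, z, rfl, h1, fun a ha => ?_⟩
        rcases List.mem_cons.1 ha with rfl | ha
        · exact hi
        · exact h2 a ha

/-- The letters in `lead 1 l` and `lead (-1) l` record the sites whose first event is a departure or
an arrival. Once the initial occupation agrees with these, `Is321Avoiding.alternating` makes
departures and arrivals alternate at every site, so no move is blocked. -/
theorem exists_moves (hn : n ≠ 2) (hl : (cox n).IsReduced l)
    (h : Is321Avoiding ((cox n).wordProd l)) {S : Finset (ZMod n)} (h1 : lead 1 l ⊆ S)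
    (h2 : ∀ j ∈ lead (-1) l, j + 1 ∉ S) : ∃ T, Moves l S T := by
  induction l with
  | nil => exact ⟨S, rfl⟩
  | cons i l ih =>
    have hl' : (cox n).IsReduced l := hl.drop 1
    have h' : Is321Avoiding ((cox n).wordProd l) :=
      Is321Avoiding.of_infix (p := [i]) (q := []) (by simpa using hl) (by simpa using h)
    obtain ⟨T, hT⟩ := ih hl' h' (lead_subset_cons.trans h1) fun j hj => h2 j (lead_subset_cons hj)
    refine ⟨_, T, hT, ?_, ?_, rfl⟩
    · by_cases hx : ∃ x ∈ l, x = i ∨ x = i - 1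
      · obtain ⟨y, x, z, rfl, h3, h4⟩ := exists_first _ hx
        push Not at h4
        rcases h3 with rfl | rfl
        · exact absurd (Is321Avoiding.alternating hn (Or.inl rfl) (p := []) hl h
            fun h5 => (h4 x h5).1 rfl) fun h5 => (h4 _ h5).2 rfl
        · exact hT.mem_of_append h4
      · push Not at hx
        rw [hT.mem_iff hx]
        refine h1 ?_
        rw [lead, if_pos ⟨fun h5 => (hx i h5).1 rfl, fun h5 => (hx _ h5).2 rfl⟩]
        exact mem_insert_self _ _
    · by_cases hx : ∃ x ∈ l, x = i + 1 ∨ x = i + 1 - 1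
      · obtain ⟨y, x, z, rfl, h3, h4⟩ := exists_first _ hx
        push Not at h4
        rcases h3 with rfl | h3
        · exact hT.notMem_of_append h4
        · rw [add_sub_cancel_right] at h3
          subst h3
          refine absurd (Is321Avoiding.alternating hn (Or.inr rfl) (p := []) hl h
            fun h5 => (h4 x h5).2 (by ring)) fun h5 => (h4 _ h5).1 (by ring)
      · push Not at hx
        rw [hT.mem_iff hx]
        refine h2 i ?_
        rw [lead, if_pos ⟨fun h5 => (hx i h5).2 (by ring), fun h5 => (hx _ h5).1 (by ring)⟩]
        exact mem_insert_self _ _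

/-- The letters of `lead δ l` can be commuted to the right end, where they form a cyclically
increasing (`δ = 1`) or decreasing (`δ = -1`) factor; the abstract `U` treats both. The count of
letters is what lets the induction see which letters remain in `v`. -/
theorem exists_eq_mul_lead (hn : n ≠ 2) (hδ : δ = 1 ∨ δ = -1)
    {U : Finset (ZMod n) → AffineSym n} (h0 : U ∅ = 1)
    (hU : ∀ i J, i ∉ J → i - δ ∉ J → U (insert i J) = (cox n).simple i * U J)
    (hl : (cox n).IsReduced l) (h : Is321Avoiding ((cox n).wordProd l)) :
    ∃ v : List (ZMod n), (cox n).wordProd l = (cox n).wordProd v * U (lead δ l) ∧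
      v.length + (lead δ l).card = l.length ∧
      ∀ j, v.count j + (if j ∈ lead δ l then 1 else 0) = l.count j := by
  induction l with
  | nil => exact ⟨[], by simp [lead, h0], by simp [lead], by simp [lead]⟩
  | cons i l ih =>
    have hl' : (cox n).IsReduced l := hl.drop 1
    have h' : Is321Avoiding ((cox n).wordProd l) :=
      Is321Avoiding.of_infix (p := [i]) (q := []) (by simpa using hl) (by simpa using h)
    obtain ⟨v, h1, h2, h3⟩ := ih hl' h'
    rw [lead]
    split_ifs with hi
    · have hi1 : i ∉ lead δ l := fun h4 => hi.1 (mem_of_mem_lead h4)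
      have hi2 : i - δ ∉ lead δ l := fun h4 => hi.2 (mem_of_mem_lead h4)
      have hv : ∀ j ∈ v, j ∈ l := by
        intro j hj
        have h4 := h3 j
        have h5 := List.count_pos_iff.2 hj
        exact List.count_pos_iff.1 (by omega)
      have hv1 : i ∉ v := fun h4 => hi.1 (hv _ h4)
      have hv2 : i - δ ∉ v := fun h4 => hi.2 (hv _ h4)
      -- One occurrence of `i + δ` has gone into the factor. A remaining one would mean two in `l`,
      -- and alternation would put an `i` between them, although `i` does not occur in `l`.
      have hv3 : i + δ ∉ v := by
        intro h4
        have h5 := hv _ h4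
        have h6 := h3 (i + δ)
        rw [if_pos (add_mem_lead hi.1 h5)] at h6
        have h7 := List.count_pos_iff.2 h4
        obtain ⟨a, b, hab, ha⟩ := List.eq_append_cons_of_mem h5
        rw [hab, List.count_append, List.count_cons_self, List.count_eq_zero_of_not_mem ha] at h6
        obtain ⟨b₁, b₂, rfl, hb⟩ := List.eq_append_cons_of_mem
          (List.count_pos_iff.1 (show 0 < b.count (i + δ) by omega))
        have h8 := Is321Avoiding.alternating hn hδ (p := a) (z := b₂) (i := i + δ) (y := b₁)
          (by rw [hab] at hl'; simpa using hl') (by rw [hab] at h'; simpa using h') hb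
        rw [add_sub_cancel_right] at h8
        exact hi.1 (by rw [hab]; simp [h8])
      have hc := prod_mul_of_commute (i := i) (l := v) braidRel_simple (by
        intro j hj
        have e1 : j ≠ i - δ := fun h4 => hv2 (h4 ▸ hj)
        have e2 : j ≠ i + δ := fun h4 => hv3 (h4 ▸ hj)
        rcases hδ with rfl | rfl
        · exact ⟨fun h5 => e1 (by rw [h5]; ring), e2⟩
        · exact ⟨fun h5 => e2 (by rw [h5]; ring), fun h5 => e1 (by rw [h5]; ring)⟩)
      rw [← wordProd_eq] at hc
      refine ⟨v, ?_, ?_, fun j => ?_⟩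
      · rw [CoxeterSystem.wordProd_cons, h1, hU i _ hi1 hi2, ← mul_assoc, ← mul_assoc, hc]
      · rw [card_insert_of_notMem hi1, List.length_cons]
        omega
      · rw [List.count_cons, ← h3 j]
        by_cases hj : j = i
        · subst hj
          simp [hi1]
        · simp [hj, Ne.symm hj]
    · refine ⟨i :: v, ?_, ?_, fun j => ?_⟩
      · rw [CoxeterSystem.wordProd_cons, CoxeterSystem.wordProd_cons, h1, mul_assoc]
      · rw [List.length_cons, List.length_cons]
        omega
      · rw [List.count_cons, List.count_cons, ← h3 j]
        omega

theorem cycInc_empty : cycInc (∅ : Finset (ZMod n)) = 1 := by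
  rw [cycInc_eq_inv univ_nonempty.ne_empty.symm, cycDec_empty, inv_one]

theorem card_le_maxc {w v : AffineSym n} {J : Finset (ZMod n)} (hJ : J ≠ univ)
    (h : w = v * cycInc J)
    (hl : (cox n).length w = (cox n).length v + (cox n).length (cycInc J)) : J.card ≤ maxc w := by
  classical
  exact le_sup (f := card) (mem_filter.2 ⟨mem_univ _, hJ, v, h, hl⟩)

theorem card_le_maxr {w v : AffineSym n} {J : Finset (ZMod n)} (hJ : J ≠ univ)
    (h : w = v * cycDec J)
    (hl : (cox n).length w = (cox n).length v + (cox n).length (cycDec J)) : J.card ≤ maxr w := by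
  classical
  exact le_sup (f := card) (mem_filter.2 ⟨mem_univ _, hJ, v, h, hl⟩)

theorem one_ne_zero_zmod : (1 : ZMod n) ≠ 0 := by
  have := add_one_ne_self (0 : ZMod n)
  rwa [zero_add] at this

theorem card_lead_le_maxc (hn : n ≠ 2) (hl : (cox n).IsReduced l)
    (h : Is321Avoiding ((cox n).wordProd l)) :
    (lead 1 l).card ≤ maxc ((cox n).wordProd l) := by
  have hJ := lead_ne_univ one_ne_zero_zmod l
  obtain ⟨v, h1, h2, -⟩ := exists_eq_mul_lead hn (Or.inl rfl) cycInc_empty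
    (fun i J h h' => cycInc_insert_left h h') hl h
  refine card_le_maxc hJ h1 (le_antisymm ?_ ?_)
  · conv_lhs => rw [h1]
    exact (cox n).length_mul_le _ _
  · rw [length_cycInc hJ, hl.eq, ← h2]
    exact Nat.add_le_add_right ((cox n).length_wordProd_le v) _

theorem card_lead_le_maxr (hn : n ≠ 2) (hl : (cox n).IsReduced l)
    (h : Is321Avoiding ((cox n).wordProd l)) :
    (lead (-1) l).card ≤ maxr ((cox n).wordProd l) := by
  have hJ := lead_ne_univ (neg_ne_zero.2 one_ne_zero_zmod) l
  obtain ⟨v, h1, h2, -⟩ := exists_eq_mul_lead hn (Or.inr rfl) cycDec_empty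
    (fun i J h h' => cycDec_insert_left h (by rwa [sub_neg_eq_add] at h')) hl h
  refine card_le_maxr hJ h1 (le_antisymm ?_ ?_)
  · conv_lhs => rw [h1]
    exact (cox n).length_mul_le _ _
  · rw [length_cycDec hJ, hl.eq, ← h2]
    exact Nat.add_le_add_right ((cox n).length_wordProd_le v) _

end Lead

end AffineStanley

/-! ### Particle description of `A_{(n-m,m)}`, and extension to Grassmannian elements. -/

namespace AffineStanley

variable {n : ℕ} [NeZero n] [Fact (1 < n)]

/-! ### The elements acting on particle configurations -/

section SetA

variable {l : List (ZMod n)} {S T : Finset (ZMod n)} {m : ℕ}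

/-- After the first two moves the particle is at `i + 2` and the site `i` is empty, unless `i + 2 =
i`. -/
theorem not_moves_braid (hn : n ≠ 2) (i : ZMod n) : ¬ Moves [i, i + 1, i] S T := by
  rintro ⟨R₂, ⟨R₁, ⟨R₀, rfl, h1, h2, rfl⟩, h3, h4, rfl⟩, h5, -, -⟩
  simp only [mem_insert, mem_erase] at h5
  rcases h5 with h5 | ⟨-, h5 | h5⟩
  · refine two_ne_zero_zmod hn ?_
    linear_combination -h5
  · exact add_one_ne_self i h5.symm
  · exact h5.1 rfl

/-- The letters acting before `j` are neither `j` nor `j + 1`, so the site `j + 1`, empty when `j`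
acts, was empty from the start. Hence a cyclically decreasing factor has at most as many letters as
there are holes; dually, an increasing one is bounded by the number of particles. -/
theorem Moves.add_one_notMem (h : Moves l S T) (hl : IsCycDecWord l) {j : ZMod n} (hj : j ∈ l) :
    j + 1 ∉ S := by
  obtain ⟨y, z, rfl⟩ := List.append_of_mem hj
  obtain ⟨R, ⟨Q, h1, h2, h3, rfl⟩, -⟩ := moves_append.1 h
  have hz := hl.sublist (List.sublist_append_right y (j :: z))
  rwa [h1.mem_iff] at h3
  intro x hx
  refine ⟨(List.pairwise_cons.1 hz.2).1 x hx, ?_⟩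
  rw [add_sub_cancel_right]
  rintro rfl
  exact (List.nodup_cons.1 hz.1).1 hx

theorem Moves.mem_of_cycInc (h : Moves l S T) (hl : IsCycIncWord l) {j : ZMod n} (hj : j ∈ l) :
    j ∈ S := by
  obtain ⟨y, z, rfl⟩ := List.append_of_mem hj
  obtain ⟨R, ⟨Q, h1, h2, h3, rfl⟩, -⟩ := moves_append.1 h
  have hz := List.sublist_append_right y (j :: z)
  rwa [h1.mem_iff] at h2
  intro x hx
  refine ⟨?_, fun h4 => (List.pairwise_cons.1 (hl.2.sublist hz)).1 x hx (by rw [h4]; ring)⟩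
  rintro rfl
  exact (List.nodup_cons.1 (hl.1.sublist hz)).1 hx

theorem Moves.exists_factor (h : Moves l S T) {p q r : AffineSym n}
    (e : (cox n).wordProd l = p * q * r)
    (hl : (cox n).length (p * q * r) = (cox n).length p + (cox n).length q + (cox n).length r)
    {l' : List (ZMod n)} (hl' : (cox n).IsReduced l') (e' : (cox n).wordProd l' = q) :
    ∃ S' T', S'.card = S.card ∧ Moves l' S' T' := by
  obtain ⟨lp, h1, rfl⟩ := (cox n).exists_isReduced p
  obtain ⟨lr, h2, rfl⟩ := (cox n).exists_isReduced r
  subst e'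
  rw [← CoxeterSystem.wordProd_append, ← CoxeterSystem.wordProd_append] at e hl
  obtain ⟨R, h3, h4⟩ := moves_append.1 (h.of_wordProd_eq (l' := lp ++ l' ++ lr) (by
    rw [CoxeterSystem.IsReduced, hl, h1.eq, h2.eq, hl'.eq, List.length_append,
      List.length_append]) e)
  obtain ⟨Q, h5, -⟩ := moves_append.1 h4
  exact ⟨R, Q, h3.card_eq, h5⟩

theorem Moves.card_le_of_cycDec (h : Moves l S T) {p r : AffineSym n} {J : Finset (ZMod n)}
    (hJ : J ≠ univ) (e : (cox n).wordProd l = p * cycDec J * r)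
    (hl : (cox n).length (p * cycDec J * r) =
      (cox n).length p + (cox n).length (cycDec J) + (cox n).length r) :
    J.card ≤ n - S.card := by
  obtain ⟨l', h1, rfl⟩ := exists_cycDecWord J hJ
  obtain ⟨S', T', h2, h3⟩ := h.exists_factor e hl (h1.isReduced hJ) (cycDec_eq h1 hJ).symm
  rw [← h2]
  have h4 : (l'.toFinset.map ⟨(· + 1), add_left_injective 1⟩) ⊆ S'ᶜ := by
    intro x hx
    obtain ⟨j, hj, rfl⟩ := mem_map.1 hx
    exact mem_compl.2 (h3.add_one_notMem h1 (List.mem_toFinset.1 hj))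
  have h5 := card_le_card h4
  rwa [card_map, card_compl, ZMod.card] at h5

theorem Moves.card_le_of_cycInc (h : Moves l S T) {p r : AffineSym n} {J : Finset (ZMod n)}
    (hJ : J ≠ univ) (e : (cox n).wordProd l = p * cycInc J * r)
    (hl : (cox n).length (p * cycInc J * r) =
      (cox n).length p + (cox n).length (cycInc J) + (cox n).length r) :
    J.card ≤ S.card := by
  obtain ⟨l', h1, rfl⟩ := exists_cycDecWord J hJ
  have h0 : (cox n).wordProd l'.reverse = cycInc l'.toFinset := by
    rw [CoxeterSystem.wordProd_reverse, cycInc_eq_inv hJ, cycDec_eq h1 hJ]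
  have h1' : IsCycIncWord l'.reverse :=
    ⟨List.nodup_reverse.2 h1.1, List.pairwise_reverse.2 h1.2⟩
  obtain ⟨S', T', h2, h3⟩ := h.exists_factor e hl (by
    rw [CoxeterSystem.isReduced_reverse_iff]
    exact h1.isReduced hJ) h0
  rw [← h2]
  exact card_le_card fun j hj => h3.mem_of_cycInc h1' (by simpa using hj)

theorem Moves.mem_setA (hn : n ≠ 2) (h : Moves l S T) :
    (cox n).wordProd l ∈ setA S.card n := by
  classical
  refine ⟨fun l' h1 h2 i h3 => ?_, ?_, ?_⟩
  · obtain ⟨p, q, rfl⟩ := h3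
    rw [List.append_assoc] at h1 h2
    obtain ⟨R, h6, -⟩ := moves_append.1 (h.of_wordProd_eq h1 h2.symm)
    obtain ⟨Q, -, h7⟩ := moves_append.1 h6
    exact not_moves_braid hn i h7
  · refine Finset.sup_le fun J hJ => ?_
    obtain ⟨-, hJ, v, h1, h2⟩ := mem_filter.1 hJ
    refine h.card_le_of_cycInc hJ (p := v) (r := 1) (by rw [mul_one, h1]) ?_
    rw [mul_one, ← h1, h2, CoxeterSystem.length_one, add_zero]
  · refine Finset.sup_le fun J hJ => ?_
    obtain ⟨-, hJ, v, h1, h2⟩ := mem_filter.1 hJ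
    refine h.card_le_of_cycDec hJ (p := v) (r := 1) (by rw [mul_one, h1]) ?_
    rw [mul_one, ← h1, h2, CoxeterSystem.length_one, add_zero]

/-- At most `maxc ≤ m` sites must be occupied and at most `maxr ≤ n - m` must be empty, and the two
sets are disjoint; so exactly `m` particles can be placed. -/
theorem exists_moves_of_mem_setA (hn : n ≠ 2) (hmn : m ≤ n) (hl : (cox n).IsReduced l)
    (h : (cox n).wordProd l ∈ setA m n) : ∃ S T, S.card = m ∧ Moves l S T := by
  classical
  have h1 := (card_lead_le_maxc hn hl h.1).trans h.2.1
  have h2 := (card_lead_le_maxr hn hl h.1).trans h.2.2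
  have h3 : lead 1 l ⊆ ((lead (-1) l).map ⟨(· + 1), add_left_injective 1⟩)ᶜ := by
    intro j hj
    rw [mem_compl, mem_map]
    rintro ⟨k, hk, rfl⟩
    refine sub_one_notMem_lead hj ?_
    rwa [Function.Embedding.coeFn_mk, add_sub_cancel_right]
  obtain ⟨S, h4, h5, h6⟩ := exists_subsuperset_card_eq h3 h1 (by
    rw [card_compl, card_map, ZMod.card]
    omega)
  obtain ⟨T, hT⟩ := exists_moves hn hl h.1 h4 fun j hj hj' =>
    mem_compl.1 (h5 hj') (mem_map.2 ⟨j, hj, rfl⟩)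
  exact ⟨S, T, h6, hT⟩

theorem Is321Avoiding.exists_mem_setA (hn : n ≠ 2) {w : AffineSym n} (h : Is321Avoiding w) :
    ∃ m, 0 < m ∧ m < n ∧ w ∈ setA m n := by
  obtain ⟨l, hl, rfl⟩ := (cox n).exists_isReduced w
  by_cases hl0 : l = []
  · have : Moves l {0} {0} := by
      rw [hl0]
      rfl
    exact ⟨1, one_pos, Fact.out, by simpa using this.mem_setA hn⟩
  · obtain ⟨T, hT⟩ := exists_moves hn hl h (S := lead 1 l) Subset.rfl fun j hj hj' =>
      sub_one_notMem_lead hj' (by rwa [add_sub_cancel_right])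
    obtain ⟨j, hj, -⟩ := exists_notMem_lead one_ne_zero_zmod hl0
    refine ⟨_, (lead_nonempty hl0).card_pos, ?_, hT.mem_setA hn⟩
    have := card_lt_univ_of_notMem hj
    rwa [ZMod.card] at this

/-- The right factor acts first, on the same number of particles. -/
theorem mem_setA_of_mul (hn : n ≠ 2) (hmn : m ≤ n) {x u : AffineSym n} (h : x * u ∈ setA m n)
    (hl : (cox n).length (x * u) = (cox n).length x + (cox n).length u) : u ∈ setA m n := by
  obtain ⟨l, h1, rfl⟩ := (cox n).exists_isReduced x
  obtain ⟨l', h2, rfl⟩ := (cox n).exists_isReduced u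
  rw [← CoxeterSystem.wordProd_append] at h hl
  obtain ⟨S, T, rfl, h3⟩ := exists_moves_of_mem_setA hn hmn (by
    rw [CoxeterSystem.IsReduced, hl, h1.eq, h2.eq, List.length_append]) h
  obtain ⟨R, h4, -⟩ := moves_append.1 h3
  exact h4.mem_setA hn

/-! ### Extension to Grassmannian elements -/

variable (n) in
/-- The configuration of `m` consecutive particles at the sites `-(m - 1), …, 0`. -/
def packed (m : ℕ) : Finset (ZMod n) :=
  (range m).image fun t : ℕ => (t : ZMod n) - ((m : ZMod n) - 1)

theorem natCast_inj_of_lt {a b : ℕ} (ha : a < n) (hb : b < n) (h : (a : ZMod n) = b) : a = b := by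
  have h' := (ZMod.natCast_eq_natCast_iff' a b n).1 h
  rwa [Nat.mod_eq_of_lt ha, Nat.mod_eq_of_lt hb] at h'

theorem card_packed (hmn : m ≤ n) : (packed n m).card = m := by
  rw [packed, card_image_of_injOn, card_range]
  intro a ha b hb h
  simp only [coe_range, Set.mem_Iio] at ha hb
  exact natCast_inj_of_lt (n := n) (by omega) (by omega) (by simpa using h)

theorem eq_zero_of_mem_packed {j : ZMod n} (h : j ∈ packed n m) (h' : j + 1 ∉ packed n m) :
    j = 0 := by
  obtain ⟨t, h1, rfl⟩ := mem_image.1 h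
  rw [mem_range] at h1
  by_cases h2 : t + 1 < m
  · refine absurd (mem_image.2 ⟨t + 1, mem_range.2 h2, ?_⟩) h'
    push_cast
    ring
  · obtain rfl : m = t + 1 := by omega
    push_cast
    ring

theorem exists_moves_packed (hmn : m ≤ n) (hS : S.card = m) : ∃ l, Moves l (packed n m) S := by
  -- Coordinates on the cycle in which the packed configuration occupies `0, …, m - 1`; the sum of
  -- coordinates is the induction measure.
  set s : ZMod n → ℕ := fun r => (r + ((m : ZMod n) - 1)).val with hs
  set p : ℕ → ZMod n := fun t => (t : ZMod n) - ((m : ZMod n) - 1) with hp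
  have hps : ∀ r, p (s r) = r := fun r => by simp [hp, hs]
  have hsp : ∀ t < n, s (p t) = t := fun t ht => by
    simp only [hp, hs, sub_add_cancel]
    exact ZMod.val_cast_of_lt ht
  have hmem : ∀ r, s r < m ↔ r ∈ packed n m := fun r => by
    constructor
    · exact fun h => mem_image.2 ⟨s r, mem_range.2 h, hps r⟩
    · intro h
      obtain ⟨t, h1, rfl⟩ := mem_image.1 h
      rw [mem_range] at h1
      have := hsp t (by omega)
      simp only [hp] at this
      rwa [this]
  induction ht : ∑ r ∈ S, s r using Nat.strong_induction_on generalizing S with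
  | _ t ih =>
    by_cases h0 : S = packed n m
    · exact ⟨[], h0⟩
    have h1 : ¬ S ⊆ packed n m := fun h =>
      h0 (eq_of_subset_of_card_le h (by rw [card_packed hmn, hS]))
    have h2 : ¬ packed n m ⊆ S := fun h =>
      h0 (eq_of_subset_of_card_le h (by rw [card_packed hmn, hS])).symm
    obtain ⟨b, hb, hb'⟩ := not_subset.1 h1
    obtain ⟨a, ha, ha'⟩ := not_subset.1 h2
    rw [← hmem] at hb' ha
    -- The first particle beyond the hole `a` has an empty site just behind it, so its last hop can
    -- be undone without crossing the cut of the coordinates.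
    have hex : ∃ q, s a < q ∧ p q ∈ S := ⟨s b, by omega, by rwa [hps]⟩
    classical
    have hq1 := Nat.find_spec hex
    have hq2 := Nat.find_min' hex (m := s b) ⟨by omega, by rwa [hps]⟩
    have hq3 := fun q => Nat.find_min hex (m := q)
    set q := Nat.find hex with hq
    have hbn : s b < n := ZMod.val_lt _
    have h3 : p (q - 1) ∉ S := by
      intro h3
      by_cases h4 : s a < q - 1
      · exact hq3 (q - 1) (by omega) ⟨h4, h3⟩
      · have : q - 1 = s a := by omega
        rw [this, hps] at h3
        exact ha' h3
    have h4 : p (q - 1) + 1 = p q := by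
      have : ((q - 1 : ℕ) : ZMod n) + 1 = q := by
        have : ((q - 1 + 1 : ℕ) : ZMod n) = (q : ℕ) := by congr 1; omega
        rwa [Nat.cast_add, Nat.cast_one] at this
      simp only [hp]
      rw [← this]
      ring
    have h5 : p (q - 1) ∉ S.erase (p q) := fun h => h3 (mem_of_mem_erase h)
    have h6 : p q ≠ p (q - 1) := fun h => h3 (h ▸ hq1.2)
    obtain ⟨l, hl⟩ := ih (∑ r ∈ insert (p (q - 1)) (S.erase (p q)), s r) (by
      rw [← ht, sum_insert h5, ← add_sum_erase S s hq1.2, hsp q (by omega),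
        hsp (q - 1) (by omega)]
      omega) (S := insert (p (q - 1)) (S.erase (p q))) (by
      rw [card_insert_of_notMem h5, card_erase_of_mem hq1.2, ← hS]
      exact Nat.sub_add_cancel (card_pos.2 ⟨_, hq1.2⟩)) rfl
    refine ⟨p (q - 1) :: l, _, hl, mem_insert_self _ _, ?_, ?_⟩
    · rw [h4, mem_insert, not_or]
      exact ⟨h6, fun h => (mem_erase.1 h).1 rfl⟩
    · rw [h4, erase_insert h5, insert_erase hq1.2]

/-- Bring `m` particles from the packed configuration to one on which `w` acts. From the packed
configuration the only possible first hop is at `0`, so every reduced word of the product ends in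
`s_0`. -/
theorem exists_mul_grassmannian (hn : n ≠ 2) (hmn : m ≤ n) {w : AffineSym n}
    (h : w ∈ setA m n) : ∃ y, IsZeroGrassmannian (w * y) ∧
      (cox n).length (w * y) = (cox n).length w + (cox n).length y ∧ w * y ∈ setA m n := by
  obtain ⟨l, hl, rfl⟩ := (cox n).exists_isReduced w
  obtain ⟨S, T, hS, hT⟩ := exists_moves_of_mem_setA hn hmn hl h
  obtain ⟨L, hL⟩ := exists_moves_packed hmn hS
  have h1 : Moves (l ++ L) (packed n m) T := moves_append.2 ⟨S, hL, hT⟩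
  have h2 := h1.mem_setA hn
  rw [card_packed hmn] at h2
  refine ⟨(cox n).wordProd L, ?_, ?_, ?_⟩
  · rw [← CoxeterSystem.wordProd_append]
    intro i hi
    obtain ⟨v, h3, h4⟩ := (isRightDescent_iff _ i).1 hi
    obtain ⟨lv, h5, rfl⟩ := (cox n).exists_isReduced v
    rw [← CoxeterSystem.wordProd_concat] at h3
    have h6 := h1.of_wordProd_eq (l' := lv.concat i) (by
      rw [CoxeterSystem.IsReduced, ← h3, h4, h5.eq, List.length_concat]) h3
    rw [List.concat_eq_append] at h6
    obtain ⟨R, ⟨Q, rfl, h7, h8, -⟩, -⟩ := moves_append.1 h6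
    exact eq_zero_of_mem_packed h7 h8
  · rw [← CoxeterSystem.wordProd_append, h1.isReduced.eq, hl.eq, hL.isReduced.eq,
      List.length_append]
  · rwa [← CoxeterSystem.wordProd_append]

theorem mem_setA_of_coef_kSchur (hn : n ≠ 2) (hmn : m ≤ n) {w : AffineSym n} {u : Grass n}
    (hw : w ∈ setA m n) (h : coef w (noncommLin n (kSchur u)) ≠ 0) : u.1 ∈ setA m n := by
  obtain ⟨y, h1, h2, h3⟩ := exists_mul_grassmannian hn hmn hw
  obtain ⟨x, h4, h5⟩ := exists_right_factor_of_coef_kSchur h1 h2 h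
  rw [h4] at h3 h5
  exact mem_setA_of_mul hn hmn h3 h5

end SetA

/-! ### The case `n = 2` -/

section Two

/-- Reduced words alternate between the two letters, so any three consecutive letters form the
forbidden pattern. -/
theorem is321Avoiding_iff_of_eq_two (hn : n = 2) (w : AffineSym n) :
    Is321Avoiding w ↔ (cox n).length w ≤ 2 := by
  constructor
  · intro h
    by_contra h1
    obtain ⟨l, hl, rfl⟩ := (cox n).exists_isReduced w
    rw [hl.eq] at h1
    rcases l with _ | ⟨a, _ | ⟨b, _ | ⟨c, l⟩⟩⟩
    · simp at h1
    · simp at h1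
    · simp at h1
    · have h2 : a ≠ b := by
        rintro rfl
        refine not_isReduced_infix_of_commute (i := a) (p := []) (y := []) (z := c :: l) ?_ hl
        simp
      have h3 : b ≠ c := by
        rintro rfl
        refine not_isReduced_infix_of_commute (i := b) (p := []) (y := []) (z := l) ?_ (hl.drop 1)
        simp
      have h4 : ∀ x y : ZMod n, x ≠ y → y = x + 1 := by
        subst hn
        decide
      obtain rfl := h4 a b h2
      obtain rfl := h4 _ c h3
      have h5 : a + 1 + 1 = a := (h4 (a + 1) a h2.symm).symm
      exact h _ hl rfl a ⟨[], l, by rw [h5]; rfl⟩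
  · intro h l hl e i hi
    have := hi.length_le
    rw [← hl.eq, e] at this
    simp at this
    omega

end Two

section Vanishing

variable {m : ℕ}

theorem is321Avoiding_of_coef_kSchur {w : AffineSym n} {u : Grass n} (hw : Is321Avoiding w)
    (h : coef w (noncommLin n (kSchur u)) ≠ 0) : Is321Avoiding u.1 := by
  by_cases hn : n = 2
  · rw [is321Avoiding_iff_of_eq_two hn] at hw ⊢
    rwa [← length_of_coef_kSchur h]
  · obtain ⟨m, -, h2, h3⟩ := hw.exists_mem_setA hn
    exact (mem_setA_of_coef_kSchur hn h2.le h3 h).1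

theorem card_lt_of_ne_univ {J : Finset (ZMod n)} (hJ : J ≠ univ) : J.card < n := by
  have := card_lt_card (ssubset_univ_iff.2 hJ)
  rwa [card_univ, ZMod.card] at this

theorem maxc_lt (w : AffineSym n) : maxc w < n := by
  classical
  refine (Finset.sup_lt_iff (Nat.pos_of_ne_zero (NeZero.ne n))).2 fun J hJ => ?_
  exact card_lt_of_ne_univ (mem_filter.1 hJ).2.1

theorem maxr_lt (w : AffineSym n) : maxr w < n := by
  classical
  refine (Finset.sup_lt_iff (Nat.pos_of_ne_zero (NeZero.ne n))).2 fun J hJ => ?_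
  exact card_lt_of_ne_univ (mem_filter.1 hJ).2.1

theorem mem_setA_of_coef_kSchur_ne_zero (hm : 0 < m) (hmn : m < n) {w : AffineSym n} {u : Grass n}
    (hw : w ∈ setA m n) (h : coef w (noncommLin n (kSchur u)) ≠ 0) : u.1 ∈ setA m n := by
  by_cases hn : n = 2
  · have h1 := maxc_lt u.1
    have h2 := maxr_lt u.1
    exact ⟨is321Avoiding_of_coef_kSchur hw.1 h, by omega, by omega⟩
  · exact mem_setA_of_coef_kSchur hn hmn.le hw h

end Vanishing

end AffineStanley

/-! ### The quotient algebra and the basis of its subalgebra. -/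

namespace AffineStanley

variable {n : ℕ} [NeZero n] [Fact (1 < n)] {m : ℕ}

/-! ### The kernel of the projection -/

section Kernel

/-- The congruence of the elements which cannot be distinguished, in any context, by the
coefficients at the elements of `A_{(n-m,m)}`. -/
def coefCon (m n : ℕ) [NeZero n] [Fact (1 < n)] : RingCon (NilCoxeter n) where
  r a b := ∀ x y, ∀ w ∈ setA m n, coef w (x * a * y) = coef w (x * b * y)
  iseqv :=
    ⟨fun _ _ _ _ _ => rfl, fun h x y w hw => (h x y w hw).symm,
      fun h h' x y w hw => (h x y w hw).trans (h' x y w hw)⟩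
  mul' {a b c d} h h' x y w hw := by
    have h1 := h x (c * y) w hw
    have h2 := h' (x * b) y w hw
    simp only [← mul_assoc] at h1 h2 ⊢
    exact h1.trans h2
  add' {a b c d} h h' x y w hw := by
    simp only [mul_add, add_mul, map_add, h x y w hw, h' x y w hw]

theorem coef_mul_mul_ne_zero {w : AffineSym n} {a b c : NilCoxeter n}
    (h : coef w (a * b * c) ≠ 0) : ∃ p q r, w = p * q * r ∧ (cox n).length (p * q * r) =
      (cox n).length p + (cox n).length q + (cox n).length r ∧ coef q b ≠ 0 := by
  obtain ⟨t, r, rfl, h1, h2, -⟩ := coef_mul_ne_zero h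
  obtain ⟨p, q, rfl, h3, -, h4⟩ := coef_mul_ne_zero h2
  exact ⟨p, q, r, rfl, by rw [h1, h3], h4⟩

theorem coef_prod_nilGen_ne_zero {w : AffineSym n} {l : List (ZMod n)}
    (h : coef w (l.map nilGen).prod ≠ 0) :
    (cox n).IsReduced l ∧ (cox n).wordProd l = w := by
  classical
  by_cases hl : (cox n).IsReduced l
  · refine ⟨hl, ?_⟩
    rw [← nilElt_wordProd hl, coef_nilElt] at h
    by_contra h1
    exact h (if_neg h1)
  · rw [prod_nilGen_eq_zero hl, map_zero] at h
    exact absurd rfl h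

theorem coef_braid_eq_zero {w : AffineSym n} (hw : Is321Avoiding w) (i : ZMod n)
    (x y : NilCoxeter n) :
    coef w (x * (nilGen i * nilGen (i + 1) * nilGen i) * y) = 0 := by
  by_contra h
  obtain ⟨p, q, r, rfl, h1, h2⟩ := coef_mul_mul_ne_zero h
  have e : nilGen i * nilGen (i + 1) * nilGen i = ([i, i + 1, i].map (nilGen (n := n))).prod := by
    simp [mul_assoc]
  rw [e] at h2
  obtain ⟨h3, rfl⟩ := coef_prod_nilGen_ne_zero h2
  obtain ⟨lp, h4, rfl⟩ := (cox n).exists_isReduced p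
  obtain ⟨lr, h5, rfl⟩ := (cox n).exists_isReduced r
  refine hw (lp ++ [i, i + 1, i] ++ lr) ?_ ?_ i ⟨lp, lr, rfl⟩
  · rw [CoxeterSystem.IsReduced, CoxeterSystem.wordProd_append, CoxeterSystem.wordProd_append, h1,
      h3.eq, h4.eq, h5.eq, List.length_append, List.length_append]
  · rw [CoxeterSystem.wordProd_append, CoxeterSystem.wordProd_append]

theorem braid_eq_of_right (i : ZMod n) : ∃ j : ZMod n,
    (nilGen (i + 1) * nilGen i * nilGen (i + 1) : NilCoxeter n) =
      nilGen j * nilGen (j + 1) * nilGen j := by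
  by_cases hn : n = 2
  · refine ⟨i + 1, ?_⟩
    have : i + 1 + 1 = i := by
      subst hn
      revert i
      decide
    rw [this]
  · exact ⟨i, (braidRel_nilGen.braid hn i).symm⟩

/-- If a relator contributed at `w`, one of its terms would be a factor of a reduced factorization
of `w`. That is excluded by `321`-avoidance for braids, and for long cyclic factors by the count of
holes and particles, which bounds factors in any position and not only at the right end. -/
theorem coefCon_of_quotRel (hm : 0 < m) (hmn : m < n) {a b : NilCoxeter n}
    (h : QuotRel m n a b) : coefCon m n a b := by
  classical
  intro x y w hw
  have hcases : n ≠ 2 → ∃ l S T, (cox n).wordProd l = w ∧ #S = m ∧ Moves (n := n) l S T := by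
    intro hn
    obtain ⟨l, hl, rfl⟩ := (cox n).exists_isReduced w
    obtain ⟨S, T, h1, h2⟩ := exists_moves_of_mem_setA hn hmn.le hl hw
    exact ⟨l, S, T, rfl, h1, h2⟩
  have helt : ∀ {q v : AffineSym n}, coef q (nilElt v) ≠ 0 → v = q := by
    intro q v h
    rw [coef_nilElt] at h
    by_contra h1
    exact h (if_neg h1)
  cases h with
  | braidLeft i => rw [coef_braid_eq_zero hw.1, mul_zero, zero_mul, map_zero]
  | braidRight i =>
    obtain ⟨j, hj⟩ := braid_eq_of_right i
    rw [hj, coef_braid_eq_zero hw.1, mul_zero, zero_mul, map_zero]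
  | dec J hJ h =>
    rw [mul_zero, zero_mul, map_zero]
    by_contra h1
    obtain ⟨p, q, r, h2, h3, h4⟩ := coef_mul_mul_ne_zero h1
    obtain rfl := helt h4
    -- Here `m = 1`, and no proper subset has more than one element.
    by_cases hn : n = 2
    · have := card_lt_of_ne_univ hJ
      omega
    · obtain ⟨l, S, T, rfl, h5, h6⟩ := hcases hn
      have := h6.card_le_of_cycDec hJ h2 h3
      rw [h5] at this
      exact absurd h (not_lt.2 this)
  | inc J hJ h =>
    rw [mul_zero, zero_mul, map_zero]
    by_contra h1
    obtain ⟨p, q, r, h2, h3, h4⟩ := coef_mul_mul_ne_zero h1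
    obtain rfl := helt h4
    by_cases hn : n = 2
    · have := card_lt_of_ne_univ hJ
      omega
    · obtain ⟨l, S, T, rfl, h5, h6⟩ := hcases hn
      have := h6.card_le_of_cycInc hJ h2 h3
      rw [h5] at this
      exact absurd h (not_lt.2 this)

theorem coef_eq_zero_of_proj_eq_zero (hm : 0 < m) (hmn : m < n) {a : NilCoxeter n}
    (h : proj m n a = 0) {w : AffineSym n} (hw : w ∈ setA m n) : coef w a = 0 := by
  have hr : ∀ ⦃a b : NilCoxeter n⦄, QuotRel m n a b →
      (coefCon m n).mk' a = (coefCon m n).mk' b := fun a b h =>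
    (RingCon.eq _).2 (coefCon_of_quotRel hm hmn h)
  have h1 : RingQuot.mkRingHom (QuotRel m n) a = 0 := by
    rw [← RingQuot.mkAlgHom_coe ℤ]
    exact h
  have h2 := RingQuot.lift_mkRingHom_apply (coefCon m n).mk' hr a
  rw [h1, map_zero] at h2
  have h3 : coefCon m n 0 a := (RingCon.eq _).1 h2
  have h4 := h3 1 1 w hw
  rw [one_mul, one_mul, mul_one, mul_one, map_zero] at h4
  exact h4.symm

theorem proj_nilElt_cycDec {J : Finset (ZMod n)} (hJ : J ≠ univ) (h : n - m < J.card) :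
    proj m n (nilElt (cycDec J)) = 0 := by
  have := RingQuot.mkAlgHom_rel ℤ (QuotRel.dec J hJ h)
  rwa [map_zero] at this

theorem proj_nilElt_cycInc {J : Finset (ZMod n)} (hJ : J ≠ univ) (h : m < J.card) :
    proj m n (nilElt (cycInc J)) = 0 := by
  have := RingQuot.mkAlgHom_rel ℤ (QuotRel.inc J hJ h)
  rwa [map_zero] at this

theorem proj_nilElt_eq_zero {w : AffineSym n} (hw : w ∉ setA m n) : proj m n (nilElt w) = 0 := by
  classical
  by_contra h0
  refine hw ⟨fun l h1 h2 i h3 => h0 ?_, ?_, ?_⟩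
  · obtain ⟨p, q, rfl⟩ := h3
    have h4 := RingQuot.mkAlgHom_rel ℤ (QuotRel.braidLeft (m := m) (n := n) i)
    rw [map_zero] at h4
    rw [← h2, nilElt_wordProd h1, List.map_append, List.map_append, List.prod_append,
      List.prod_append, map_mul, map_mul]
    have e : ([i, i + 1, i].map (nilGen (n := n))).prod =
        nilGen i * nilGen (i + 1) * nilGen i := by
      simp [mul_assoc]
    have h5 : proj m n ([i, i + 1, i].map nilGen).prod = 0 := by
      rw [e]
      exact h4
    rw [h5, mul_zero, zero_mul]
  · refine Finset.sup_le fun J hJ => ?_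
    obtain ⟨-, hJ, v, h1, h2⟩ := mem_filter.1 hJ
    by_contra h3
    rw [h1] at h2
    rw [h1, ← nilElt_mul h2, map_mul, proj_nilElt_cycInc hJ (not_le.1 h3), mul_zero] at h0
    exact h0 rfl
  · refine Finset.sup_le fun J hJ => ?_
    obtain ⟨-, hJ, v, h1, h2⟩ := mem_filter.1 hJ
    by_contra h3
    rw [h1] at h2
    rw [h1, ← nilElt_mul h2, map_mul, proj_nilElt_cycDec hJ (not_le.1 h3), mul_zero] at h0
    exact h0 rfl

theorem proj_nilH_eq_zero {k : ℕ} (hk : n - m < k) : proj m n (nilH n k) = 0 := by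
  classical
  rw [nilH, map_sum]
  refine sum_eq_zero fun J hJ => ?_
  obtain ⟨-, h1, h2⟩ := mem_filter.1 hJ
  exact proj_nilElt_cycDec h1 (h2 ▸ hk)

end Kernel

/-! ### The basis of the quotient algebra -/

section Basis

/-- The terms outside `A_{(n-m,m)}` are killed by the projection, and those inside have coefficient
zero by the vanishing theorem. -/
theorem proj_noncomm_kSchur_eq_zero (hm : 0 < m) (hmn : m < n) {u : Grass n}
    (hu : u.1 ∉ setA m n) : proj m n (noncommLin n (kSchur u)) = 0 := by
  obtain ⟨c, h1, h2⟩ := eq_sum_coef (noncommLin n (kSchur u))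
  rw [h2, Finsupp.sum, map_sum]
  refine sum_eq_zero fun w _ => ?_
  rw [map_zsmul]
  by_cases hw : w ∈ setA m n
  · have : c w = 0 := by
      rw [← h1]
      by_contra h
      exact hu (mem_setA_of_coef_kSchur_ne_zero hm hmn hw h)
    rw [this, zero_zsmul]
  · rw [proj_nilElt_eq_zero hw]
    exact zsmul_zero (α := NilQuot m n) _

/-- The coefficients at `A_{(n-m,m)}` vanish on the kernel of the projection, and on these `s_u`
they are dual coordinates. -/
theorem linearIndependent_proj_kSchur (hm : 0 < m) (hmn : m < n) :
    LinearIndependent ℤ fun u : GrassA m n => proj m n (noncommLin n (kSchur u.1)) := by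
  classical
  refine (linearIndependent_iff' (R := ℤ) (M := NilQuot m n)).2 ?_
  intro s g h v hv
  have h1 : proj m n (∑ u ∈ s, g u • noncommLin n (kSchur u.1)) = 0 := by
    rw [map_sum, ← h]
    exact sum_congr rfl fun u _ => map_smul (proj m n) (g u) _
  have h2 := coef_eq_zero_of_proj_eq_zero hm hmn h1 v.2
  rw [map_sum] at h2
  simp only [map_smul, coef_kSchur, smul_eq_mul] at h2
  rw [sum_eq_single_of_mem v hv, if_pos rfl, mul_one] at h2
  · exact h2
  · intro u _ hne
    rw [if_neg fun h => hne (Subtype.ext h), mul_zero]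

theorem proj_hProd_mem (α : Fin (n - 1) →₀ ℕ) :
    proj m n (hProd n α) ∈ algB m n := by
  rw [hProd, map_list_prod]
  refine Subalgebra.list_prod_mem _ fun x hx => ?_
  rw [List.map_map] at hx
  obtain ⟨k, hk, rfl⟩ := List.mem_map.1 hx
  rw [Function.comp_apply]
  by_cases h : k ≤ n - m
  · exact Algebra.subset_adjoin ⟨k, ⟨(mem_parts hk).1, h⟩, rfl⟩
  · rw [proj_nilH_eq_zero (not_le.1 h)]
    exact Subalgebra.zero_mem _

theorem proj_noncommLin_mem (f : HRing n) :
    proj m n (noncommLin n f) ∈ algB m n := by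
  rw [noncommLin_apply, noncomm_eq_sum, map_sum]
  refine Subalgebra.sum_mem _ fun α _ => ?_
  rw [map_zsmul]
  exact (algB m n).smul_mem (proj_hProd_mem α) _

theorem noncommLin_mul (f g : HRing n) :
    noncommLin n (f * g) = noncommLin n f * noncommLin n g := by
  have h1 : ∀ α β, noncommLin n (MvPolynomial.monomial α 1 * MvPolynomial.monomial β 1) =
      noncommLin n (MvPolynomial.monomial α 1) * noncommLin n (MvPolynomial.monomial β 1) := by
    intro α β
    rw [MvPolynomial.monomial_mul, mul_one]
    simp only [noncommLin_monomial, hProd_add]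
  have h2 : ∀ (f : HRing n), f = ∑ α ∈ f.support, f.coeff α • MvPolynomial.monomial α 1 := by
    intro f
    conv_lhs => rw [f.as_sum]
    refine sum_congr rfl fun α _ => ?_
    rw [MvPolynomial.smul_monomial, smul_eq_mul, mul_one]
  rw [h2 f, h2 g, sum_mul_sum]
  simp only [map_sum, smul_mul_smul_comm, map_smul, h1, sum_mul_sum]

theorem exists_noncommLin_eq_nilH {k : ℕ} (hk : 0 < k) (hkn : k < n) :
    ∃ f : HRing n, noncommLin n f = nilH n k := by
  obtain ⟨α, hα⟩ := exists_perm_parts (n := n) (l := [k]) (by simp [hk, hkn])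
  refine ⟨MvPolynomial.monomial α 1, ?_⟩
  rw [noncommLin_monomial, hProd, prod_nilH_perm hα]
  simp

/-- By commutativity of the `𝐡_i` the map from `ℤ[h_1, …, h_{n-1}]` is multiplicative, so its image
is closed under products; `m > 0` makes each generator the image of a variable. -/
theorem exists_of_mem_algB (hm : 0 < m) {x : NilQuot m n} (hx : x ∈ algB m n) :
    ∃ f : HRing n, x = proj m n (noncommLin n f) := by
  rw [algB] at hx
  induction hx using Algebra.adjoin_induction with
  | mem x hx =>
    obtain ⟨k, hk, rfl⟩ := hx
    rw [Set.mem_Icc] at hk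
    obtain ⟨f, hf⟩ := exists_noncommLin_eq_nilH (n := n) (k := k) (by omega) (by
      have := (Fact.out : 1 < n)
      omega)
    exact ⟨f, by rw [hf]⟩
  | algebraMap r =>
    have h : parts (0 : Fin (n - 1) →₀ ℕ) = [] := by simp [parts, List.flatMap_eq_nil_iff]
    refine ⟨r • MvPolynomial.monomial 0 1, ?_⟩
    rw [map_smul, noncommLin_monomial, map_zsmul, hProd, h, List.map_nil, List.prod_nil, map_one]
    exact Algebra.algebraMap_eq_smul_one r
  | add x y _ _ hx hy =>
    obtain ⟨f, rfl⟩ := hx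
    obtain ⟨g, rfl⟩ := hy
    exact ⟨f + g, by rw [map_add, map_add]⟩
  | mul x y _ _ hx hy =>
    obtain ⟨f, rfl⟩ := hx
    obtain ⟨g, rfl⟩ := hy
    exact ⟨f * g, by rw [noncommLin_mul, map_mul]⟩

theorem span_proj_kSchur (hm : 0 < m) (hmn : m < n) :
    Submodule.span ℤ (Set.range fun u : GrassA m n => proj m n (noncommLin n (kSchur u.1))) =
      Subalgebra.toSubmodule (algB m n) := by
  refine le_antisymm (Submodule.span_le.2 ?_) ?_
  · rintro _ ⟨u, rfl⟩
    exact proj_noncommLin_mem _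
  · intro x hx
    obtain ⟨f, rfl⟩ := exists_of_mem_algB hm hx
    obtain ⟨c, -, hf⟩ := exists_eq_sum_kSchur f
    rw [hf, Finsupp.sum, map_sum, map_sum]
    refine Submodule.sum_mem _ fun u _ => ?_
    rw [map_smul, map_zsmul]
    refine Submodule.smul_mem _ _ ?_
    by_cases hu : u.1 ∈ setA m n
    · exact Submodule.subset_span ⟨⟨u, hu⟩, rfl⟩
    · rw [proj_noncomm_kSchur_eq_zero hm hmn hu]
      exact Submodule.zero_mem _

end Basis

end AffineStanley

end

theorem theorem4p13 (m n : ℕ) [NeZero n] (hm : 0 < m) (hmn : m < n) :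
    -- each `F_w` has a unique expansion `F_w = ∑_u c^w_u F_u` into affine Schur functions
    (∀ w : AffineSym n,
      ∃! c : Grass n →₀ ℤ, IsAffineSchurExpansion w c) ∧
    -- if `w` is `321`-avoiding, then `c^w_u = 0` unless `u` is `321`-avoiding
    (∀ (w : AffineSym n) (c : Grass n →₀ ℤ),
      IsAffineSchurExpansion w c → Is321Avoiding w →
      ∀ u : Grass n, ¬ Is321Avoiding u.1 → c u = 0) ∧
    -- if moreover `maxc w ≤ m` and `maxr w ≤ n - m`, then `c^w_u = 0` unless `u ∈ A⁰_{(n-m,m)}`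
    (∀ (w : AffineSym n) (c : Grass n →₀ ℤ),
      IsAffineSchurExpansion w c → Is321Avoiding w →
      maxc w ≤ m → maxr w ≤ n - m →
      ∀ u : Grass n, u.1 ∉ setA m n → c u = 0) ∧
    -- the `k`-Schur functions exist and are unique, and the images in `𝔸_{m,n}` of the
    -- noncommutative ones with `u ∈ A⁰_{(n-m,m)}` form a `ℤ`-basis of `𝔹_{m,n}`
    (∃! s : Grass n → HRing n, IsKSchurFamily s) ∧
    (∀ s : Grass n → HRing n, IsKSchurFamily s →
      LinearIndependent ℤ (fun u : GrassA m n =>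
        proj m n (noncomm (s u.1))) ∧
      Submodule.span ℤ (Set.range fun u : GrassA m n =>
        proj m n (noncomm (s u.1))) =
        Subalgebra.toSubmodule (algB m n)) := by
  have : Fact (1 < n) := ⟨by omega⟩
  refine ⟨existsUnique_isAffineSchurExpansion, fun w c hc hw u hu => ?_,
    fun w c hc hw h1 h2 u hu => ?_, existsUnique_isKSchurFamily, fun s hs => ?_⟩
  · rw [(isAffineSchurExpansion_iff_coef w c).1 hc]
    by_contra h
    exact hu (is321Avoiding_of_coef_kSchur hw h)
  · rw [(isAffineSchurExpansion_iff_coef w c).1 hc]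
    by_contra h
    exact hu (mem_setA_of_coef_kSchur_ne_zero hm hmn ⟨hw, h1, h2⟩ h)
  · obtain rfl := (isKSchurFamily_iff s).1 hs
    simp only [← noncommLin_apply]
    exact ⟨linearIndependent_proj_kSchur hm hmn, span_proj_kSchur hm hmn⟩
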